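/- Let $\mathbf{2}\text{-}\mathbf{Cat}$ be the category of small (strict) 2-categories and (strict) 2-functors, with the monoidal structure $(\boxtimes,\mathbf 1)$ given by the Gray tensor product: the 0-cells of $A\boxtimes B$ are pairs $(a,b)$; its 1-cells are words in the generators $(f,b):(a,b)\to(a',b)$ and $(a,g):(a,b)\to(a,b')$, for 1-cells $f$ of $A$ and $g$ of $B$, modulo functoriality in $f$ and in $g$; its 2-cells $u\Rightarrow v$ are the pairs of 2-cells between the projections of $u$ and $v$ on $A$ and on $B$. The unit $\mathbf 1$ is the terminal 2-category. For a set $L$, let $\langle L\rangle$ be the strict symmetric monoidal category freely generated by $L$, seen as a 2-category with one 0-cell: its 1-cells are the words over $L$ (composed by concatenation, written in the order of time) and its 2-cells $u\Rightarrow v$ are the label-preserving bijections between the positions of $u$ and of $v$. Below, a 2-functor $\langle L\rangle\to\langle L'\rangle$ "given on letters" by a partial function $L\rightharpoonup L'$ renames the letters on which this function is defined, erases the others, and restricts the bijections. A 2-functor from $\langle L\rangle$ to a tensor product of 2-categories $\langle L_i\rangle$ "given on letters" by words in the disjoint union of the $L_i$, each word containing at most one letter of each $L_i$, is the 2-functor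 with these values on the letters whose projection on each $\langle L_i\rangle$ is the 2-functor given on letters by the corresponding partial function. Comonoids and bicomodules are taken in $(\mathbf{2}\text{-}\mathbf{Cat},\boxtimes,\mathbf 1)$. For comonoids $(A,d_A,e_A)$ and $(B,d_B,e_B)$, an $A,B$-bicomodule is an object $S$ with a coaction $c_S:S\to A\boxtimes S\boxtimes B$ such that $(A\boxtimes c_S\boxtimes B)\circ c_S=(d_A\boxtimes S\boxtimes d_B)\circ c_S$ and $(e_A\boxtimes S\boxtimes e_B)\circ c_S=\mathrm{id}_S$; composing $c_S$ with $e_B$ or with $e_A$ gives its left coaction $c_S^{\ell}:S\to A\boxtimes S$ and its right coaction $c_S^{r}:S\to S\boxtimes B$. A morphism of $A,B$-bicomodules (a double cell with identity vertical edges) is a morphism $\theta:S\to S'$ with $c_{S'}\circ\theta=(A\boxtimes\theta\boxtimes B)\circ c_S$. The horizontal composite $S\boxtimes_B T$ of an $A,B$-bicomodule $S$ and a $B,D$-bicomodule $T$ is the equalizer $\mathrm{equ}:S\boxtimes_B T\to S\boxtimes T$ of $c_S^{r}\boxtimes T$ and $S\boxtimes c_T^{\ell}$, provided that $A\boxtimes\mathrm{equ}\boxtimes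 D$ is again an equalizer of the tensored pair; its coaction is the one induced by $c_S^{\ell}\boxtimes c_T^{r}$. The identity bicomodule on $A$ is $A$ with coaction $(A\boxtimes d_A)\circ d_A$. Let $M_0=\langle O,P\rangle$, with $$d:M_0\to M_0\boxtimes M_0,\quad O\mapsto O_2\cdot O_1,\quad P\mapsto P_1\cdot P_2,\qquad e:M_0\to\mathbf 1,$$ and let $M_1=\langle O_s,P_s,O_t,P_t\rangle$, with $\mathrm{coact}:M_1\to M_0\boxtimes M_1\boxtimes M_0$ given on letters by $$O_s\mapsto P_1\cdot O_s,\quad P_s\mapsto P_s\cdot O_1,\quad O_t\mapsto O_3\cdot O_t,\quad P_t\mapsto P_t\cdot P_3,$$ where the indices indicate the component of the tensor product. Then $(M_0,d,e)$ is a comonoid, $(M_1,\mathrm{coact})$ is an $M_0,M_0$-bicomodule, the horizontal composites $M_2=M_1\boxtimes_{M_0}M_1$, $M_2\boxtimes_{M_0}M_1$ and $M_1\boxtimes_{M_0}M_2$ exist, the last two are isomorphic compatibly with their morphisms to $M_1\boxtimes M_1\boxtimes M_1$ (write $M_3=M_2\boxtimes_{M_0}M_1$), and there are bicomodule morphisms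 $\mathrm{mult}:M_2\to M_1$ and $\mathrm{unit}:M_0\to M_1$ (from the identity bicomodule on $M_0$) which satisfy the associativity law $\mathrm{mult}\circ(\mathrm{mult}\boxtimes_{M_0}M_1)=\mathrm{mult}\circ(M_1\boxtimes_{M_0}\mathrm{mult})$ and the two neutrality laws $\mathrm{mult}\circ(\mathrm{unit}\boxtimes_{M_0}M_1)=\mathrm{id}_{M_1}=\mathrm{mult}\circ(M_1\boxtimes_{M_0}\mathrm{unit})$. In other words, these data are a monad in the weak double category of comonoids and bicomodules in $(\mathbf{2}\text{-}\mathbf{Cat},\boxtimes,\mathbf 1)$, that is, an internal category in the sense of Aguiar. Moreover: 1. $M_2\cong\langle O_s,P_s,PO,OP,O_t,P_t\rangle$. Under this isomorphism, the inclusion $\mathrm{equ}:M_2\to M_1\boxtimes M_1$ is given on letters by $O_s\mapsto O_s^{1}$, $P_s\mapsto P_s^{1}$, $PO\mapsto P_s^{2}\cdot O_t^{1}$, $OP\mapsto P_t^{1}\cdot O_s^{2}$, $O_t\mapsto O_t^{2}$, $P_t\mapsto P_t^{2}$ (the exponents indicate the component), and $\mathrm{mult}$ is given on letters by keeping $O_s,P_s,O_t,P_t$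 and erasing the internal moves $PO$ and $OP$ (they are sent to the identity). 2. $M_3\cong\langle O_s,P_s,PO_s,OP_s,PO_t,OP_t,O_t,P_t\rangle$. Under this isomorphism, the inclusion $M_3\to M_1\boxtimes M_1\boxtimes M_1$ is given on letters by $O_s\mapsto O_s^{1}$, $P_s\mapsto P_s^{1}$, $PO_s\mapsto P_s^{2}\cdot O_t^{1}$, $OP_s\mapsto P_t^{1}\cdot O_s^{2}$, $PO_t\mapsto P_s^{3}\cdot O_t^{2}$, $OP_t\mapsto P_t^{2}\cdot O_s^{3}$, $O_t\mapsto O_t^{3}$, $P_t\mapsto P_t^{3}$. -/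

import Mathlib

section TwoCategories

open CategoryTheory Bicategory

/-- A small strict 2-category. -/
structure TwoCat : Type 1 where
  carrier : Type
  [bicategory : Bicategory.{0, 0} carrier]
  [strict : Bicategory.Strict carrier]

namespace TwoCat

instance : CoeSort TwoCat Type := ⟨TwoCat.carrier⟩
instance (A : TwoCat) : Bicategory.{0, 0} A := A.bicategory
instance (A : TwoCat) : Bicategory.Strict A := A.strict

theorem strictPseudofunctor_ext {A B : TwoCat} {F G : StrictPseudofunctor A B}
    (h : F.toPrelaxFunctor = G.toPrelaxFunctor) : F = G := by
  obtain ⟨⟨⟨F0, mid, mcomp, _, _, _, _, _⟩, hid, hmid⟩, hc, hmc⟩ := F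
  obtain ⟨⟨⟨G0, mid', mcomp', _, _, _, _, _⟩, hid', hmid'⟩, hc', hmc'⟩ := G
  dsimp at h
  subst h
  have e1 : mid = mid' := by
    funext a; exact (hmid a).trans (hmid' a).symm
  have e2 : @mcomp = @mcomp' := by
    funext a b c f g; exact (hmc f g).trans (hmc' f g).symm
  subst e1; subst e2; rfl

/-- The category of small 2-categories and (strict) 2-functors. -/
instance : Category TwoCat where
  Hom A B := StrictPseudofunctor A B
  id A := StrictPseudofunctor.id A
  comp F G := StrictPseudofunctor.comp F G
  id_comp _ := strictPseudofunctor_ext rfl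
  comp_id _ := strictPseudofunctor_ext rfl
  assoc _ _ _ := strictPseudofunctor_ext rfl

/-- A 2-functor from its action on cells and the strict preservation laws. -/
def ofCore {A B : TwoCat} (S : StrictPseudofunctorPreCore A B) : A ⟶ B :=
  StrictPseudofunctor.mk'' S

section
variable {A B C : TwoCat}

/-- The action of a 2-functor on objects. -/
abbrev obj (F : A ⟶ B) (a : A) : B := (show StrictPseudofunctor A B from F).obj a

/-- The action of a 2-functor on 1-cells. -/
abbrev map (F : A ⟶ B) {a b : A} (f : a ⟶ b) : obj F a ⟶ obj F b :=
  (show StrictPseudofunctor A B from F).map f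

/-- The action of a 2-functor on 2-cells. -/
abbrev map₂ (F : A ⟶ B) {a b : A} {f g : a ⟶ b} (η : f ⟶ g) : map F f ⟶ map F g :=
  (show StrictPseudofunctor A B from F).map₂ η

theorem map_id (F : A ⟶ B) (a : A) : map F (𝟙 a) = 𝟙 (obj F a) :=
  (show StrictPseudofunctor A B from F).map_id a

theorem map_comp (F : A ⟶ B) {a b c : A} (f : a ⟶ b) (g : b ⟶ c) :
    map F (f ≫ g) = map F f ≫ map F g :=
  (show StrictPseudofunctor A B from F).map_comp f g

theorem map₂_id (F : A ⟶ B) {a b : A} (f : a ⟶ b) : map₂ F (𝟙 f) = 𝟙 (map F f) :=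
  (show StrictPseudofunctor A B from F).map₂_id f

theorem map₂_comp (F : A ⟶ B) {a b : A} {f g h : a ⟶ b} (η : f ⟶ g) (θ : g ⟶ h) :
    map₂ F (η ≫ θ) = map₂ F η ≫ map₂ F θ :=
  (show StrictPseudofunctor A B from F).map₂_comp η θ

theorem map₂_whiskerLeft (F : A ⟶ B) {a b c : A} (f : a ⟶ b) {g h : b ⟶ c} (η : g ⟶ h) :
    map₂ F (f ◁ η) = eqToHom (map_comp F f g) ≫ map F f ◁ map₂ F η ≫
      eqToHom (map_comp F f h).symm := by
  have := (show StrictPseudofunctor A B from F).map₂_whisker_left f η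
  rw [StrictPseudofunctor.mapComp_eq_eqToIso, StrictPseudofunctor.mapComp_eq_eqToIso] at this
  simpa using this

theorem map₂_whiskerRight (F : A ⟶ B) {a b c : A} {f g : a ⟶ b} (η : f ⟶ g) (h : b ⟶ c) :
    map₂ F (η ▷ h) = eqToHom (map_comp F f h) ≫ map₂ F η ▷ map F h ≫
      eqToHom (map_comp F g h).symm := by
  have := (show StrictPseudofunctor A B from F).map₂_whisker_right η h
  rw [StrictPseudofunctor.mapComp_eq_eqToIso, StrictPseudofunctor.mapComp_eq_eqToIso] at this
  simpa using this

theorem hom_ext {F G : A ⟶ B} (h₀ : ∀ a, obj F a = obj G a)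
    (h₁ : ∀ {a b : A} (f : a ⟶ b), HEq (map F f) (map G f))
    (h₂ : ∀ {a b : A} {f g : a ⟶ b} (η : f ⟶ g), HEq (map₂ F η) (map₂ G η)) : F = G := by
  apply strictPseudofunctor_ext
  obtain ⟨⟨⟨⟨⟨⟨F0, F1⟩, F2⟩, _, _⟩, _, _, _, _, _, _, _⟩, _, _⟩, _, _⟩ := F
  obtain ⟨⟨⟨⟨⟨⟨G0, G1⟩, G2⟩, _, _⟩, _, _, _, _, _, _, _⟩, _, _⟩, _, _⟩ := G
  dsimp [obj, map, map₂] at *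
  obtain rfl : F0 = G0 := funext h₀
  obtain rfl : @F1 = @G1 := by
    funext a b f; exact eq_of_heq (h₁ f)
  obtain rfl : @F2 = @G2 := by
    funext a b f g η; exact eq_of_heq (h₂ η)
  rfl

end

end TwoCat

open TwoCat

/-- Objects of the category generated by the 1-cells `(f, b)` and `(a, g)`. -/
structure FunnyObj (A B : TwoCat) where
  fst : A
  snd : B

/-- The generating 1-cells `(f, b) : (a, b) ⟶ (a', b)` and `(a, g) : (a, b) ⟶ (a, b')`. -/
inductive FunnyGen (A B : TwoCat) : FunnyObj A B → FunnyObj A B → Type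
  | left {a a' : A} (f : a ⟶ a') (b : B) : FunnyGen A B ⟨a, b⟩ ⟨a', b⟩
  | right (a : A) {b b' : B} (g : b ⟶ b') : FunnyGen A B ⟨a, b⟩ ⟨a, b'⟩

instance (A B : TwoCat) : Quiver (FunnyObj A B) := ⟨FunnyGen A B⟩

namespace Funny

variable {A B : TwoCat}

/-- The path of length one on a generator `(f, b)`. -/
def pathL {a a' : A} (f : a ⟶ a') (b : B) :
    (show Paths (FunnyObj A B) from ⟨a, b⟩) ⟶ (show Paths (FunnyObj A B) from ⟨a', b⟩) :=
  Quiver.Hom.toPath (FunnyGen.left f b : (⟨a, b⟩ : FunnyObj A B) ⟶ ⟨a', b⟩)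

/-- The path of length one on a generator `(a, g)`. -/
def pathR (a : A) {b b' : B} (g : b ⟶ b') :
    (show Paths (FunnyObj A B) from ⟨a, b⟩) ⟶ (show Paths (FunnyObj A B) from ⟨a, b'⟩) :=
  Quiver.Hom.toPath (FunnyGen.right a g : (⟨a, b⟩ : FunnyObj A B) ⟶ ⟨a, b'⟩)

/-- The four families of relations between paths. -/
inductive Rel (A B : TwoCat) : HomRel (Paths (FunnyObj A B))
  | left_id (a : A) (b : B) : Rel A B (pathL (𝟙 a) b) (𝟙 _)
  | left_comp {a a' a'' : A} (f : a ⟶ a') (f' : a' ⟶ a'') (b : B) :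
      Rel A B (pathL (f ≫ f') b) (pathL f b ≫ pathL f' b)
  | right_id (a : A) (b : B) : Rel A B (pathR a (𝟙 b)) (𝟙 _)
  | right_comp (a : A) {b b' b'' : B} (g : b ⟶ b') (g' : b' ⟶ b'') :
      Rel A B (pathR a (g ≫ g')) (pathR a g ≫ pathR a g')

variable (A B) in
/-- The category of words in the generators, modulo the relations (the funny tensor product of the
underlying categories). -/
abbrev Cat : Type := CategoryTheory.Quotient (Rel A B)

/-- The pair `(a, b)` as an object. -/
abbrev pt (a : A) (b : B) : Cat A B := ⟨(⟨a, b⟩ : FunnyObj A B)⟩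

/-- The class of the generator `(f, b)`. -/
def inl {a a' : A} (f : a ⟶ a') (b : B) : pt a b ⟶ pt a' b :=
  (CategoryTheory.Quotient.functor (Rel A B)).map (pathL f b)

/-- The class of the generator `(a, g)`. -/
def inr (a : A) {b b' : B} (g : b ⟶ b') : pt a b ⟶ pt a b' :=
  (CategoryTheory.Quotient.functor (Rel A B)).map (pathR a g)

theorem inl_id (a : A) (b : B) : inl (𝟙 a) b = 𝟙 (pt a b) :=
  CategoryTheory.Quotient.sound _ (Rel.left_id a b)

theorem inl_comp {a a' a'' : A} (f : a ⟶ a') (f' : a' ⟶ a'') (b : B) :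
    inl (f ≫ f') b = inl f b ≫ inl f' b :=
  CategoryTheory.Quotient.sound _ (Rel.left_comp f f' b)

theorem inr_id (a : A) (b : B) : inr a (𝟙 b) = 𝟙 (pt a b) :=
  CategoryTheory.Quotient.sound _ (Rel.right_id a b)

theorem inr_comp (a : A) {b b' b'' : B} (g : b ⟶ b') (g' : b' ⟶ b'') :
    inr a (g ≫ g') = inr a g ≫ inr a g' :=
  CategoryTheory.Quotient.sound _ (Rel.right_comp a g g')

theorem induction {P : ∀ {x y : Cat A B}, (x ⟶ y) → Prop}
    (hid : ∀ x : Cat A B, P (𝟙 x))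
    (hcomp : ∀ {x y z : Cat A B} (u : x ⟶ y) (v : y ⟶ z), P u → P v → P (u ≫ v))
    (hl : ∀ {a a' : A} (f : a ⟶ a') (b : B), P (inl f b))
    (hr : ∀ (a : A) {b b' : B} (g : b ⟶ b'), P (inr a g))
    {x y : Cat A B} (u : x ⟶ y) : P u := by
  refine CategoryTheory.Quotient.induction (P := fun u => P u) (r := Rel A B) ?_ u
  intro a b f
  refine Paths.induction (fun f => P ((CategoryTheory.Quotient.functor (Rel A B)).map f)) ?_ ?_ f
  · intro v; exact hid _
  · intro u v w p q hp
    have e : (CategoryTheory.Quotient.functor (Rel A B)).map (p ≫ (Paths.of _).map q) =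
      (CategoryTheory.Quotient.functor (Rel A B)).map p ≫ (CategoryTheory.Quotient.functor (Rel A B)).map ((Paths.of _).map q) :=
      CategoryTheory.Functor.map_comp _ _ _
    rw [e]
    refine hcomp _ _ hp ?_
    change FunnyGen A B v w at q
    cases q with
    | left f b => exact hl f b
    | right a g => exact hr a g

/-- The universal property: a functor on words is given on generators. -/
structure LiftData (A B : TwoCat) (X : Type*) [Category X] where
  obj : A → B → X
  left {a a' : A} (f : a ⟶ a') (b : B) : obj a b ⟶ obj a' b
  right (a : A) {b b' : B} (g : b ⟶ b') : obj a b ⟶ obj a b'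
  left_id (a : A) (b : B) : left (𝟙 a) b = 𝟙 _
  left_comp {a a' a'' : A} (f : a ⟶ a') (f' : a' ⟶ a'') (b : B) :
    left (f ≫ f') b = left f b ≫ left f' b
  right_id (a : A) (b : B) : right a (𝟙 b) = 𝟙 _
  right_comp (a : A) {b b' b'' : B} (g : b ⟶ b') (g' : b' ⟶ b'') :
    right a (g ≫ g') = right a g ≫ right a g'

/-- The functor on words determined by its values on the generators. -/
def lift {X : Type*} [Category X] (D : LiftData A B X) : Cat A B ⥤ X :=
  CategoryTheory.Quotient.lift _
    (Paths.lift (V := FunnyObj A B)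
      { obj := fun x => D.obj x.fst x.snd
        map := fun {_ _} u => match u with
          | FunnyGen.left f b => D.left f b
          | FunnyGen.right a g => D.right a g })
    (by
      intro x y u v h
      cases h with
      | left_id a b => exact (Category.id_comp _).trans (D.left_id a b)
      | left_comp f f' b =>
        exact (Category.id_comp _).trans ((D.left_comp f f' b).trans (by
          rw [CategoryTheory.Functor.map_comp]; congr 1 <;> exact (Category.id_comp _).symm))
      | right_id a b => exact (Category.id_comp _).trans (D.right_id a b)
      | right_comp a g g' =>
        exact (Category.id_comp _).trans ((D.right_comp a g g').trans (by
          rw [CategoryTheory.Functor.map_comp]; congr 1 <;> exact (Category.id_comp _).symm)))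

section
variable {X : Type*} [Category X] (D : LiftData A B X)

theorem lift_inl {a a' : A} (f : a ⟶ a') (b : B) : (lift D).map (inl f b) = D.left f b :=
  Category.id_comp _

theorem lift_inr (a : A) {b b' : B} (g : b ⟶ b') : (lift D).map (inr a g) = D.right a g :=
  Category.id_comp _

end

variable (A B) in
/-- The first projection on words. -/
def fst : Cat A B ⥤ A := lift
  { obj := fun a _ => a
    left := fun f _ => f
    right := fun a _ _ _ => 𝟙 a
    left_id := fun _ _ => rfl
    left_comp := fun _ _ _ => rfl
    right_id := fun _ _ => rfl
    right_comp := fun _ _ _ _ _ _ => (Category.id_comp _).symm }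

variable (A B) in
/-- The second projection on words. -/
def snd : Cat A B ⥤ B := lift
  { obj := fun _ b => b
    left := fun _ b => 𝟙 b
    right := fun _ _ _ g => g
    left_id := fun _ _ => rfl
    left_comp := fun _ _ _ => (Category.id_comp _).symm
    right_id := fun _ _ => rfl
    right_comp := fun _ _ _ _ _ _ => rfl }

end Funny

/-- Objects of the Gray tensor product. -/
structure GrayObj (A B : TwoCat) where
  fst : A
  snd : B

/-- A 1-cell of the Gray tensor product is a word in the generators modulo the relations. The two
projections of the word are recorded, together with equations which determine them. -/
structure GrayHom {A B : TwoCat} (x y : GrayObj A B) where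
  word : Funny.pt x.fst x.snd ⟶ Funny.pt y.fst y.snd
  fst : x.fst ⟶ y.fst
  snd : x.snd ⟶ y.snd
  map_fst : (Funny.fst A B).map word = fst
  map_snd : (Funny.snd A B).map word = snd

/-- A 2-cell of the Gray tensor product is a pair of 2-cells between the projections. -/
structure GrayHom₂ {A B : TwoCat} {x y : GrayObj A B} (u v : GrayHom x y) where
  fst : u.fst ⟶ v.fst
  snd : u.snd ⟶ v.snd

namespace Gray

variable {A B : TwoCat}

theorem hom_ext' {x y : GrayObj A B} {u v : GrayHom x y} (h : u.word = v.word) : u = v := by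
  obtain ⟨w, f, g, rfl, rfl⟩ := u
  obtain ⟨w', f', g', rfl, rfl⟩ := v
  dsimp at h
  subst h; rfl

theorem hom₂_ext' {x y : GrayObj A B} {u v : GrayHom x y} {η θ : GrayHom₂ u v}
    (h : η.fst = θ.fst) (h' : η.snd = θ.snd) : η = θ := by
  cases η; cases θ; dsimp at h h'; subst h; subst h'; rfl

instance : CategoryStruct (GrayObj A B) where
  Hom x y := GrayHom x y
  id x := ⟨𝟙 _, 𝟙 _, 𝟙 _, CategoryTheory.Functor.map_id _ _, CategoryTheory.Functor.map_id _ _⟩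
  comp u v := ⟨u.word ≫ v.word, u.fst ≫ v.fst, u.snd ≫ v.snd,
    by rw [CategoryTheory.Functor.map_comp, u.map_fst, v.map_fst]; rfl, by rw [CategoryTheory.Functor.map_comp, u.map_snd, v.map_snd]; rfl⟩

instance (x y : GrayObj A B) : Category (x ⟶ y) where
  Hom u v := GrayHom₂ u v
  id _ := ⟨𝟙 _, 𝟙 _⟩
  comp η θ := ⟨η.fst ≫ θ.fst, η.snd ≫ θ.snd⟩
  id_comp _ := hom₂_ext' (Category.id_comp _) (Category.id_comp _)
  comp_id _ := hom₂_ext' (Category.comp_id _) (Category.comp_id _)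
  assoc _ _ _ := hom₂_ext' (Category.assoc _ _ _) (Category.assoc _ _ _)

section
variable {x y z w : GrayObj A B}

@[simp] theorem id_word (x : GrayObj A B) : GrayHom.word (𝟙 x) = 𝟙 _ := rfl
@[simp] theorem id_fst (x : GrayObj A B) : GrayHom.fst (𝟙 x) = 𝟙 _ := rfl
@[simp] theorem id_snd (x : GrayObj A B) : GrayHom.snd (𝟙 x) = 𝟙 _ := rfl
@[simp] theorem comp_word (u : x ⟶ y) (v : y ⟶ z) :
    GrayHom.word (u ≫ v) = GrayHom.word u ≫ GrayHom.word v := rfl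
@[simp] theorem comp_fst (u : x ⟶ y) (v : y ⟶ z) :
    GrayHom.fst (u ≫ v) = GrayHom.fst u ≫ GrayHom.fst v := rfl
@[simp] theorem comp_snd (u : x ⟶ y) (v : y ⟶ z) :
    GrayHom.snd (u ≫ v) = GrayHom.snd u ≫ GrayHom.snd v := rfl
@[simp] theorem id₂_fst (u : x ⟶ y) : GrayHom₂.fst (𝟙 u) = 𝟙 _ := rfl
@[simp] theorem id₂_snd (u : x ⟶ y) : GrayHom₂.snd (𝟙 u) = 𝟙 _ := rfl
@[simp] theorem comp₂_fst {u v w : x ⟶ y} (η : u ⟶ v) (θ : v ⟶ w) :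
    GrayHom₂.fst (η ≫ θ) = GrayHom₂.fst η ≫ GrayHom₂.fst θ := rfl
@[simp] theorem comp₂_snd {u v w : x ⟶ y} (η : u ⟶ v) (θ : v ⟶ w) :
    GrayHom₂.snd (η ≫ θ) = GrayHom₂.snd η ≫ GrayHom₂.snd θ := rfl

theorem hom_ext {u v : x ⟶ y} (h : GrayHom.word u = GrayHom.word v) : u = v := hom_ext' h

theorem hom₂_ext {u v : x ⟶ y} {η θ : u ⟶ v} (h : GrayHom₂.fst η = GrayHom₂.fst θ)
    (h' : GrayHom₂.snd η = GrayHom₂.snd θ) : η = θ := hom₂_ext' h h'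

@[simp] theorem eqToHom_fst {u v : x ⟶ y} (h : u = v) :
    GrayHom₂.fst (eqToHom h) = eqToHom (congrArg GrayHom.fst h) := by subst h; rfl
@[simp] theorem eqToHom_snd {u v : x ⟶ y} (h : u = v) :
    GrayHom₂.snd (eqToHom h) = eqToHom (congrArg GrayHom.snd h) := by subst h; rfl

/-- An invertible 2-cell from invertible components. -/
def mkIso (u v : x ⟶ y) (h : GrayHom.fst u ≅ GrayHom.fst v) (h' : GrayHom.snd u ≅ GrayHom.snd v) :
    u ≅ v where
  hom := ⟨h.hom, h'.hom⟩
  inv := ⟨h.inv, h'.inv⟩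
  hom_inv_id := hom₂_ext h.hom_inv_id h'.hom_inv_id
  inv_hom_id := hom₂_ext h.inv_hom_id h'.inv_hom_id

end

instance : Bicategory (GrayObj A B) where
  whiskerLeft u _ _ η := GrayHom₂.mk (GrayHom.fst u ◁ GrayHom₂.fst η) (GrayHom.snd u ◁ GrayHom₂.snd η)
  whiskerRight η u := GrayHom₂.mk (GrayHom₂.fst η ▷ GrayHom.fst u) (GrayHom₂.snd η ▷ GrayHom.snd u)
  associator u v w := mkIso _ _ (α_ u.fst v.fst w.fst) (α_ u.snd v.snd w.snd)
  leftUnitor u := mkIso _ _ (λ_ u.fst) (λ_ u.snd)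
  rightUnitor u := mkIso _ _ (ρ_ u.fst) (ρ_ u.snd)
  whiskerLeft_id _ _ := hom₂_ext (whiskerLeft_id _ _) (whiskerLeft_id _ _)
  whiskerLeft_comp _ _ _ _ _ _ := hom₂_ext (whiskerLeft_comp _ _ _) (whiskerLeft_comp _ _ _)
  id_whiskerLeft _ := hom₂_ext (id_whiskerLeft _) (id_whiskerLeft _)
  comp_whiskerLeft _ _ _ _ _ := hom₂_ext (comp_whiskerLeft _ _ _) (comp_whiskerLeft _ _ _)
  id_whiskerRight _ _ := hom₂_ext (id_whiskerRight _ _) (id_whiskerRight _ _)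
  comp_whiskerRight _ _ _ := hom₂_ext (comp_whiskerRight _ _ _) (comp_whiskerRight _ _ _)
  whiskerRight_id _ := hom₂_ext (whiskerRight_id _) (whiskerRight_id _)
  whiskerRight_comp _ _ _ := hom₂_ext (whiskerRight_comp _ _ _) (whiskerRight_comp _ _ _)
  whisker_assoc _ _ _ _ _ := hom₂_ext (whisker_assoc _ _ _) (whisker_assoc _ _ _)
  whisker_exchange _ _ := hom₂_ext (whisker_exchange _ _) (whisker_exchange _ _)
  pentagon _ _ _ _ := hom₂_ext (pentagon _ _ _ _) (pentagon _ _ _ _)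
  triangle _ _ := hom₂_ext (triangle _ _) (triangle _ _)

instance : Bicategory.Strict (GrayObj A B) where
  id_comp _ := hom_ext (Category.id_comp _)
  comp_id _ := hom_ext (Category.comp_id _)
  assoc _ _ _ := hom_ext (Category.assoc _ _ _)
  leftUnitor_eqToIso u := by
    ext
    apply hom₂_ext
    · simp only [eqToIso.hom, eqToHom_fst]
      exact congrArg Iso.hom (Bicategory.Strict.leftUnitor_eqToIso u.fst)
    · simp only [eqToIso.hom, eqToHom_snd]
      exact congrArg Iso.hom (Bicategory.Strict.leftUnitor_eqToIso u.snd)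
  rightUnitor_eqToIso u := by
    ext
    apply hom₂_ext
    · simp only [eqToIso.hom, eqToHom_fst]
      exact congrArg Iso.hom (Bicategory.Strict.rightUnitor_eqToIso u.fst)
    · simp only [eqToIso.hom, eqToHom_snd]
      exact congrArg Iso.hom (Bicategory.Strict.rightUnitor_eqToIso u.snd)
  associator_eqToIso u v w := by
    ext
    apply hom₂_ext
    · simp only [eqToIso.hom, eqToHom_fst]
      exact congrArg Iso.hom (Bicategory.Strict.associator_eqToIso u.fst v.fst w.fst)
    · simp only [eqToIso.hom, eqToHom_snd]
      exact congrArg Iso.hom (Bicategory.Strict.associator_eqToIso u.snd v.snd w.snd)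

/-- The generating 1-cell `(f, b)`. -/
def inl {a a' : A} (f : a ⟶ a') (b : B) : (⟨a, b⟩ : GrayObj A B) ⟶ ⟨a', b⟩ :=
  GrayHom.mk (Funny.inl f b) f (𝟙 b) (Funny.lift_inl _ f b) (Funny.lift_inl _ f b)

/-- The generating 1-cell `(a, g)`. -/
def inr (a : A) {b b' : B} (g : b ⟶ b') : (⟨a, b⟩ : GrayObj A B) ⟶ ⟨a, b'⟩ :=
  GrayHom.mk (Funny.inr a g) (𝟙 a) g (Funny.lift_inr _ a g) (Funny.lift_inr _ a g)

theorem inl_id (a : A) (b : B) : inl (𝟙 a) b = 𝟙 _ := hom_ext (Funny.inl_id a b)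

theorem inl_comp {a a' a'' : A} (f : a ⟶ a') (f' : a' ⟶ a'') (b : B) :
    inl (f ≫ f') b = inl f b ≫ inl f' b := hom_ext (Funny.inl_comp f f' b)

theorem inr_id (a : A) (b : B) : inr a (𝟙 b) = 𝟙 _ := hom_ext (Funny.inr_id a b)

theorem inr_comp (a : A) {b b' b'' : B} (g : b ⟶ b') (g' : b' ⟶ b'') :
    inr a (g ≫ g') = inr a g ≫ inr a g' := hom_ext (Funny.inr_comp a g g')

/-- The 1-cell defined by a word. -/
def ofWord {x y : GrayObj A B} (w : Funny.pt x.fst x.snd ⟶ Funny.pt y.fst y.snd) : x ⟶ y :=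
  GrayHom.mk w _ _ rfl rfl

theorem induction {P : ∀ {x y : GrayObj A B}, (x ⟶ y) → Prop}
    (hid : ∀ x : GrayObj A B, P (𝟙 x))
    (hcomp : ∀ {x y z : GrayObj A B} (u : x ⟶ y) (v : y ⟶ z), P u → P v → P (u ≫ v))
    (hl : ∀ {a a' : A} (f : a ⟶ a') (b : B), P (inl f b))
    (hr : ∀ (a : A) {b b' : B} (g : b ⟶ b'), P (inr a g))
    {x y : GrayObj A B} (u : x ⟶ y) : P u := by
  have key : ∀ {x y : Funny.Cat A B} (w : x ⟶ y),
      P (ofWord (x := ⟨x.as.fst, x.as.snd⟩) (y := ⟨y.as.fst, y.as.snd⟩) w) := by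
    intro x y w
    refine Funny.induction (P := fun {x y} w =>
      P (ofWord (x := ⟨x.as.fst, x.as.snd⟩) (y := ⟨y.as.fst, y.as.snd⟩) w)) ?_ ?_ ?_ ?_ w
    · intro x
      have := hid ⟨x.as.fst, x.as.snd⟩
      convert this using 1
      exact hom_ext rfl
    · intro x y z u v hu hv
      have := hcomp _ _ hu hv
      convert this using 1
      exact hom_ext rfl
    · intro a a' f b
      have := hl f b
      convert this using 1
      exact hom_ext rfl
    · intro a b b' g
      have := hr a g
      convert this using 1
      exact hom_ext rfl
  have := key u.word
  rwa [show u = ofWord u.word from hom_ext rfl]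

end Gray

namespace TwoCat

/-- The Gray tensor product of two 2-categories. -/
abbrev gray (A B : TwoCat) : TwoCat := ⟨GrayObj A B⟩

/-- The 0-cell of the terminal 2-category. -/
structure PtObj : Type where

/-- The 1-cell of the terminal 2-category. -/
structure PtHom (_ _ : PtObj) : Type where

/-- The 2-cell of the terminal 2-category. -/
structure PtHom₂ {x y : PtObj} (_ _ : PtHom x y) : Type where

instance : CategoryStruct PtObj where
  Hom := PtHom
  id _ := ⟨⟩
  comp _ _ := ⟨⟩

instance (x y : PtObj) : Category (x ⟶ y) where
  Hom f g := PtHom₂ f g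
  id _ := ⟨⟩
  comp _ _ := ⟨⟩
  id_comp _ := rfl
  comp_id _ := rfl
  assoc _ _ _ := rfl

instance : Bicategory PtObj where
  whiskerLeft _ _ _ _ := PtHom₂.mk
  whiskerRight _ _ := PtHom₂.mk
  associator _ _ _ := ⟨PtHom₂.mk, PtHom₂.mk, rfl, rfl⟩
  leftUnitor _ := ⟨PtHom₂.mk, PtHom₂.mk, rfl, rfl⟩
  rightUnitor _ := ⟨PtHom₂.mk, PtHom₂.mk, rfl, rfl⟩
  whiskerLeft_id _ _ := rfl
  whiskerLeft_comp _ _ _ _ _ _ := rfl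
  id_whiskerLeft _ := rfl
  comp_whiskerLeft _ _ _ _ _ := rfl
  id_whiskerRight _ _ := rfl
  comp_whiskerRight _ _ _ := rfl
  whiskerRight_id _ := rfl
  whiskerRight_comp _ _ _ := rfl
  whisker_assoc _ _ _ _ _ := rfl
  whisker_exchange _ _ := rfl
  pentagon _ _ _ _ := rfl
  triangle _ _ := rfl

instance : Bicategory.Strict PtObj where
  id_comp _ := rfl
  comp_id _ := rfl
  assoc _ _ _ := rfl
  leftUnitor_eqToIso _ := rfl
  rightUnitor_eqToIso _ := rfl
  associator_eqToIso _ _ _ := rfl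

/-- The terminal 2-category. -/
abbrev pt : TwoCat := ⟨PtObj⟩

/-- The unique 2-functor to the terminal 2-category. -/
def toPt (A : TwoCat) : A ⟶ pt := ofCore
  { obj := fun _ => PtObj.mk
    map := fun _ => PtHom.mk
    map₂ := fun _ => PtHom₂.mk
    map₂_id := fun _ => rfl
    map₂_comp := fun _ _ => rfl
    map_id := fun _ => rfl
    map_comp := fun _ _ => rfl
    map₂_whisker_left := fun _ _ _ _ => rfl
    map₂_whisker_right := fun _ _ => rfl }

section
variable {A B X P Q : TwoCat}

variable (A B) in
/-- The first projection `A ⊠ B ⟶ A`. -/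
def π₁ : gray A B ⟶ A := ofCore
  { obj := GrayObj.fst
    map := GrayHom.fst
    map₂ := GrayHom₂.fst
    map₂_id := fun _ => rfl
    map₂_comp := fun _ _ => rfl
    map_id := fun _ => rfl
    map_comp := fun _ _ => rfl
    map₂_whisker_left := fun _ _ _ _ =>
      ((Category.id_comp _).trans (Category.comp_id _)).symm
    map₂_whisker_right := fun _ _ =>
      ((Category.id_comp _).trans (Category.comp_id _)).symm }

variable (A B) in
/-- The second projection `A ⊠ B ⟶ B`. -/
def π₂ : gray A B ⟶ B := ofCore
  { obj := GrayObj.snd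
    map := GrayHom.snd
    map₂ := GrayHom₂.snd
    map₂_id := fun _ => rfl
    map₂_comp := fun _ _ => rfl
    map_id := fun _ => rfl
    map_comp := fun _ _ => rfl
    map₂_whisker_left := fun _ _ _ _ =>
      ((Category.id_comp _).trans (Category.comp_id _)).symm
    map₂_whisker_right := fun _ _ =>
      ((Category.id_comp _).trans (Category.comp_id _)).symm }

/-- A 2-functor into a Gray tensor product, from two 2-functors `F` and `G` and a functorial choice
of a 1-cell `w f` of the Gray tensor product with projections `F f` and `G f`, for every 1-cell `f`.
On 2-cells it is the pairing of `F` and `G`. -/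
def pair (F : X ⟶ A) (G : X ⟶ B)
    (w : ∀ {x y : X} (_ : x ⟶ y),
      (⟨obj F x, obj G x⟩ : GrayObj A B) ⟶ ⟨obj F y, obj G y⟩)
    (w_fst : ∀ {x y : X} (f : x ⟶ y), GrayHom.fst (w f) = map F f)
    (w_snd : ∀ {x y : X} (f : x ⟶ y), GrayHom.snd (w f) = map G f)
    (w_id : ∀ x : X, w (𝟙 x) = 𝟙 _)
    (w_comp : ∀ {x y z : X} (f : x ⟶ y) (g : y ⟶ z), w (f ≫ g) = w f ≫ w g) :
    X ⟶ gray A B := ofCore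
  { obj := fun x => (⟨obj F x, obj G x⟩ : GrayObj A B)
    map := fun f => GrayHom.mk (GrayHom.word (w f)) (map F f) (map G f)
      ((w f).map_fst.trans (w_fst f)) ((w f).map_snd.trans (w_snd f))
    map₂ := fun η => GrayHom₂.mk (map₂ F η) (map₂ G η)
    map₂_id := fun f => Gray.hom₂_ext' (map₂_id F f) (map₂_id G f)
    map₂_comp := fun η θ => Gray.hom₂_ext' (map₂_comp F η θ) (map₂_comp G η θ)
    map_id := fun x => Gray.hom_ext (congrArg GrayHom.word (w_id x) :)
    map_comp := fun f g => Gray.hom_ext (congrArg GrayHom.word (w_comp f g) :)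
    map₂_whisker_left := fun f _ _ η => by
      apply Gray.hom₂_ext
      · refine (map₂_whiskerLeft F f η).trans ?_
        erw [Gray.comp₂_fst, Gray.comp₂_fst, Gray.eqToHom_fst, Gray.eqToHom_fst]; rfl
      · refine (map₂_whiskerLeft G f η).trans ?_
        erw [Gray.comp₂_snd, Gray.comp₂_snd, Gray.eqToHom_snd, Gray.eqToHom_snd]; rfl
    map₂_whisker_right := fun η f => by
      apply Gray.hom₂_ext
      · refine (map₂_whiskerRight F η f).trans ?_
        erw [Gray.comp₂_fst, Gray.comp₂_fst, Gray.eqToHom_fst, Gray.eqToHom_fst]; rfl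
      · refine (map₂_whiskerRight G η f).trans ?_
        erw [Gray.comp₂_snd, Gray.comp₂_snd, Gray.eqToHom_snd, Gray.eqToHom_snd]; rfl }

/-- Compatible images of the generating 1-cells, which lift two 2-functors `F` and `G` to a 2-functor
between Gray tensor products. -/
structure GrayLift (F : gray P Q ⟶ A) (G : gray P Q ⟶ B) where
  left {p p' : P} (_ : p ⟶ p') (q : Q) :
    (⟨obj F (⟨p, q⟩ : GrayObj P Q), obj G (⟨p, q⟩ : GrayObj P Q)⟩ : GrayObj A B) ⟶
      ⟨obj F (⟨p', q⟩ : GrayObj P Q), obj G (⟨p', q⟩ : GrayObj P Q)⟩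
  right (p : P) {q q' : Q} (_ : q ⟶ q') :
    (⟨obj F (⟨p, q⟩ : GrayObj P Q), obj G (⟨p, q⟩ : GrayObj P Q)⟩ : GrayObj A B) ⟶
      ⟨obj F (⟨p, q'⟩ : GrayObj P Q), obj G (⟨p, q'⟩ : GrayObj P Q)⟩
  left_id (p : P) (q : Q) : left (𝟙 p) q = 𝟙 _
  left_comp {p p' p'' : P} (f : p ⟶ p') (f' : p' ⟶ p'') (q : Q) :
    left (f ≫ f') q = left f q ≫ left f' q
  right_id (p : P) (q : Q) : right p (𝟙 q) = 𝟙 _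
  right_comp (p : P) {q q' q'' : Q} (g : q ⟶ q') (g' : q' ⟶ q'') :
    right p (g ≫ g') = right p g ≫ right p g'
  left_fst {p p' : P} (f : p ⟶ p') (q : Q) : GrayHom.fst (left f q) = map F (Gray.inl f q)
  left_snd {p p' : P} (f : p ⟶ p') (q : Q) : GrayHom.snd (left f q) = map G (Gray.inl f q)
  right_fst (p : P) {q q' : Q} (g : q ⟶ q') : GrayHom.fst (right p g) = map F (Gray.inr p g)
  right_snd (p : P) {q q' : Q} (g : q ⟶ q') : GrayHom.snd (right p g) = map G (Gray.inr p g)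

variable {F : gray P Q ⟶ A} {G : gray P Q ⟶ B}

/-- The underlying functor on words. -/
def GrayLift.data (E : GrayLift F G) : Funny.LiftData P Q (GrayObj A B) where
  obj p q := ⟨obj F (⟨p, q⟩ : GrayObj P Q), obj G (⟨p, q⟩ : GrayObj P Q)⟩
  left := E.left
  right := E.right
  left_id := E.left_id
  left_comp := E.left_comp
  right_id := E.right_id
  right_comp := E.right_comp

/-- The 2-functor between Gray tensor products, with projections `F` and `G`, which has the given
values on the generating 1-cells. -/
def liftGray (E : GrayLift F G) : gray P Q ⟶ gray A B :=
  let D := E.data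
  pair F G (fun {x y} u => (Funny.lift D).map (GrayHom.word u))
    (fun {x y} u => by
      refine Gray.induction (P := fun {x y} u =>
        GrayHom.fst ((Funny.lift D).map (GrayHom.word u)) = map F u) ?_ ?_ ?_ ?_ u
      · intro x
        exact (congrArg GrayHom.fst ((Funny.lift D).map_id _)).trans (map_id F x).symm
      · intro x y z u v hu hv
        refine (congrArg GrayHom.fst ((Funny.lift D).map_comp _ _)).trans ?_
        refine Eq.trans ?_ (map_comp F u v).symm
        rw [← hu, ← hv]; rfl
      · intro p p' f q
        exact (congrArg GrayHom.fst (Funny.lift_inl D f q)).trans (E.left_fst f q)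
      · intro p q q' g
        exact (congrArg GrayHom.fst (Funny.lift_inr D p g)).trans (E.right_fst p g))
    (fun {x y} u => by
      refine Gray.induction (P := fun {x y} u =>
        GrayHom.snd ((Funny.lift D).map (GrayHom.word u)) = map G u) ?_ ?_ ?_ ?_ u
      · intro x
        exact (congrArg GrayHom.snd ((Funny.lift D).map_id _)).trans (map_id G x).symm
      · intro x y z u v hu hv
        refine (congrArg GrayHom.snd ((Funny.lift D).map_comp _ _)).trans ?_
        refine Eq.trans ?_ (map_comp G u v).symm
        rw [← hu, ← hv]; rfl
      · intro p p' f q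
        exact (congrArg GrayHom.snd (Funny.lift_inl D f q)).trans (E.left_snd f q)
      · intro p q q' g
        exact (congrArg GrayHom.snd (Funny.lift_inr D p g)).trans (E.right_snd p g))
    (fun _ => (Funny.lift D).map_id _)
    (fun _ _ => (Funny.lift D).map_comp _ _)

theorem liftGray_inl (E : GrayLift F G) {p p' : P} (f : p ⟶ p') (q : Q) :
    map (liftGray E) (Gray.inl f q) = E.left f q :=
  Gray.hom_ext (congrArg GrayHom.word (Funny.lift_inl E.data f q) :)

theorem liftGray_inr (E : GrayLift F G) (p : P) {q q' : Q} (g : q ⟶ q') :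
    map (liftGray E) (Gray.inr p g) = E.right p g :=
  Gray.hom_ext (congrArg GrayHom.word (Funny.lift_inr E.data p g) :)

end

end TwoCat

namespace TwoCat

section
variable {A B X P Q : TwoCat}

theorem comp_heq {x y z x' y' z' : X} {f : x ⟶ y} {g : y ⟶ z} {f' : x' ⟶ y'} {g' : y' ⟶ z'}
    (hx : x = x') (hy : y = y') (hz : z = z') (hf : HEq f f') (hg : HEq g g') :
    HEq (f ≫ g) (f' ≫ g') := by
  subst hx; subst hy; subst hz; cases hf; cases hg; rfl

theorem id_heq {x x' : X} (hx : x = x') : HEq (𝟙 x) (𝟙 x') := by subst hx; rfl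

/-- Two 2-functors out of a Gray tensor product which agree on 0-cells and on generating 1-cells
agree on 1-cells. -/
theorem map_heq_of_gen {F G : gray P Q ⟶ X} (h₀ : ∀ x, obj F x = obj G x)
    (hl : ∀ {p p' : P} (f : p ⟶ p') (q : Q), HEq (map F (Gray.inl f q)) (map G (Gray.inl f q)))
    (hr : ∀ (p : P) {q q' : Q} (g : q ⟶ q'), HEq (map F (Gray.inr p g)) (map G (Gray.inr p g)))
    {x y : gray P Q} (u : x ⟶ y) : HEq (map F u) (map G u) := by
  refine Gray.induction (P := fun u => HEq (map F u) (map G u)) ?_ ?_ ?_ ?_ u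
  · intro x
    exact (heq_of_eq (map_id F x)).trans
      ((id_heq (h₀ x)).trans (heq_of_eq (map_id G x).symm))
  · intro x y z u v hu hv
    exact (heq_of_eq (map_comp F u v)).trans
      ((comp_heq (h₀ x) (h₀ y) (h₀ z) hu hv).trans (heq_of_eq (map_comp G u v).symm))
  · exact hl
  · exact hr

theorem hom₂_heq {x y x' y' : GrayObj A B} (hx : x = x') (hy : y = y')
    {u v : GrayHom x y} {u' v' : GrayHom x' y'} (hu : HEq u u') (hv : HEq v v')
    {η : GrayHom₂ u v} {η' : GrayHom₂ u' v'} (h : HEq η.fst η'.fst) (h' : HEq η.snd η'.snd) :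
    HEq η η' := by
  subst hx; subst hy; cases hu; cases hv
  exact heq_of_eq (Gray.hom₂_ext' (eq_of_heq h) (eq_of_heq h'))

/-- A 2-functor into a Gray tensor product is determined by its projections and by its action on
1-cells. -/
theorem ext_gray {F G : X ⟶ gray A B} (h₁ : F ≫ π₁ A B = G ≫ π₁ A B)
    (h₂ : F ≫ π₂ A B = G ≫ π₂ A B)
    (hw : ∀ {x y : X} (f : x ⟶ y), HEq (map F f) (map G f)) : F = G := by
  have h₀ : ∀ a, obj F a = obj G a := by
    intro a
    have e₁ : (obj F a).fst = (obj G a).fst :=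
      congrArg (fun K : X ⟶ A => obj K a) h₁
    have e₂ : (obj F a).snd = (obj G a).snd :=
      congrArg (fun K : X ⟶ B => obj K a) h₂
    exact congrArg₂ GrayObj.mk e₁ e₂
  have key : ∀ {Y : TwoCat} {K K' : X ⟶ Y}, K = K' → ∀ {a b : X} {f g : a ⟶ b} (η : f ⟶ g),
      HEq (map₂ K η) (map₂ K' η) := by
    rintro Y K _ rfl a b f g η; rfl
  exact hom_ext h₀ hw (fun η => hom₂_heq (h₀ _) (h₀ _) (hw _) (hw _) (key h₁ η) (key h₂ η))

/-- A 2-functor out of a Gray tensor product with values in a Gray tensor product is determined by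
its projections and by its values on generating 1-cells. -/
theorem ext_gray_gray {F G : gray P Q ⟶ gray A B} (h₁ : F ≫ π₁ A B = G ≫ π₁ A B)
    (h₂ : F ≫ π₂ A B = G ≫ π₂ A B)
    (hl : ∀ {p p' : P} (f : p ⟶ p') (q : Q), HEq (map F (Gray.inl f q)) (map G (Gray.inl f q)))
    (hr : ∀ (p : P) {q q' : Q} (g : q ⟶ q'), HEq (map F (Gray.inr p g)) (map G (Gray.inr p g))) :
    F = G := by
  have h₀ : ∀ a, obj F a = obj G a := by
    intro a
    have e₁ : (obj F a).fst = (obj G a).fst :=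
      congrArg (fun K : gray P Q ⟶ A => obj K a) h₁
    have e₂ : (obj F a).snd = (obj G a).snd :=
      congrArg (fun K : gray P Q ⟶ B => obj K a) h₂
    exact congrArg₂ GrayObj.mk e₁ e₂
  exact ext_gray h₁ h₂ (fun u => map_heq_of_gen h₀ hl hr u)

/-- The data of the tensor product of two 2-functors: `(f, b) ↦ (F f, G b)` and `(a, g) ↦ (F a, G g)`. -/
def grayMapLift {A' B' : TwoCat} (F : A ⟶ A') (G : B ⟶ B') :
    GrayLift (A := A') (B := B') (π₁ A B ≫ F) (π₂ A B ≫ G) :=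
  .mk
    (fun f b => Gray.inl (map F f) (obj G b))
    (fun a _ _ g => Gray.inr (obj F a) (map G g))
    (fun a b => (congrArg (fun u => Gray.inl u (obj G b)) (map_id F a)).trans (Gray.inl_id _ _))
    (fun f f' b => (congrArg (fun u => Gray.inl u (obj G b)) (map_comp F f f')).trans
      (Gray.inl_comp _ _ _))
    (fun a b => (congrArg (fun u => Gray.inr (obj F a) u) (map_id G b)).trans (Gray.inr_id _ _))
    (fun a _ _ _ g g' => (congrArg (fun u => Gray.inr (obj F a) u) (map_comp G g g')).trans
      (Gray.inr_comp _ _ _))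
    (fun _ _ => rfl) (fun _ b => (map_id G b).symm)
    (fun a _ _ _ => (map_id F a).symm) (fun _ _ _ _ => rfl)

/-- The tensor product of two 2-functors. -/
def grayMap {A' B' : TwoCat} (F : A ⟶ A') (G : B ⟶ B') : gray A B ⟶ gray A' B' :=
  liftGray (grayMapLift F G)

theorem grayMap_inl {A' B' : TwoCat} (F : A ⟶ A') (G : B ⟶ B') {a a' : A} (f : a ⟶ a') (b : B) :
    map (grayMap F G) (Gray.inl f b) = Gray.inl (map F f) (obj G b) :=
  liftGray_inl (grayMapLift F G) f b

theorem grayMap_inr {A' B' : TwoCat} (F : A ⟶ A') (G : B ⟶ B') (a : A) {b b' : B} (g : b ⟶ b') :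
    map (grayMap F G) (Gray.inr a g) = Gray.inr (obj F a) (map G g) :=
  liftGray_inr (grayMapLift F G) a g

/-- The constant 2-functor. -/
def const (A : TwoCat) {B : TwoCat} (b : B) : A ⟶ B := ofCore
  { obj := fun _ => b
    map := fun _ => 𝟙 b
    map₂ := fun _ => 𝟙 (𝟙 b)
    map₂_id := fun _ => rfl
    map₂_comp := fun _ _ => (Category.id_comp _).symm
    map_id := fun _ => rfl
    map_comp := fun _ _ => (Category.id_comp _).symm
    map₂_whisker_left := fun _ _ _ _ => by simp
    map₂_whisker_right := fun _ _ => by simp }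

/-- The 2-functor `a ↦ (a, b)`. -/
def insL (A : TwoCat) {B : TwoCat} (b : B) : A ⟶ gray A B :=
  pair (𝟙 A) (const A b) (fun f => Gray.inl f b) (fun _ => rfl) (fun _ => rfl)
    (fun a => Gray.inl_id a b) (fun f g => Gray.inl_comp f g b)

/-- The 2-functor `b ↦ (a, b)`. -/
def insR {A : TwoCat} (B : TwoCat) (a : A) : B ⟶ gray A B :=
  pair (const B a) (𝟙 B) (fun f => Gray.inr a f) (fun _ => rfl) (fun _ => rfl)
    (fun b => Gray.inr_id a b) (fun f g => Gray.inr_comp a f g)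

/-- The 2-functor `(a, b) ↦ (a, (b, c))`. -/
abbrev assocInsL (A B : TwoCat) {C : TwoCat} (c : C) : gray A B ⟶ gray A (gray B C) :=
  grayMap (𝟙 A) (insL B c)

/-- The 2-functor `(b, c) ↦ ((a, b), c)`. -/
abbrev assocInsR {A : TwoCat} (B C : TwoCat) (a : A) : gray B C ⟶ gray (gray A B) C :=
  grayMap (insR B a) (𝟙 C)

/-- The data of the associator `(A ⊠ B) ⊠ C ⟶ A ⊠ (B ⊠ C)`. -/
def assocHomLift (A B C : TwoCat) :
    GrayLift (π₁ (gray A B) C ≫ π₁ A B) (grayMap (π₂ A B) (𝟙 C)) :=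
  .mk
    (fun f c => map (assocInsL A B c) f)
    (fun x _ _ h => Gray.inr (GrayObj.fst x) (Gray.inr (GrayObj.snd x) h))
    (fun x c => map_id (assocInsL A B c) x)
    (fun f g c => map_comp (assocInsL A B c) f g)
    (fun _ _ => (congrArg (Gray.inr _) (Gray.inr_id _ _)).trans (Gray.inr_id _ _))
    (fun _ _ _ _ _ _ => (congrArg (Gray.inr _) (Gray.inr_comp _ _ _)).trans (Gray.inr_comp _ _ _))
    (fun _ _ => rfl)
    (fun f c => (grayMap_inl (π₂ A B) (𝟙 C) f c).symm)
    (fun _ _ _ _ => rfl)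
    (fun x _ _ h => (grayMap_inr (π₂ A B) (𝟙 C) x h).symm)

/-- The associator `(A ⊠ B) ⊠ C ⟶ A ⊠ (B ⊠ C)`. -/
def assocHom (A B C : TwoCat) : gray (gray A B) C ⟶ gray A (gray B C) :=
  liftGray (assocHomLift A B C)

theorem assocHom_inl (A B C : TwoCat) {x y : gray A B} (f : x ⟶ y) (c : C) :
    map (assocHom A B C) (Gray.inl f c) = map (assocInsL A B c) f :=
  liftGray_inl (assocHomLift A B C) f c

theorem assocHom_inl_inl (A B C : TwoCat) {a a' : A} (f : a ⟶ a') (b : B) (c : C) :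
    map (assocHom A B C) (Gray.inl (Gray.inl f b) c) =
      Gray.inl (B := gray B C) f ⟨b, c⟩ :=
  (assocHom_inl A B C _ c).trans (grayMap_inl (𝟙 A) (insL B c) f b)

theorem assocHom_inl_inr (A B C : TwoCat) (a : A) {b b' : B} (f : b ⟶ b') (c : C) :
    map (assocHom A B C) (Gray.inl (Gray.inr a f) c) = Gray.inr a (Gray.inl f c) :=
  (assocHom_inl A B C _ c).trans (grayMap_inr (𝟙 A) (insL B c) a f)

theorem assocHom_inr (A B C : TwoCat) (a : A) (b : B) {c c' : C} (f : c ⟶ c') :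
    map (assocHom A B C) (Gray.inr (⟨a, b⟩ : GrayObj A B) f) = Gray.inr a (Gray.inr b f) :=
  liftGray_inr (assocHomLift A B C) _ f

/-- The data of the inverse associator `A ⊠ (B ⊠ C) ⟶ (A ⊠ B) ⊠ C`. -/
def assocInvLift (A B C : TwoCat) :
    GrayLift (grayMap (𝟙 A) (π₁ B C)) (π₂ A (gray B C) ≫ π₂ B C) :=
  .mk
    (fun f x => Gray.inl (A := gray A B) (Gray.inl f (GrayObj.fst x)) (GrayObj.snd x))
    (fun a _ _ f => map (assocInsR B C a) f)
    (fun _ _ => (congrArg (fun u => Gray.inl u _) (Gray.inl_id _ _)).trans (Gray.inl_id _ _))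
    (fun _ _ _ => (congrArg (fun u => Gray.inl u _) (Gray.inl_comp _ _ _)).trans
      (Gray.inl_comp _ _ _))
    (fun a x => map_id (assocInsR B C a) x)
    (fun a _ _ _ f g => map_comp (assocInsR B C a) f g)
    (fun f x => (grayMap_inl (𝟙 A) (π₁ B C) f x).symm)
    (fun _ _ => rfl)
    (fun a _ _ f => (grayMap_inr (𝟙 A) (π₁ B C) a f).symm)
    (fun _ _ _ _ => rfl)

/-- The inverse associator `A ⊠ (B ⊠ C) ⟶ (A ⊠ B) ⊠ C`. -/
def assocInv (A B C : TwoCat) : gray A (gray B C) ⟶ gray (gray A B) C :=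
  liftGray (assocInvLift A B C)

theorem assocInv_inl (A B C : TwoCat) {a a' : A} (f : a ⟶ a') (b : B) (c : C) :
    map (assocInv A B C) (Gray.inl f (⟨b, c⟩ : GrayObj B C)) = Gray.inl (Gray.inl f b) c :=
  liftGray_inl (assocInvLift A B C) f _

theorem assocInv_inr (A B C : TwoCat) (a : A) {x y : gray B C} (f : x ⟶ y) :
    map (assocInv A B C) (Gray.inr a f) = map (assocInsR B C a) f :=
  liftGray_inr (assocInvLift A B C) a f

theorem assocInv_inr_inl (A B C : TwoCat) (a : A) {b b' : B} (f : b ⟶ b') (c : C) :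
    map (assocInv A B C) (Gray.inr a (Gray.inl f c)) = Gray.inl (Gray.inr a f) c :=
  (assocInv_inr A B C a _).trans (grayMap_inl (insR B a) (𝟙 C) f c)

theorem assocInv_inr_inr (A B C : TwoCat) (a : A) (b : B) {c c' : C} (f : c ⟶ c') :
    map (assocInv A B C) (Gray.inr a (Gray.inr b f)) =
      Gray.inr (A := gray A B) ⟨a, b⟩ f :=
  (assocInv_inr A B C a _).trans (grayMap_inr (insR B a) (𝟙 C) b f)

/-- To compare two 2-functors on the 1-cells `(u, q)`, with `u` in a Gray tensor product, it
suffices to compare them on generators. -/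
theorem map_inl_heq {A B Q X : TwoCat} {F G : gray (gray A B) Q ⟶ X}
    (h₀ : ∀ x, obj F x = obj G x) (q : Q)
    (hl : ∀ {p p' : A} (f : p ⟶ p') (b : B),
      HEq (map F (Gray.inl (Gray.inl f b) q)) (map G (Gray.inl (Gray.inl f b) q)))
    (hr : ∀ (a : A) {b b' : B} (g : b ⟶ b'),
      HEq (map F (Gray.inl (Gray.inr a g) q)) (map G (Gray.inl (Gray.inr a g) q)))
    {x y : gray A B} (u : x ⟶ y) : HEq (map F (Gray.inl u q)) (map G (Gray.inl u q)) :=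
  map_heq_of_gen (F := insL (gray A B) q ≫ F) (G := insL (gray A B) q ≫ G)
    (fun x => h₀ ⟨x, q⟩) hl hr u

theorem map_inr_heq {A B P X : TwoCat} {F G : gray P (gray A B) ⟶ X}
    (h₀ : ∀ x, obj F x = obj G x) (p : P)
    (hl : ∀ {a a' : A} (f : a ⟶ a') (b : B),
      HEq (map F (Gray.inr p (Gray.inl f b))) (map G (Gray.inr p (Gray.inl f b))))
    (hr : ∀ (a : A) {b b' : B} (g : b ⟶ b'),
      HEq (map F (Gray.inr p (Gray.inr a g))) (map G (Gray.inr p (Gray.inr a g))))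
    {x y : gray A B} (u : x ⟶ y) : HEq (map F (Gray.inr p u)) (map G (Gray.inr p u)) :=
  map_heq_of_gen (F := insR (gray A B) p ≫ F) (G := insR (gray A B) p ≫ G)
    (fun x => h₀ ⟨p, x⟩) hl hr u

theorem grayMap_π₁ {A' B' : TwoCat} (F : A ⟶ A') (G : B ⟶ B') :
    grayMap F G ≫ π₁ A' B' = π₁ A B ≫ F :=
  hom_ext (fun _ => rfl) (fun _ => HEq.rfl) (fun _ => HEq.rfl)

theorem grayMap_π₂ {A' B' : TwoCat} (F : A ⟶ A') (G : B ⟶ B') :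
    grayMap F G ≫ π₂ A' B' = π₂ A B ≫ G :=
  hom_ext (fun _ => rfl) (fun _ => HEq.rfl) (fun _ => HEq.rfl)

theorem grayMap_id (A B : TwoCat) : grayMap (𝟙 A) (𝟙 B) = 𝟙 (gray A B) :=
  ext_gray_gray (grayMap_π₁ _ _) (grayMap_π₂ _ _)
    (fun f b => heq_of_eq (grayMap_inl (𝟙 A) (𝟙 B) f b))
    (fun a _ _ g => heq_of_eq (grayMap_inr (𝟙 A) (𝟙 B) a g))

theorem grayMap_comp {A₁ A₂ A₃ B₁ B₂ B₃ : TwoCat} (F : A₁ ⟶ A₂) (F' : A₂ ⟶ A₃) (G : B₁ ⟶ B₂)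
    (G' : B₂ ⟶ B₃) : grayMap F G ≫ grayMap F' G' = grayMap (F ≫ F') (G ≫ G') :=
  ext_gray_gray (hom_ext (fun _ => rfl) (fun _ => HEq.rfl) (fun _ => HEq.rfl))
    (hom_ext (fun _ => rfl) (fun _ => HEq.rfl) (fun _ => HEq.rfl))
    (fun f b => heq_of_eq
      ((congrArg (map (grayMap F' G')) (grayMap_inl F G f b)).trans
        ((grayMap_inl F' G' _ _).trans (grayMap_inl (F ≫ F') (G ≫ G') f b).symm)))
    (fun a _ _ g => heq_of_eq
      ((congrArg (map (grayMap F' G')) (grayMap_inr F G a g)).trans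
        ((grayMap_inr F' G' _ _).trans (grayMap_inr (F ≫ F') (G ≫ G') a g).symm)))

theorem assocHom_π₁ (A B C : TwoCat) :
    assocHom A B C ≫ π₁ A (gray B C) = π₁ (gray A B) C ≫ π₁ A B :=
  hom_ext (fun _ => rfl) (fun _ => HEq.rfl) (fun _ => HEq.rfl)

theorem assocHom_π₂ (A B C : TwoCat) :
    assocHom A B C ≫ π₂ A (gray B C) = grayMap (π₂ A B) (𝟙 C) :=
  hom_ext (fun _ => rfl) (fun _ => HEq.rfl) (fun _ => HEq.rfl)

theorem assocInv_π₁ (A B C : TwoCat) :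
    assocInv A B C ≫ π₁ (gray A B) C = grayMap (𝟙 A) (π₁ B C) :=
  hom_ext (fun _ => rfl) (fun _ => HEq.rfl) (fun _ => HEq.rfl)

theorem assocInv_π₂ (A B C : TwoCat) :
    assocInv A B C ≫ π₂ (gray A B) C = π₂ A (gray B C) ≫ π₂ B C :=
  hom_ext (fun _ => rfl) (fun _ => HEq.rfl) (fun _ => HEq.rfl)

theorem assoc_hom_inv (A B C : TwoCat) : assocHom A B C ≫ assocInv A B C = 𝟙 _ := by
  have key₁ : ∀ {a a' : A} (f : a ⟶ a') (b : B) (c : C),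
      map (assocHom A B C ≫ assocInv A B C) (Gray.inl (Gray.inl f b) c) =
        Gray.inl (Gray.inl f b) c := fun f b c =>
    (congrArg (map (assocInv A B C)) (assocHom_inl_inl A B C f b c)).trans
      (assocInv_inl A B C f b c)
  have key₂ : ∀ (a : A) {b b' : B} (f : b ⟶ b') (c : C),
      map (assocHom A B C ≫ assocInv A B C) (Gray.inl (Gray.inr a f) c) =
        Gray.inl (Gray.inr a f) c := fun a _ _ f c =>
    (congrArg (map (assocInv A B C)) (assocHom_inl_inr A B C a f c)).trans
      (assocInv_inr_inl A B C a f c)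
  have key₃ : ∀ (a : A) (b : B) {c c' : C} (f : c ⟶ c'),
      map (assocHom A B C ≫ assocInv A B C) (Gray.inr (A := gray A B) ⟨a, b⟩ f) =
        Gray.inr (A := gray A B) ⟨a, b⟩ f := fun a b _ _ f =>
    (congrArg (map (assocInv A B C)) (assocHom_inr A B C a b f)).trans
      (assocInv_inr_inr A B C a b f)
  refine ext_gray_gray ?_ (hom_ext (fun _ => rfl) (fun _ => HEq.rfl) (fun _ => HEq.rfl))
    (fun u c => map_inl_heq (F := assocHom A B C ≫ assocInv A B C) (G := 𝟙 _) (fun _ => by rfl) c (fun f b => heq_of_eq (key₁ f b c))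
      (fun a _ _ f => heq_of_eq (key₂ a f c)) u)
    (fun x _ _ f => heq_of_eq (key₃ x.fst x.snd f))
  exact ext_gray_gray (hom_ext (fun _ => rfl) (fun _ => HEq.rfl) (fun _ => HEq.rfl))
    (hom_ext (fun _ => rfl) (fun _ => HEq.rfl) (fun _ => HEq.rfl))
    (fun u c => map_inl_heq (F := (assocHom A B C ≫ assocInv A B C) ≫ π₁ _ _) (G := 𝟙 _ ≫ π₁ _ _) (fun _ => by rfl) c
      (fun f b => heq_of_eq (congrArg (map (π₁ (gray A B) C)) (key₁ f b c)))
      (fun a _ _ f => heq_of_eq (congrArg (map (π₁ (gray A B) C)) (key₂ a f c))) u)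
    (fun x _ _ f => heq_of_eq (congrArg (map (π₁ (gray A B) C)) (key₃ x.fst x.snd f)))

theorem assoc_inv_hom (A B C : TwoCat) : assocInv A B C ≫ assocHom A B C = 𝟙 _ := by
  have key₁ : ∀ {a a' : A} (f : a ⟶ a') (b : B) (c : C),
      map (assocInv A B C ≫ assocHom A B C) (Gray.inl (B := gray B C) f ⟨b, c⟩) =
        Gray.inl (B := gray B C) f ⟨b, c⟩ := fun f b c =>
    (congrArg (map (assocHom A B C)) (assocInv_inl A B C f b c)).trans
      (assocHom_inl_inl A B C f b c)
  have key₂ : ∀ (a : A) {b b' : B} (f : b ⟶ b') (c : C),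
      map (assocInv A B C ≫ assocHom A B C) (Gray.inr a (Gray.inl f c)) =
        Gray.inr a (Gray.inl f c) := fun a _ _ f c =>
    (congrArg (map (assocHom A B C)) (assocInv_inr_inl A B C a f c)).trans
      (assocHom_inl_inr A B C a f c)
  have key₃ : ∀ (a : A) (b : B) {c c' : C} (f : c ⟶ c'),
      map (assocInv A B C ≫ assocHom A B C) (Gray.inr a (Gray.inr b f)) =
        Gray.inr a (Gray.inr b f) := fun a b _ _ f =>
    (congrArg (map (assocHom A B C)) (assocInv_inr_inr A B C a b f)).trans
      (assocHom_inr A B C a b f)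
  refine ext_gray_gray (hom_ext (fun _ => rfl) (fun _ => HEq.rfl) (fun _ => HEq.rfl)) ?_
    (fun f x => heq_of_eq (key₁ f x.fst x.snd))
    (fun a _ _ u => map_inr_heq (F := assocInv A B C ≫ assocHom A B C) (G := 𝟙 _) (fun _ => by rfl) a (fun f c => heq_of_eq (key₂ a f c))
      (fun b _ _ f => heq_of_eq (key₃ a b f)) u)
  exact ext_gray_gray (hom_ext (fun _ => rfl) (fun _ => HEq.rfl) (fun _ => HEq.rfl))
    (hom_ext (fun _ => rfl) (fun _ => HEq.rfl) (fun _ => HEq.rfl))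
    (fun f x => heq_of_eq (congrArg (map (π₂ A (gray B C))) (key₁ f x.fst x.snd)))
    (fun a _ _ u => map_inr_heq (F := (assocInv A B C ≫ assocHom A B C) ≫ π₂ _ _) (G := 𝟙 _ ≫ π₂ _ _) (fun _ => by rfl) a
      (fun f c => heq_of_eq (congrArg (map (π₂ A (gray B C))) (key₂ a f c)))
      (fun b _ _ f => heq_of_eq (congrArg (map (π₂ A (gray B C))) (key₃ a b f))) u)

/-- The associator isomorphism. -/
def assoc (A B C : TwoCat) : gray (gray A B) C ≅ gray A (gray B C) where
  hom := assocHom A B C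
  inv := assocInv A B C
  hom_inv_id := assoc_hom_inv A B C
  inv_hom_id := assoc_inv_hom A B C

/-- The left unitor. -/
def leftUnitor (A : TwoCat) : gray pt A ≅ A where
  hom := π₂ pt A
  inv := insR A PtObj.mk
  hom_inv_id := ext_gray_gray (hom_ext (fun _ => rfl) (fun _ => HEq.rfl) (fun _ => HEq.rfl))
    (hom_ext (fun _ => rfl) (fun _ => HEq.rfl) (fun _ => HEq.rfl))
    (fun _ a => heq_of_eq ((Gray.inr_id (A := pt) PtObj.mk a).trans
      (Gray.inl_id (A := pt) PtObj.mk a).symm))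
    (fun _ _ _ _ => HEq.rfl)
  inv_hom_id := hom_ext (fun _ => rfl) (fun _ => HEq.rfl) (fun _ => HEq.rfl)

/-- The right unitor. -/
def rightUnitor (A : TwoCat) : gray A pt ≅ A where
  hom := π₁ A pt
  inv := insL A PtObj.mk
  hom_inv_id := ext_gray_gray (hom_ext (fun _ => rfl) (fun _ => HEq.rfl) (fun _ => HEq.rfl))
    (hom_ext (fun _ => rfl) (fun _ => HEq.rfl) (fun _ => HEq.rfl))
    (fun _ _ => HEq.rfl)
    (fun a _ _ _ => heq_of_eq ((Gray.inl_id (B := pt) a PtObj.mk).trans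
      (Gray.inr_id (B := pt) a PtObj.mk).symm))
  inv_hom_id := hom_ext (fun _ => rfl) (fun _ => HEq.rfl) (fun _ => HEq.rfl)

theorem assoc_naturality {A₁ A₂ B₁ B₂ C₁ C₂ : TwoCat} (F : A₁ ⟶ A₂) (G : B₁ ⟶ B₂) (H : C₁ ⟶ C₂) :
    grayMap (grayMap F G) H ≫ assocHom A₂ B₂ C₂ =
      assocHom A₁ B₁ C₁ ≫ grayMap F (grayMap G H) := by
  have key₁ : ∀ {a a' : A₁} (f : a ⟶ a') (b : B₁) (c : C₁),
      map (grayMap (grayMap F G) H ≫ assocHom A₂ B₂ C₂) (Gray.inl (Gray.inl f b) c) =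
        map (assocHom A₁ B₁ C₁ ≫ grayMap F (grayMap G H)) (Gray.inl (Gray.inl f b) c) :=
      fun f b c => by
    refine (congrArg (map (assocHom A₂ B₂ C₂)) ((grayMap_inl (grayMap F G) H _ c).trans
      (congrArg (fun u => Gray.inl u (obj H c)) (grayMap_inl F G f b)))).trans ?_
    refine (assocHom_inl_inl A₂ B₂ C₂ _ _ _).trans ?_
    exact ((congrArg (map (grayMap F (grayMap G H))) (assocHom_inl_inl A₁ B₁ C₁ f b c)).trans
      (grayMap_inl F (grayMap G H) f _)).symm
  have key₂ : ∀ (a : A₁) {b b' : B₁} (f : b ⟶ b') (c : C₁),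
      map (grayMap (grayMap F G) H ≫ assocHom A₂ B₂ C₂) (Gray.inl (Gray.inr a f) c) =
        map (assocHom A₁ B₁ C₁ ≫ grayMap F (grayMap G H)) (Gray.inl (Gray.inr a f) c) :=
      fun a _ _ f c => by
    refine (congrArg (map (assocHom A₂ B₂ C₂)) ((grayMap_inl (grayMap F G) H _ c).trans
      (congrArg (fun u => Gray.inl u (obj H c)) (grayMap_inr F G a f)))).trans ?_
    refine (assocHom_inl_inr A₂ B₂ C₂ _ _ _).trans ?_
    exact ((congrArg (map (grayMap F (grayMap G H))) (assocHom_inl_inr A₁ B₁ C₁ a f c)).trans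
      ((grayMap_inr F (grayMap G H) a _).trans
        (congrArg (Gray.inr (obj F a)) (grayMap_inl G H f c)))).symm
  have key₃ : ∀ (a : A₁) (b : B₁) {c c' : C₁} (f : c ⟶ c'),
      map (grayMap (grayMap F G) H ≫ assocHom A₂ B₂ C₂) (Gray.inr (A := gray A₁ B₁) ⟨a, b⟩ f) =
        map (assocHom A₁ B₁ C₁ ≫ grayMap F (grayMap G H)) (Gray.inr (A := gray A₁ B₁) ⟨a, b⟩ f) :=
      fun a b _ _ f => by
    refine (congrArg (map (assocHom A₂ B₂ C₂)) (grayMap_inr (grayMap F G) H _ f)).trans ?_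
    refine (assocHom_inr A₂ B₂ C₂ _ _ _).trans ?_
    exact ((congrArg (map (grayMap F (grayMap G H))) (assocHom_inr A₁ B₁ C₁ a b f)).trans
      ((grayMap_inr F (grayMap G H) a _).trans
        (congrArg (Gray.inr (obj F a)) (grayMap_inr G H b f)))).symm
  refine ext_gray_gray (hom_ext (fun _ => rfl) (fun _ => HEq.rfl) (fun _ => HEq.rfl)) ?_
    (fun u c => map_inl_heq (F := grayMap (grayMap F G) H ≫ assocHom A₂ B₂ C₂) (G := assocHom A₁ B₁ C₁ ≫ grayMap F (grayMap G H)) (fun _ => by rfl) c (fun f b => heq_of_eq (key₁ f b c))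
      (fun a _ _ f => heq_of_eq (key₂ a f c)) u)
    (fun x _ _ f => heq_of_eq (key₃ x.fst x.snd f))
  exact ext_gray_gray (hom_ext (fun _ => rfl) (fun _ => HEq.rfl) (fun _ => HEq.rfl))
    (hom_ext (fun _ => rfl) (fun _ => HEq.rfl) (fun _ => HEq.rfl))
    (fun u c => map_inl_heq (F := (grayMap (grayMap F G) H ≫ assocHom A₂ B₂ C₂) ≫ π₂ _ _) (G := (assocHom A₁ B₁ C₁ ≫ grayMap F (grayMap G H)) ≫ π₂ _ _) (fun _ => by rfl) c
      (fun f b => heq_of_eq (congrArg (map (π₂ A₂ (gray B₂ C₂))) (key₁ f b c)))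
      (fun a _ _ f => heq_of_eq (congrArg (map (π₂ A₂ (gray B₂ C₂))) (key₂ a f c))) u)
    (fun x _ _ f => heq_of_eq (congrArg (map (π₂ A₂ (gray B₂ C₂))) (key₃ x.fst x.snd f)))

theorem triangle_eq (A B : TwoCat) :
    assocHom A pt B ≫ grayMap (𝟙 A) (π₂ pt B) = grayMap (π₁ A pt) (𝟙 B) := by
  refine ext_gray_gray (hom_ext (fun _ => rfl) (fun _ => HEq.rfl) (fun _ => HEq.rfl))
    (hom_ext (fun _ => rfl) (fun _ => HEq.rfl) (fun _ => HEq.rfl))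
    (fun u c => map_inl_heq (F := assocHom A pt B ≫ grayMap (𝟙 A) (π₂ pt B)) (G := grayMap (π₁ A pt) (𝟙 B)) (fun _ => by rfl) c (fun f b => heq_of_eq ?_)
      (fun a _ _ f => heq_of_eq ?_) u)
    (fun x _ _ f => heq_of_eq ?_)
  · refine (congrArg (map (grayMap (𝟙 A) (π₂ pt B))) (assocHom_inl_inl A pt B f b c)).trans ?_
    refine (grayMap_inl (𝟙 A) (π₂ pt B) f _).trans ?_
    exact (grayMap_inl (π₁ A pt) (𝟙 B) (Gray.inl f b) c).symm
  · refine (congrArg (map (grayMap (𝟙 A) (π₂ pt B))) (assocHom_inl_inr A pt B a f c)).trans ?_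
    refine (grayMap_inr (𝟙 A) (π₂ pt B) a _).trans ?_
    refine Eq.trans ?_ (grayMap_inl (π₁ A pt) (𝟙 B) (Gray.inr a f) c).symm
    exact (Gray.inr_id a c).trans (Gray.inl_id a c).symm
  · refine (congrArg (map (grayMap (𝟙 A) (π₂ pt B))) (assocHom_inr A pt B x.fst x.snd f)).trans ?_
    refine (grayMap_inr (𝟙 A) (π₂ pt B) _ _).trans ?_
    exact (grayMap_inr (π₁ A pt) (𝟙 B) x f).symm

/-- To compare two 2-functors on 1-cells of a threefold Gray tensor product, it suffices to compare
them on generators. -/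
theorem map_heq_of_gen₄ {A B C D X : TwoCat} {L R : gray (gray (gray A B) C) D ⟶ X}
    (h₀ : ∀ x, obj L x = obj R x)
    (key₁ : ∀ {a a' : A} (f : a ⟶ a') (b : B) (c : C) (d : D),
      HEq (map L (Gray.inl (Gray.inl (Gray.inl f b) c) d))
        (map R (Gray.inl (Gray.inl (Gray.inl f b) c) d)))
    (key₂ : ∀ (a : A) {b b' : B} (f : b ⟶ b') (c : C) (d : D),
      HEq (map L (Gray.inl (Gray.inl (Gray.inr a f) c) d))
        (map R (Gray.inl (Gray.inl (Gray.inr a f) c) d)))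
    (key₃ : ∀ (a : A) (b : B) {c c' : C} (f : c ⟶ c') (d : D),
      HEq (map L (Gray.inl (Gray.inr (A := gray A B) ⟨a, b⟩ f) d))
        (map R (Gray.inl (Gray.inr (A := gray A B) ⟨a, b⟩ f) d)))
    (key₄ : ∀ (a : A) (b : B) (c : C) {d d' : D} (f : d ⟶ d'),
      HEq (map L (Gray.inr (A := gray (gray A B) C) ⟨⟨a, b⟩, c⟩ f))
        (map R (Gray.inr (A := gray (gray A B) C) ⟨⟨a, b⟩, c⟩ f)))
    {x y : gray (gray (gray A B) C) D} (u : x ⟶ y) : HEq (map L u) (map R u) := by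
  refine map_heq_of_gen (F := L) (G := R) h₀ (fun u d => ?_) (fun x _ _ f => key₄ _ _ _ f) u
  refine map_inl_heq (F := L) (G := R) h₀ d (fun v c => ?_) (fun x _ _ f => key₃ _ _ f d) u
  exact map_heq_of_gen (F := insL (gray A B) c ≫ insL (gray (gray A B) C) d ≫ L)
      (G := insL (gray A B) c ≫ insL (gray (gray A B) C) d ≫ R) (fun x => h₀ ⟨⟨x, c⟩, d⟩)
      (fun f b => key₁ f b c d) (fun a _ _ f => key₂ a f c d) v

theorem pentagon_eq (A B C D : TwoCat) :
    grayMap (assocHom A B C) (𝟙 D) ≫ assocHom A (gray B C) D ≫ grayMap (𝟙 A) (assocHom B C D) =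
      assocHom (gray A B) C D ≫ assocHom A B (gray C D) := by
  have p₁ : (grayMap (assocHom A B C) (𝟙 D) ≫ assocHom A (gray B C) D ≫
      grayMap (𝟙 A) (assocHom B C D)) ≫ π₁ A (gray B (gray C D)) =
      (assocHom (gray A B) C D ≫ assocHom A B (gray C D)) ≫ π₁ A (gray B (gray C D)) := by
    rw [Category.assoc, Category.assoc, grayMap_π₁, Category.comp_id, assocHom_π₁, ← Category.assoc,
      grayMap_π₁, Category.assoc, assocHom_π₁, Category.assoc, assocHom_π₁, ← Category.assoc,
      ← Category.assoc, assocHom_π₁]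
  have p₂ : (grayMap (assocHom A B C) (𝟙 D) ≫ assocHom A (gray B C) D ≫
      grayMap (𝟙 A) (assocHom B C D)) ≫ π₂ A (gray B (gray C D)) =
      (assocHom (gray A B) C D ≫ assocHom A B (gray C D)) ≫ π₂ A (gray B (gray C D)) := by
    have e := assoc_naturality (π₂ A B) (𝟙 C) (𝟙 D)
    rw [grayMap_id] at e
    rw [Category.assoc, Category.assoc, grayMap_π₂, ← Category.assoc (assocHom A (gray B C) D),
      assocHom_π₂, ← Category.assoc, grayMap_comp, assocHom_π₂, Category.comp_id, Category.assoc,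
      assocHom_π₂, e]
  refine ext_gray p₁ p₂ (map_heq_of_gen₄ (L := grayMap (assocHom A B C) (𝟙 D) ≫
      assocHom A (gray B C) D ≫ grayMap (𝟙 A) (assocHom B C D))
    (R := assocHom (gray A B) C D ≫ assocHom A B (gray C D)) (fun _ => rfl) ?_ ?_ ?_ ?_)
  · intro _ _ f b c d
    apply heq_of_eq
    refine (congrArg (fun u => map (grayMap (𝟙 A) (assocHom B C D))
      (map (assocHom A (gray B C) D) u)) ((grayMap_inl (assocHom A B C) (𝟙 D) _ d).trans
        (congrArg (fun u => Gray.inl u d) (assocHom_inl_inl A B C f b c)))).trans ?_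
    refine (congrArg (map (grayMap (𝟙 A) (assocHom B C D)))
      (assocHom_inl_inl A (gray B C) D f ⟨b, c⟩ d)).trans ?_
    refine (grayMap_inl (𝟙 A) (assocHom B C D) f _).trans ?_
    exact ((congrArg (map (assocHom A B (gray C D)))
      (assocHom_inl_inl (gray A B) C D (Gray.inl f b) c d)).trans
        (assocHom_inl_inl A B (gray C D) f b ⟨c, d⟩)).symm
  · intro a _ _ f c d
    apply heq_of_eq
    refine (congrArg (fun u => map (grayMap (𝟙 A) (assocHom B C D))
      (map (assocHom A (gray B C) D) u)) ((grayMap_inl (assocHom A B C) (𝟙 D) _ d).trans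
        (congrArg (fun u => Gray.inl u d) (assocHom_inl_inr A B C a f c)))).trans ?_
    refine (congrArg (map (grayMap (𝟙 A) (assocHom B C D)))
      (assocHom_inl_inr A (gray B C) D a (Gray.inl f c) d)).trans ?_
    refine (grayMap_inr (𝟙 A) (assocHom B C D) a _).trans ?_
    refine (congrArg (Gray.inr a) (assocHom_inl_inl B C D f c d)).trans ?_
    exact ((congrArg (map (assocHom A B (gray C D)))
      (assocHom_inl_inl (gray A B) C D (Gray.inr a f) c d)).trans
        (assocHom_inl_inr A B (gray C D) a f ⟨c, d⟩)).symm
  · intro a b _ _ f d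
    apply heq_of_eq
    refine (congrArg (fun u => map (grayMap (𝟙 A) (assocHom B C D))
      (map (assocHom A (gray B C) D) u)) ((grayMap_inl (assocHom A B C) (𝟙 D) _ d).trans
        (congrArg (fun u => Gray.inl u d) (assocHom_inr A B C a b f)))).trans ?_
    refine (congrArg (map (grayMap (𝟙 A) (assocHom B C D)))
      (assocHom_inl_inr A (gray B C) D a (Gray.inr b f) d)).trans ?_
    refine (grayMap_inr (𝟙 A) (assocHom B C D) a _).trans ?_
    refine (congrArg (Gray.inr a) (assocHom_inl_inr B C D b f d)).trans ?_
    exact ((congrArg (map (assocHom A B (gray C D)))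
      (assocHom_inl_inr (gray A B) C D ⟨a, b⟩ f d)).trans
        (assocHom_inr A B (gray C D) a b (Gray.inl f d))).symm
  · intro a b c _ _ f
    apply heq_of_eq
    refine (congrArg (fun u => map (grayMap (𝟙 A) (assocHom B C D))
      (map (assocHom A (gray B C) D) u)) (grayMap_inr (assocHom A B C) (𝟙 D) _ f)).trans ?_
    refine (congrArg (map (grayMap (𝟙 A) (assocHom B C D)))
      (assocHom_inr A (gray B C) D a ⟨b, c⟩ f)).trans ?_
    refine (grayMap_inr (𝟙 A) (assocHom B C D) a _).trans ?_
    refine (congrArg (Gray.inr a) (assocHom_inr B C D b c f)).trans ?_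
    exact ((congrArg (map (assocHom A B (gray C D)))
      (assocHom_inr (gray A B) C D ⟨a, b⟩ c f)).trans
        (assocHom_inr A B (gray C D) a b (Gray.inr c f))).symm

/-- The monoidal category of small 2-categories and 2-functors, with the Gray tensor product. -/
instance : MonoidalCategoryStruct TwoCat where
  tensorObj := gray
  whiskerLeft A _ _ G := grayMap (𝟙 A) G
  whiskerRight F B := grayMap F (𝟙 B)
  tensorHom := grayMap
  tensorUnit := pt
  associator := assoc
  leftUnitor := leftUnitor
  rightUnitor := rightUnitor

attribute [local irreducible] grayMap assocHom

instance : MonoidalCategory TwoCat := MonoidalCategory.ofTensorHom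
  (id_tensorHom_id := grayMap_id)
  (id_tensorHom := fun _ _ _ _ => rfl)
  (tensorHom_id := fun _ _ => rfl)
  (tensorHom_comp_tensorHom := fun F G F' G' => grayMap_comp F F' G G')
  (associator_naturality := assoc_naturality)
  (leftUnitor_naturality := fun G => grayMap_π₂ (𝟙 pt) G)
  (rightUnitor_naturality := fun F => grayMap_π₁ F (𝟙 pt))
  (pentagon := pentagon_eq)
  (triangle := triangle_eq)

end
end TwoCat

/-- The only 0-cell of the 2-category of words over `L`. -/
structure FreeObj (L : Type) : Type where

/-- A 2-cell between two words is a label-preserving bijection between their positions. -/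
structure FreeHom₂ {L : Type} (u v : List L) where
  equiv : Fin u.length ≃ Fin v.length
  label : ∀ i, v.get (equiv i) = u.get i

namespace Words

variable {L L' : Type}

theorem hom₂_ext' {u v : List L} {η θ : FreeHom₂ u v}
    (h : ∀ i, (η.equiv i).val = (θ.equiv i).val) : η = θ := by
  cases η; cases θ
  congr 1
  exact Equiv.ext (fun i => Fin.ext (h i))

/-- The positions of a concatenated word. -/
def join (u v : List L) : Fin u.length ⊕ Fin v.length ≃ Fin (u ++ v).length :=
  finSumFinEquiv.trans (finCongr List.length_append.symm)

theorem join_inl_val (u v : List L) (i : Fin u.length) : (join u v (.inl i)).val = i.val := rfl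

theorem join_inr_val (u v : List L) (i : Fin v.length) :
    (join u v (.inr i)).val = u.length + i.val := rfl

theorem get_join_inl (u v : List L) (i : Fin u.length) :
    (u ++ v).get (join u v (.inl i)) = u.get i := by
  simp [join]

theorem get_join_inr (u v : List L) (i : Fin v.length) :
    (u ++ v).get (join u v (.inr i)) = v.get i := by
  simp [join]

/-- The horizontal composite of two 2-cells. -/
def hcomp {u u' v v' : List L} (η : FreeHom₂ u u') (θ : FreeHom₂ v v') :
    FreeHom₂ (u ++ v) (u' ++ v') where
  equiv := (join u v).symm.trans ((Equiv.sumCongr η.equiv θ.equiv).trans (join u' v'))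
  label i := by
    obtain ⟨i | i, rfl⟩ := (join u v).surjective i
    · simp only [Equiv.trans_apply, Equiv.symm_apply_apply, Equiv.sumCongr_apply, Sum.map_inl]
      rw [get_join_inl, get_join_inl, η.label]
    · simp only [Equiv.trans_apply, Equiv.symm_apply_apply, Equiv.sumCongr_apply, Sum.map_inr]
      rw [get_join_inr, get_join_inr, θ.label]

theorem hcomp_inl {u u' v v' : List L} (η : FreeHom₂ u u') (θ : FreeHom₂ v v')
    (i : Fin u.length) :
    (hcomp η θ).equiv (join u v (.inl i)) = join u' v' (.inl (η.equiv i)) := by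
  simp [hcomp]

theorem hcomp_inr {u u' v v' : List L} (η : FreeHom₂ u u') (θ : FreeHom₂ v v')
    (i : Fin v.length) :
    (hcomp η θ).equiv (join u v (.inr i)) = join u' v' (.inr (θ.equiv i)) := by
  simp [hcomp]

/-- The identity 2-cell. -/
def id₂ (u : List L) : FreeHom₂ u u := ⟨Equiv.refl _, fun _ => rfl⟩

/-- The vertical composite of two 2-cells. -/
def comp₂ {u v w : List L} (η : FreeHom₂ u v) (θ : FreeHom₂ v w) : FreeHom₂ u w :=
  ⟨η.equiv.trans θ.equiv, fun i => (θ.label _).trans (η.label i)⟩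

/-- The 2-cell between two equal words which preserves the order of the positions. -/
def cast₂ {u v : List L} (h : u = v) : FreeHom₂ u v :=
  ⟨finCongr (congrArg List.length h), fun i => by subst h; rfl⟩

instance : CategoryStruct (FreeObj L) where
  Hom _ _ := List L
  id _ := []
  comp u v := u ++ v

instance (x y : FreeObj L) : Category (x ⟶ y) where
  Hom u v := FreeHom₂ (L := L) u v
  id u := id₂ u
  comp η θ := comp₂ η θ
  id_comp _ := rfl
  comp_id _ := rfl
  assoc _ _ _ := rfl

/-- The invertible 2-cell between two equal words. -/
def castIso {x y : FreeObj L} {u v : x ⟶ y} (h : u = v) : u ≅ v where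
  hom := cast₂ h
  inv := cast₂ h.symm
  hom_inv_id := hom₂_ext' fun _ => rfl
  inv_hom_id := hom₂_ext' fun _ => rfl

theorem castIso_eq {x y : FreeObj L} {u v : x ⟶ y} (h : u = v) : castIso h = eqToIso h := by
  subst h; rfl

/-- Two 2-cells out of a concatenated word agree if they agree on both parts. -/
theorem ext_join {u v w : List L} {η θ : FreeHom₂ (u ++ v) w}
    (hl : ∀ i, (η.equiv (join u v (.inl i))).val = (θ.equiv (join u v (.inl i))).val)
    (hr : ∀ i, (η.equiv (join u v (.inr i))).val = (θ.equiv (join u v (.inr i))).val) :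
    η = θ := by
  apply hom₂_ext'
  intro i
  obtain ⟨i | i, rfl⟩ := (join u v).surjective i
  exacts [hl i, hr i]

theorem hcomp_val_inl {u u' v v' : List L} (η : FreeHom₂ u u') (θ : FreeHom₂ v v')
    (k : Fin (u ++ v).length) (i : Fin u.length) (h : k.val = i.val) :
    ((hcomp η θ).equiv k).val = (η.equiv i).val := by
  obtain rfl : k = join u v (.inl i) := Fin.ext h
  rw [hcomp_inl]; rfl

theorem hcomp_val_inr {u u' v v' : List L} (η : FreeHom₂ u u') (θ : FreeHom₂ v v')
    (k : Fin (u ++ v).length) (i : Fin v.length) (h : k.val = u.length + i.val) :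
    ((hcomp η θ).equiv k).val = u'.length + (θ.equiv i).val := by
  obtain rfl : k = join u v (.inr i) := Fin.ext h
  rw [hcomp_inr]; rfl

theorem length_eq {u v : List L} (η : FreeHom₂ u v) : u.length = v.length :=
  Fin.equiv_iff_eq.mp ⟨η.equiv⟩

theorem hcomp_id (u v : List L) : hcomp (id₂ u) (id₂ v) = id₂ (u ++ v) :=
  ext_join (fun i => by rw [hcomp_inl]; rfl) (fun i => by rw [hcomp_inr]; rfl)

theorem hcomp_comp {u u' u'' v v' v'' : List L} (η : FreeHom₂ u u') (η' : FreeHom₂ u' u'')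
    (θ : FreeHom₂ v v') (θ' : FreeHom₂ v' v'') :
    hcomp (comp₂ η η') (comp₂ θ θ') = comp₂ (hcomp η θ) (hcomp η' θ') :=
  ext_join
    (fun i => by
      rw [hcomp_inl]
      change _ = ((hcomp η' θ').equiv ((hcomp η θ).equiv _)).val
      rw [hcomp_inl, hcomp_inl]; rfl)
    (fun i => by
      rw [hcomp_inr]
      change _ = ((hcomp η' θ').equiv ((hcomp η θ).equiv _)).val
      rw [hcomp_inr, hcomp_inr]; rfl)

theorem hcomp_nil_left {u v : List L} (η : FreeHom₂ u v) : hcomp (id₂ []) η = η :=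
  hom₂_ext' fun i => by
    rw [hcomp_val_inr (id₂ []) η i i (by simp)]; simp

theorem hcomp_nil_right {u v : List L} (η : FreeHom₂ u v) :
    hcomp η (id₂ []) =
      comp₂ (cast₂ (List.append_nil u)) (comp₂ η (cast₂ (List.append_nil v).symm)) :=
  ext_join (fun i => by rw [hcomp_inl]; rfl) (fun i => i.elim0)

theorem hcomp_assoc {u u' v v' w w' : List L} (η : FreeHom₂ u u') (θ : FreeHom₂ v v')
    (κ : FreeHom₂ w w') :
    hcomp (hcomp η θ) κ = comp₂ (cast₂ (List.append_assoc u v w))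
      (comp₂ (hcomp η (hcomp θ κ)) (cast₂ (List.append_assoc u' v' w').symm)) := by
  have hη := length_eq η
  have hθ := length_eq θ
  refine ext_join (fun i => ?_) (fun i => ?_)
  · obtain ⟨i | i, rfl⟩ := (join u v).surjective i
    · rw [hcomp_inl, join_inl_val, hcomp_inl, join_inl_val]
      exact (hcomp_val_inl η (hcomp θ κ) _ i rfl).symm
    · rw [hcomp_inl, join_inl_val, hcomp_inr, join_inr_val]
      refine Eq.symm ((hcomp_val_inr η (hcomp θ κ) _ (join v w (.inl i)) rfl).trans ?_)
      rw [hcomp_inl]; rfl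
  · rw [hcomp_inr, join_inr_val]
    refine Eq.symm ((hcomp_val_inr η (hcomp θ κ) _ (join v w (.inr i)) ?_).trans ?_)
    · change (u ++ v).length + i.val = u.length + (v.length + i.val)
      simp [Nat.add_assoc]
    · rw [hcomp_inr, join_inr_val]; simp [Nat.add_assoc]

theorem cast₂_trans {u v w : List L} (h : u = v) (h' : v = w) :
    comp₂ (cast₂ h) (cast₂ h') = cast₂ (h.trans h') := rfl

theorem hcomp_cast_left {u u' : List L} (h : u = u') (v : List L) :
    hcomp (cast₂ h) (id₂ v) = cast₂ (congrArg (· ++ v) h) := by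
  subst h; exact hcomp_id u v

theorem hcomp_cast_right (u : List L) {v v' : List L} (h : v = v') :
    hcomp (id₂ u) (cast₂ h) = cast₂ (congrArg (u ++ ·) h) := by
  subst h; exact hcomp_id u v

instance : Bicategory (FreeObj L) where
  whiskerLeft u _ _ η := hcomp (id₂ (L := L) u) η
  whiskerRight η u := hcomp η (id₂ (L := L) u)
  associator u v w := castIso (List.append_assoc (α := L) u v w)
  leftUnitor u := castIso (List.nil_append (α := L) u)
  rightUnitor u := castIso (List.append_nil (α := L) u)
  whiskerLeft_id u v := hcomp_id (L := L) u v
  whiskerLeft_comp u _ _ _ η θ := hcomp_comp (id₂ (L := L) u) (id₂ u) η θ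
  id_whiskerLeft η := hcomp_nil_left (L := L) η
  comp_whiskerLeft u v _ _ η := by
    have e := hcomp_assoc (id₂ (L := L) u) (id₂ (L := L) v) η
    rw [hcomp_id] at e
    exact e
  id_whiskerRight u v := hcomp_id (L := L) u v
  comp_whiskerRight η θ u := hcomp_comp η θ (id₂ (L := L) u) (id₂ u)
  whiskerRight_id η := hcomp_nil_right (L := L) η
  whiskerRight_comp η v w := by
    have e := hcomp_assoc η (id₂ (L := L) v) (id₂ (L := L) w)
    rw [hcomp_id] at e
    have e' := congrArg (fun κ => comp₂ (cast₂ (List.append_assoc (α := L) _ v w).symm)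
      (comp₂ κ (cast₂ (List.append_assoc (α := L) _ v w)))) e
    exact e'.symm
  whisker_assoc u _ _ η w := hcomp_assoc (id₂ (L := L) u) η (id₂ (L := L) w)
  whisker_exchange {a b c f g h i} η θ := by
    exact (hcomp_comp (id₂ (L := L) f) η θ (id₂ (L := L) i)).symm.trans
      (hcomp_comp η (id₂ (L := L) g) (id₂ (L := L) h) θ)
  pentagon u v w z :=
    congrArg₂ (fun κ κ' => comp₂ κ (comp₂ (cast₂ (List.append_assoc (α := L) u (List.append (α := L) v w) z)) κ'))
      (hcomp_cast_left (List.append_assoc (α := L) u v w) z)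
      (hcomp_cast_right u (List.append_assoc (α := L) v w z))
  triangle u v :=
    (congrArg (comp₂ (cast₂ (List.append_assoc (α := L) u [] v)))
      (hcomp_cast_right u (List.nil_append (α := L) v))).trans
      (hcomp_cast_left (List.append_nil (α := L) u) v).symm

instance : Bicategory.Strict (FreeObj L) where
  id_comp u := List.nil_append (α := L) u
  comp_id u := List.append_nil (α := L) u
  assoc u v w := List.append_assoc (α := L) u v w
  leftUnitor_eqToIso _ := castIso_eq _
  rightUnitor_eqToIso _ := castIso_eq _
  associator_eqToIso _ _ _ := castIso_eq _

theorem eqToHom_eq {x y : FreeObj L} {u v : x ⟶ y} (h : u = v) : eqToHom h = cast₂ h :=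
  (congrArg Iso.hom (castIso_eq h)).symm

/-- The number of letters of the word before position `i` on which `h` is defined. -/
def posFun (h : L → Option L') (u : List L) (i : {i : Fin u.length // (h (u.get i)).isSome}) :
    Fin (u.filterMap h).length :=
  ⟨((u.take i.1.val).filterMap h).length, by
    have e : u = u.take i.1.val ++ (u.get i.1 :: u.drop (i.1.val + 1)) := by simp
    obtain ⟨y, hy⟩ := Option.isSome_iff_exists.mp i.2
    have e' : u.filterMap h = (u.take i.1.val).filterMap h ++
        (y :: (u.drop (i.1.val + 1)).filterMap h) := by
      conv_lhs => rw [e]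
      rw [List.filterMap_append, List.filterMap_cons_some hy]
    rw [e']; simp⟩

theorem get_posFun (h : L → Option L') (u : List L)
    (i : {i : Fin u.length // (h (u.get i)).isSome}) :
    some ((u.filterMap h).get (posFun h u i)) = h (u.get i.1) := by
  have e : u = u.take i.1.val ++ (u.get i.1 :: u.drop (i.1.val + 1)) := by simp
  obtain ⟨y, hy⟩ := Option.isSome_iff_exists.mp i.2
  have e' : u.filterMap h = (u.take i.1.val).filterMap h ++
      (y :: (u.drop (i.1.val + 1)).filterMap h) := by
    conv_lhs => rw [e]
    rw [List.filterMap_append, List.filterMap_cons_some hy]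
  rw [hy]
  simp only [posFun, List.get_eq_getElem]
  rw [← List.getElem?_eq_getElem, e']
  simp

theorem posFun_lt (h : L → Option L') (u : List L)
    {i j : {i : Fin u.length // (h (u.get i)).isSome}} (hij : i.1.val < j.1.val) :
    (posFun h u i).val < (posFun h u j).val := by
  obtain ⟨y, hy⟩ := Option.isSome_iff_exists.mp i.2
  have e : u.take (i.1.val + 1) = u.take i.1.val ++ [u.get i.1] := by
    simp
  have e₂ : (u.take j.1.val).take (i.1.val + 1) = u.take (i.1.val + 1) := by
    rw [List.take_take]; congr 1; omega
  have e₃ : u.take j.1.val = u.take i.1.val ++ (u.get i.1 :: (u.take j.1.val).drop (i.1.val + 1)) := by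
    conv_lhs => rw [← List.take_append_drop (i.1.val + 1) (u.take j.1.val), e₂, e, List.append_assoc,
      List.singleton_append]
  change ((u.take i.1.val).filterMap h).length < ((u.take j.1.val).filterMap h).length
  rw [e₃, List.filterMap_append, List.filterMap_cons_some hy]
  simp

theorem posFun_surjective (h : L → Option L') (u : List L) (j : ℕ)
    (hj : j < (u.filterMap h).length) : ∃ i, (posFun h u i).val = j := by
  induction u using List.reverseRecOn with
  | nil => simp at hj
  | append_singleton u a ih =>
    by_cases hj' : j < (u.filterMap h).length
    · obtain ⟨i, hi⟩ := ih hj'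
      refine ⟨⟨join u [a] (.inl i.1), by rw [get_join_inl]; exact i.2⟩, ?_⟩
      rw [← hi]
      change (((u ++ [a]).take i.1.val).filterMap h).length = ((u.take i.1.val).filterMap h).length
      rw [List.take_append_of_le_length i.1.2.le]
    · have hs : (h a).isSome := by
        by_contra hn
        have hn' : h a = none := by simpa using hn
        rw [List.filterMap_append] at hj
        simp [hn'] at hj
        omega
      have hjl : j = (u.filterMap h).length := by
        obtain ⟨y, hy⟩ := Option.isSome_iff_exists.mp hs
        rw [List.filterMap_append] at hj
        simp [hy] at hj
        omega
      refine ⟨⟨join u [a] (.inr ⟨0, by simp⟩), by rw [get_join_inr]; exact hs⟩, ?_⟩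
      rw [hjl]
      change (((u ++ [a]).take (u.length + 0)).filterMap h).length = _
      simp

/-- The order-preserving bijection between the positions of a word on which `h` is defined and the
positions of the word obtained by applying `h` and erasing the letters on which `h` is undefined. -/
noncomputable def pos (h : L → Option L') (u : List L) :
    {i : Fin u.length // (h (u.get i)).isSome} ≃ Fin (u.filterMap h).length :=
  Equiv.ofBijective (posFun h u)
    ⟨fun i j e => by
      rcases lt_trichotomy i.1.val j.1.val with hl | he | hl
      · exact absurd (congrArg Fin.val e) (posFun_lt h u hl).ne
      · exact Subtype.ext (Fin.ext he)
      · exact absurd (congrArg Fin.val e) (posFun_lt h u hl).ne',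
    fun j => by
      obtain ⟨i, hi⟩ := posFun_surjective h u j.val j.2
      exact ⟨i, Fin.ext hi⟩⟩

theorem pos_val (h : L → Option L') (u : List L)
    (i : {i : Fin u.length // (h (u.get i)).isSome}) :
    (pos h u i).val = ((u.take i.1.val).filterMap h).length := rfl

/-- The restriction of a label-preserving bijection to the positions on which `h` is defined. -/
def restr (h : L → Option L') {u v : List L} (η : FreeHom₂ u v) :
    {i : Fin u.length // (h (u.get i)).isSome} ≃ {i : Fin v.length // (h (v.get i)).isSome} :=
  η.equiv.subtypeEquiv (fun i => by rw [η.label i])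

/-- The image of a 2-cell under the application of a partial function to the letters. -/
noncomputable def map₂ (h : L → Option L') {u v : List L} (η : FreeHom₂ u v) :
    FreeHom₂ (u.filterMap h) (v.filterMap h) where
  equiv := (pos h u).symm.trans ((restr h η).trans (pos h v))
  label j := by
    obtain ⟨i, rfl⟩ := (pos h u).surjective j
    apply Option.some_injective
    refine Eq.trans ?_ (get_posFun h u i).symm
    simp only [Equiv.trans_apply, Equiv.symm_apply_apply]
    refine (get_posFun h v _).trans ?_
    exact congrArg h (η.label i.1)

theorem map₂_pos (h : L → Option L') {u v : List L} (η : FreeHom₂ u v)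
    (i : {i : Fin u.length // (h (u.get i)).isSome}) :
    (map₂ h η).equiv (pos h u i) = pos h v (restr h η i) := by
  simp [map₂]

theorem map₂_hcomp (h : L → Option L') {u u' v v' : List L} (η : FreeHom₂ u u')
    (θ : FreeHom₂ v v') :
    map₂ h (hcomp η θ) = comp₂ (cast₂ List.filterMap_append)
      (comp₂ (hcomp (map₂ h η) (map₂ h θ)) (cast₂ List.filterMap_append.symm)) := by
  apply hom₂_ext'
  intro j
  obtain ⟨⟨i, hi⟩, rfl⟩ := (pos h (u ++ v)).surjective j
  rw [map₂_pos]
  obtain ⟨i | i, rfl⟩ := (join u v).surjective i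
  · have hi' : (h (u.get i)).isSome := by rwa [get_join_inl] at hi
    refine Eq.trans ?_ (hcomp_val_inl (map₂ h η) (map₂ h θ) _ (pos h u ⟨i, hi'⟩) ?_).symm
    · rw [map₂_pos, pos_val, pos_val]
      change (((u' ++ v').take ((hcomp η θ).equiv _).val).filterMap h).length = _
      rw [hcomp_inl, join_inl_val, List.take_append_of_le_length (η.equiv i).2.le]
      rfl
    · change (((u ++ v).take i.val).filterMap h).length = ((u.take i.val).filterMap h).length
      rw [List.take_append_of_le_length i.2.le]
  · have hi' : (h (v.get i)).isSome := by rwa [get_join_inr] at hi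
    refine Eq.trans ?_ (hcomp_val_inr (map₂ h η) (map₂ h θ) _ (pos h v ⟨i, hi'⟩) ?_).symm
    · rw [map₂_pos, pos_val, pos_val]
      change (((u' ++ v').take ((hcomp η θ).equiv _).val).filterMap h).length = _
      rw [hcomp_inr, join_inr_val, List.take_length_add_append, List.filterMap_append,
        List.length_append]
      rfl
    · change (((u ++ v).take (u.length + i.val)).filterMap h).length =
        (u.filterMap h).length + ((v.take i.val).filterMap h).length
      rw [List.take_length_add_append, List.filterMap_append, List.length_append]

theorem map₂_id (h : L → Option L') (u : List L) : map₂ h (id₂ u) = id₂ (u.filterMap h) := by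
  apply hom₂_ext'
  intro j
  obtain ⟨i, rfl⟩ := (pos h u).surjective j
  rw [map₂_pos]; rfl

theorem map₂_comp (h : L → Option L') {u v w : List L} (η : FreeHom₂ u v) (θ : FreeHom₂ v w) :
    map₂ h (comp₂ η θ) = comp₂ (map₂ h η) (map₂ h θ) := by
  apply hom₂_ext'
  intro j
  obtain ⟨i, rfl⟩ := (pos h u).surjective j
  rw [map₂_pos]
  change _ = ((map₂ h θ).equiv ((map₂ h η).equiv _)).val
  rw [map₂_pos, map₂_pos]; rfl

end Words

namespace TwoCat

/-- The 2-category with one 0-cell freely generated by the letters in `L` as a strict symmetric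
monoidal category: its 1-cells are the words over `L`, composed by concatenation (in the order of
time), and its 2-cells are the label-preserving bijections. -/
abbrev free (L : Type) : TwoCat := ⟨FreeObj L⟩

/-- The 1-cell given by a word. -/
abbrev freeWord {L : Type} (u : List L) : (FreeObj.mk : free L) ⟶ (FreeObj.mk : free L) := u

/-- The 2-functor which sends every letter `l` with `h l = some l'` to `l'`, erases the letters `l`
with `h l = none`, and restricts the bijections accordingly. -/
noncomputable def partialMap {L L' : Type} (h : L → Option L') : free L ⟶ free L' := ofCore
  { obj := fun _ => FreeObj.mk
    map := fun u => List.filterMap (α := L) h u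
    map₂ := fun η => Words.map₂ h η
    map₂_id := fun u => Words.map₂_id (L := L) h u
    map₂_comp := fun η θ => Words.map₂_comp (L := L) h η θ
    map_id := fun _ => rfl
    map_comp := fun u v => List.filterMap_append (f := h) (l := u) (l' := v)
    map₂_whisker_left := fun u _ _ η => by
      rw [Words.eqToHom_eq, Words.eqToHom_eq]
      refine (Words.map₂_hcomp (L := L) h (Words.id₂ u) η).trans ?_
      rw [Words.map₂_id]; rfl
    map₂_whisker_right := fun η u => by
      rw [Words.eqToHom_eq, Words.eqToHom_eq]
      refine (Words.map₂_hcomp (L := L) h η (Words.id₂ u)).trans ?_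
      rw [Words.map₂_id]; rfl }

section
variable {L : Type} {A B : TwoCat}

/-- The 1-cell of the Gray tensor product associated with a word, given the 1-cells associated with
the letters. -/
def wordHom {F : free L ⟶ A} {G : free L ⟶ B}
    (h : L → ((⟨obj F FreeObj.mk, obj G FreeObj.mk⟩ : GrayObj A B) ⟶
      ⟨obj F FreeObj.mk, obj G FreeObj.mk⟩)) :
    List L → ((⟨obj F FreeObj.mk, obj G FreeObj.mk⟩ : GrayObj A B) ⟶
      ⟨obj F FreeObj.mk, obj G FreeObj.mk⟩)
  | [] => 𝟙 _
  | l :: u => h l ≫ wordHom h u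

/-- The 2-functor from `free L` to a Gray tensor product which sends every letter `l` to the 1-cell
`h l`, and whose projections are the 2-functors `F` and `G`. -/
def toGray (F : free L ⟶ A) (G : free L ⟶ B)
    (h : L → ((⟨obj F FreeObj.mk, obj G FreeObj.mk⟩ : GrayObj A B) ⟶
      ⟨obj F FreeObj.mk, obj G FreeObj.mk⟩))
    (h_fst : ∀ l, GrayHom.fst (h l) = map F (freeWord [l]))
    (h_snd : ∀ l, GrayHom.snd (h l) = map G (freeWord [l])) : free L ⟶ gray A B :=
  pair F G (fun u => wordHom h u)
    (fun u => by
      change List L at u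
      induction u with
      | nil => exact (map_id F FreeObj.mk).symm
      | cons l u ih =>
        refine Eq.trans ?_ (map_comp F (freeWord [l]) (freeWord u)).symm
        exact congrArg₂ (· ≫ ·) (h_fst l) (ih))
    (fun u => by
      change List L at u
      induction u with
      | nil => exact (map_id G FreeObj.mk).symm
      | cons l u ih =>
        refine Eq.trans ?_ (map_comp G (freeWord [l]) (freeWord u)).symm
        exact congrArg₂ (· ≫ ·) (h_snd l) (ih))
    (fun _ => rfl)
    (fun u v => by
      change List L at u
      change List L at v
      change wordHom h (u ++ v) = wordHom h u ≫ wordHom h v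
      induction u with
      | nil => exact (Bicategory.Strict.id_comp _).symm
      | cons l u ih =>
        change h l ≫ wordHom h (u ++ v) = (h l ≫ wordHom h u) ≫ wordHom h v
        rw [ih, Bicategory.Strict.assoc])

end

end TwoCat

end TwoCategories

section Comodules

open CategoryTheory MonoidalCategory Limits
open scoped ComonObj

universe v u

variable {C : Type u} [Category.{v} C] [MonoidalCategory C]

/-- An `A,B`-bicomodule structure on the object `X`, for comonoids `A` and `B`. -/
structure BicomoduleStr (A B X : C) [ComonObj A] [ComonObj B] where
  coact : X ⟶ A ⊗ (X ⊗ B)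
  coassoc : coact ≫ A ◁ (coact ▷ B) ≫ A ◁ (α_ A (X ⊗ B) B).hom ≫ (α_ A A ((X ⊗ B) ⊗ B)).inv ≫
      (A ⊗ A) ◁ (α_ X B B).hom = coact ≫ (Δ[A] ⊗ₘ (X ◁ Δ[B]))
  counit : coact ≫ (ε[A] ⊗ₘ (X ◁ ε[B])) ≫ (λ_ (X ⊗ 𝟙_ C)).hom ≫ (ρ_ X).hom = 𝟙 X

namespace BicomoduleStr

variable {A B D X Y : C} [ComonObj A] [ComonObj B] [ComonObj D]

/-- The left coaction. -/
def left (S : BicomoduleStr A B X) : X ⟶ A ⊗ X :=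
  S.coact ≫ A ◁ (X ◁ ε[B]) ≫ A ◁ (ρ_ X).hom

/-- The right coaction. -/
def right (S : BicomoduleStr A B X) : X ⟶ X ⊗ B :=
  S.coact ≫ ε[A] ▷ (X ⊗ B) ≫ (λ_ (X ⊗ B)).hom

/-- The first of the two morphisms whose equalizer is the horizontal composite. -/
def fork₁ (S : BicomoduleStr A B X) (_ : BicomoduleStr B D Y) : X ⊗ Y ⟶ X ⊗ (B ⊗ Y) :=
  S.right ▷ Y ≫ (α_ X B Y).hom

/-- The second of the two morphisms whose equalizer is the horizontal composite. -/
def fork₂ (_ : BicomoduleStr A B X) (T : BicomoduleStr B D Y) : X ⊗ Y ⟶ X ⊗ (B ⊗ Y) :=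
  X ◁ T.left

end BicomoduleStr

/-- A morphism `φ : X ⟶ Y` is a double cell with identity vertical edges, between two `A,B`-bicomodules
with coactions `c` and `c'`. -/
def IsBicomoduleHom {A B X Y : C} (c : X ⟶ A ⊗ (X ⊗ B)) (c' : Y ⟶ A ⊗ (Y ⊗ B)) (φ : X ⟶ Y) : Prop :=
  φ ≫ c' = c ≫ A ◁ (φ ▷ B)

/-- The coaction of the identity bicomodule on a comonoid `A`. -/
def idCoact (A : C) [ComonObj A] : A ⟶ A ⊗ (A ⊗ A) := Δ[A] ≫ A ◁ Δ[A]

/-- A horizontal composite of bicomodules: an equalizer of the right coaction of `S` and of the left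
coaction of `T`, which remains an equalizer when it is tensored with `A` and `D`, together with the
bicomodule structure induced by the left coaction of `S` and the right coaction of `T`. -/
structure HComposite {A B D X Y : C} [ComonObj A] [ComonObj B] [ComonObj D]
    (S : BicomoduleStr A B X) (T : BicomoduleStr B D Y) where
  obj : C
  equ : obj ⟶ X ⊗ Y
  condition : equ ≫ S.fork₁ T = equ ≫ S.fork₂ T
  isLimit : IsLimit (Fork.ofι equ condition)
  tensor_condition : A ◁ (equ ▷ D) ≫ A ◁ (S.fork₁ T ▷ D) = A ◁ (equ ▷ D) ≫ A ◁ (S.fork₂ T ▷ D)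
  tensor_isLimit : IsLimit (Fork.ofι (A ◁ (equ ▷ D)) tensor_condition)
  str : BicomoduleStr A D obj
  coact_equ : str.coact ≫ A ◁ (equ ▷ D) =
    equ ≫ (S.left ⊗ₘ T.right) ≫ (α_ A X (Y ⊗ D)).hom ≫ A ◁ (α_ X Y D).inv

/-- An internal category in a monoidal category, with comonoid of objects `A₀` and object of morphisms
`A₁`: a monad in the weak double category of comonoids and bicomodules. -/
structure InternalCategory (A₀ A₁ : C) [ComonObj A₀] where
  bicomodule : BicomoduleStr A₀ A₀ A₁
  /-- the composite of the bicomodule with itself -/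
  comp₂ : HComposite bicomodule bicomodule
  /-- the threefold composite, bracketed on the left -/
  comp₃ : HComposite comp₂.str bicomodule
  /-- the threefold composite, bracketed on the right -/
  comp₃' : HComposite bicomodule comp₂.str
  /-- the associativity isomorphism of horizontal composition -/
  assoc : comp₃.obj ≅ comp₃'.obj
  assoc_equ : assoc.hom ≫ comp₃'.equ ≫ A₁ ◁ comp₂.equ =
    comp₃.equ ≫ comp₂.equ ▷ A₁ ≫ (α_ A₁ A₁ A₁).hom
  mult : comp₂.obj ⟶ A₁
  mult_hom : IsBicomoduleHom comp₂.str.coact bicomodule.coact mult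
  unit : A₀ ⟶ A₁
  unit_hom : IsBicomoduleHom (idCoact A₀) bicomodule.coact unit
  /-- the horizontal composite of `mult` with the identity -/
  multLeft : comp₃.obj ⟶ comp₂.obj
  multLeft_equ : multLeft ≫ comp₂.equ = comp₃.equ ≫ mult ▷ A₁
  /-- the horizontal composite of the identity with `mult` -/
  multRight : comp₃'.obj ⟶ comp₂.obj
  multRight_equ : multRight ≫ comp₂.equ = comp₃'.equ ≫ A₁ ◁ mult
  /-- the horizontal composite of `unit` with the identity -/
  unitLeft : A₁ ⟶ comp₂.obj
  unitLeft_equ : unitLeft ≫ comp₂.equ = bicomodule.left ≫ unit ▷ A₁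
  /-- the horizontal composite of the identity with `unit` -/
  unitRight : A₁ ⟶ comp₂.obj
  unitRight_equ : unitRight ≫ comp₂.equ = bicomodule.right ≫ A₁ ◁ unit
  mult_assoc : multLeft ≫ mult = assoc.hom ≫ multRight ≫ mult
  unit_mult : unitLeft ≫ mult = 𝟙 A₁
  mult_unit : unitRight ≫ mult = 𝟙 A₁

end Comodules

section Template

open CategoryTheory TwoCat

/-- The polarities of moves in a game. -/
inductive GameMove : Type
  | O | P

/-- The polarities of moves of a strategy, in the source (`s`) and in the target (`t`). -/
inductive StratMove : Type
  | Os | Ps | Ot | Pt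

/-- The polarities of moves of two interacting strategies. -/
inductive StratMove₂ : Type
  | Os | Ps | PO | OP | Ot | Pt

/-- The polarities of moves of three interacting strategies. -/
inductive StratMove₃ : Type
  | Os | Ps | POs | OPs | POt | OPt | Ot | Pt

/-- The 2-category of polarities of games. -/
abbrev anchorGame : TwoCat := free GameMove

/-- The 2-category of polarities of strategies. -/
abbrev anchorStrat : TwoCat := free StratMove

/-- The 1-cell of `free L ⊠ B` given by a letter on the left. -/
abbrev lft {L : Type} {B : TwoCat} (l : L) (b : B) :
    (⟨FreeObj.mk, b⟩ : GrayObj (free L) B) ⟶ ⟨FreeObj.mk, b⟩ :=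
  Gray.inl (freeWord [l]) b

/-- The 1-cell of `A ⊠ free L` given by a letter on the right. -/
abbrev rgt {L : Type} {A : TwoCat} (a : A) (l : L) :
    (⟨a, FreeObj.mk⟩ : GrayObj A (free L)) ⟶ ⟨a, FreeObj.mk⟩ :=
  Gray.inr a (freeWord [l])

/-- The 1-cells `O₂ · O₁` and `P₁ · P₂`. -/
def gameComulWord (l : GameMove) :
    (⟨FreeObj.mk, FreeObj.mk⟩ : GrayObj anchorGame anchorGame) ⟶ ⟨FreeObj.mk, FreeObj.mk⟩ :=
  match l with
  | .O => rgt (A := anchorGame) FreeObj.mk GameMove.O ≫ lft (B := anchorGame) GameMove.O FreeObj.mk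
  | .P => lft (B := anchorGame) GameMove.P FreeObj.mk ≫ rgt (A := anchorGame) FreeObj.mk GameMove.P

/-- The comultiplication `O ↦ O₂ · O₁` and `P ↦ P₁ · P₂`. -/
def gameComul : anchorGame ⟶ gray anchorGame anchorGame :=
  toGray (𝟙 anchorGame) (𝟙 anchorGame) gameComulWord
    (by rintro (_ | _) <;> rfl) (by rintro (_ | _) <;> rfl)

/-- The counit. -/
def gameCounit : anchorGame ⟶ pt := toPt anchorGame

/-- The projection of the moves of a strategy on the source game, where polarities are reversed. -/
noncomputable def stratSource : anchorStrat ⟶ anchorGame :=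
  partialMap (L := StratMove) (L' := GameMove) fun
    | .Os => some .P
    | .Ps => some .O
    | .Ot => none
    | .Pt => none

/-- The projection of the moves of a strategy on the target game. -/
noncomputable def stratTarget : anchorStrat ⟶ anchorGame :=
  partialMap (L := StratMove) (L' := GameMove) fun
    | .Os => none
    | .Ps => none
    | .Ot => some .O
    | .Pt => some .P

/-- The components of `Os`, `Ps · O₁`, `O₃ · Ot` and `Pt · P₃` in the strategy and in the target
game. -/
def stratCoactRightWord (l : StratMove) :
    (⟨FreeObj.mk, FreeObj.mk⟩ : GrayObj anchorStrat anchorGame) ⟶ ⟨FreeObj.mk, FreeObj.mk⟩ :=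
  match l with
  | .Os => lft (B := anchorGame) StratMove.Os FreeObj.mk
  | .Ps => lft (B := anchorGame) StratMove.Ps FreeObj.mk
  | .Ot => rgt (A := anchorStrat) FreeObj.mk GameMove.O ≫ lft (B := anchorGame) StratMove.Ot FreeObj.mk
  | .Pt => lft (B := anchorGame) StratMove.Pt FreeObj.mk ≫ rgt (A := anchorStrat) FreeObj.mk GameMove.P

/-- The component of the coaction in the strategy and in the target game. -/
noncomputable def stratCoactRight : anchorStrat ⟶ gray anchorStrat anchorGame :=
  toGray (𝟙 anchorStrat) stratTarget stratCoactRightWord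
    (by rintro (_ | _ | _ | _) <;> rfl) (by rintro (_ | _ | _ | _) <;> rfl)

/-- The 1-cells `P₁ · Os`, `Ps · O₁`, `O₃ · Ot` and `Pt · P₃`. -/
def stratCoactWord (l : StratMove) :
    (⟨FreeObj.mk, ⟨FreeObj.mk, FreeObj.mk⟩⟩ : GrayObj anchorGame (gray anchorStrat anchorGame)) ⟶
      ⟨FreeObj.mk, ⟨FreeObj.mk, FreeObj.mk⟩⟩ :=
  match l with
  | .Os => lft (B := (gray anchorStrat anchorGame)) GameMove.P ⟨FreeObj.mk, FreeObj.mk⟩ ≫ Gray.inr (A := anchorGame) FreeObj.mk (stratCoactRightWord .Os)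
  | .Ps => Gray.inr (A := anchorGame) FreeObj.mk (stratCoactRightWord .Ps) ≫ lft (B := (gray anchorStrat anchorGame)) GameMove.O ⟨FreeObj.mk, FreeObj.mk⟩
  | .Ot => Gray.inr (A := anchorGame) FreeObj.mk (stratCoactRightWord .Ot)
  | .Pt => Gray.inr (A := anchorGame) FreeObj.mk (stratCoactRightWord .Pt)

/-- The coaction `Os ↦ P₁ · Os`, `Ps ↦ Ps · O₁`, `Ot ↦ O₃ · Ot` and `Pt ↦ Pt · P₃`. -/
noncomputable def stratCoact : anchorStrat ⟶ gray anchorGame (gray anchorStrat anchorGame) :=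
  toGray stratSource stratCoactRight stratCoactWord
    (by rintro (_ | _ | _ | _) <;> rfl) (by rintro (_ | _ | _ | _) <;> rfl)

/-- The moves of two interacting strategies played by the first one. -/
noncomputable def fst₂ : free StratMove₂ ⟶ anchorStrat :=
  partialMap (L := StratMove₂) (L' := StratMove) fun
    | .Os => some .Os
    | .Ps => some .Ps
    | .PO => some .Ot
    | .OP => some .Pt
    | .Ot => none
    | .Pt => none

/-- The moves of two interacting strategies played by the second one. -/
noncomputable def snd₂ : free StratMove₂ ⟶ anchorStrat :=
  partialMap (L := StratMove₂) (L' := StratMove) fun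
    | .Os => none
    | .Ps => none
    | .PO => some .Ps
    | .OP => some .Os
    | .Ot => some .Ot
    | .Pt => some .Pt

/-- The pairs of moves played by two interacting strategies. -/
def inclWord₂ (l : StratMove₂) :
    (⟨FreeObj.mk, FreeObj.mk⟩ : GrayObj anchorStrat anchorStrat) ⟶ ⟨FreeObj.mk, FreeObj.mk⟩ :=
  match l with
  | .Os => lft (B := anchorStrat) StratMove.Os FreeObj.mk
  | .Ps => lft (B := anchorStrat) StratMove.Ps FreeObj.mk
  | .PO => rgt (A := anchorStrat) FreeObj.mk StratMove.Ps ≫ lft (B := anchorStrat) StratMove.Ot FreeObj.mk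
  | .OP => lft (B := anchorStrat) StratMove.Pt FreeObj.mk ≫ rgt (A := anchorStrat) FreeObj.mk StratMove.Os
  | .Ot => rgt (A := anchorStrat) FreeObj.mk StratMove.Ot
  | .Pt => rgt (A := anchorStrat) FreeObj.mk StratMove.Pt

/-- The 2-functor `PO ↦ Ps₂ · Ot₁` and `OP ↦ Pt₁ · Os₂`, which sends `Os` and `Ps` to the first
component, and `Ot` and `Pt` to the second component. -/
noncomputable def incl₂ : free StratMove₂ ⟶ gray anchorStrat anchorStrat :=
  toGray fst₂ snd₂ inclWord₂
    (by rintro (_ | _ | _ | _ | _ | _) <;> rfl) (by rintro (_ | _ | _ | _ | _ | _) <;> rfl)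

/-- The 2-functor which erases the internal moves of two interacting strategies. -/
noncomputable def hide : free StratMove₂ ⟶ anchorStrat :=
  partialMap (L := StratMove₂) (L' := StratMove) fun
    | .Os => some .Os
    | .Ps => some .Ps
    | .PO => none
    | .OP => none
    | .Ot => some .Ot
    | .Pt => some .Pt

/-- The moves of three interacting strategies played by the first one. -/
noncomputable def fst₃ : free StratMove₃ ⟶ anchorStrat :=
  partialMap (L := StratMove₃) (L' := StratMove) fun
    | .Os => some .Os
    | .Ps => some .Ps
    | .POs => some .Ot
    | .OPs => some .Pt
    | .POt => none
    | .OPt => none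
    | .Ot => none
    | .Pt => none

/-- The moves of three interacting strategies played by the second one. -/
noncomputable def snd₃ : free StratMove₃ ⟶ anchorStrat :=
  partialMap (L := StratMove₃) (L' := StratMove) fun
    | .Os => none
    | .Ps => none
    | .POs => some .Ps
    | .OPs => some .Os
    | .POt => some .Ot
    | .OPt => some .Pt
    | .Ot => none
    | .Pt => none

/-- The moves of three interacting strategies played by the third one. -/
noncomputable def thd₃ : free StratMove₃ ⟶ anchorStrat :=
  partialMap (L := StratMove₃) (L' := StratMove) fun
    | .Os => none
    | .Ps => none
    | .POs => none
    | .OPs => none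
    | .POt => some .Ps
    | .OPt => some .Os
    | .Ot => some .Ot
    | .Pt => some .Pt

/-- The moves played by the first two of three interacting strategies. -/
def inclLeftWord₃ (l : StratMove₃) :
    (⟨FreeObj.mk, FreeObj.mk⟩ : GrayObj anchorStrat anchorStrat) ⟶ ⟨FreeObj.mk, FreeObj.mk⟩ :=
  match l with
  | .Os => lft (B := anchorStrat) StratMove.Os FreeObj.mk
  | .Ps => lft (B := anchorStrat) StratMove.Ps FreeObj.mk
  | .POs => rgt (A := anchorStrat) FreeObj.mk StratMove.Ps ≫ lft (B := anchorStrat) StratMove.Ot FreeObj.mk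
  | .OPs => lft (B := anchorStrat) StratMove.Pt FreeObj.mk ≫ rgt (A := anchorStrat) FreeObj.mk StratMove.Os
  | .POt => rgt (A := anchorStrat) FreeObj.mk StratMove.Ot
  | .OPt => rgt (A := anchorStrat) FreeObj.mk StratMove.Pt
  | .Ot => 𝟙 _
  | .Pt => 𝟙 _

/-- The component of `incl₃` in the first two strategies. -/
noncomputable def inclLeft₃ : free StratMove₃ ⟶ gray anchorStrat anchorStrat :=
  toGray fst₃ snd₃ inclLeftWord₃
    (by rintro (_ | _ | _ | _ | _ | _ | _ | _) <;> rfl)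
    (by rintro (_ | _ | _ | _ | _ | _ | _ | _) <;> rfl)

/-- The moves played by three interacting strategies. -/
def inclWord₃ (l : StratMove₃) :
    (⟨⟨FreeObj.mk, FreeObj.mk⟩, FreeObj.mk⟩ :
        GrayObj (gray anchorStrat anchorStrat) anchorStrat) ⟶
      ⟨⟨FreeObj.mk, FreeObj.mk⟩, FreeObj.mk⟩ :=
  match l with
  | .Os => Gray.inl (B := anchorStrat) (inclLeftWord₃ .Os) FreeObj.mk
  | .Ps => Gray.inl (B := anchorStrat) (inclLeftWord₃ .Ps) FreeObj.mk
  | .POs => Gray.inl (B := anchorStrat) (inclLeftWord₃ .POs) FreeObj.mk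
  | .OPs => Gray.inl (B := anchorStrat) (inclLeftWord₃ .OPs) FreeObj.mk
  | .POt => rgt (A := (gray anchorStrat anchorStrat)) ⟨FreeObj.mk, FreeObj.mk⟩ StratMove.Ps ≫ Gray.inl (B := anchorStrat) (inclLeftWord₃ .POt) FreeObj.mk
  | .OPt => Gray.inl (B := anchorStrat) (inclLeftWord₃ .OPt) FreeObj.mk ≫ rgt (A := (gray anchorStrat anchorStrat)) ⟨FreeObj.mk, FreeObj.mk⟩ StratMove.Os
  | .Ot => rgt (A := (gray anchorStrat anchorStrat)) ⟨FreeObj.mk, FreeObj.mk⟩ StratMove.Ot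
  | .Pt => rgt (A := (gray anchorStrat anchorStrat)) ⟨FreeObj.mk, FreeObj.mk⟩ StratMove.Pt

/-- The 2-functor `POs ↦ Ps₂ · Ot₁`, `OPs ↦ Pt₁ · Os₂`, `POt ↦ Ps₃ · Ot₂` and `OPt ↦ Pt₂ · Os₃`, which
sends `Os` and `Ps` to the first component, and `Ot` and `Pt` to the third component. -/
noncomputable def incl₃ : free StratMove₃ ⟶ gray (gray anchorStrat anchorStrat) anchorStrat :=
  toGray inclLeft₃ thd₃ inclWord₃
    (by rintro (_ | _ | _ | _ | _ | _ | _ | _) <;> rfl)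
    (by rintro (_ | _ | _ | _ | _ | _ | _ | _) <;> rfl)

end Template

open CategoryTheory MonoidalCategory TwoCat

/-! All 2-categories involved have one 0-cell and a free monoid of 1-cells. This class is closed
under the Gray tensor product, because the coproduct of two free monoids is free on the disjoint
union of the alphabets (`Coded`). On 1-cells a 2-functor between such 2-categories is therefore a
substitution of words for letters (`letterMap`). Since a 2-cell of a Gray tensor product is a pair
of 2-cells, a 2-functor into it is determined by this substitution and by its two projections
(`ext_letterMap`). Applied once per tensor factor, this reduces every diagram to a case analysis on
letters and to identities between projections, most of them composites of letterwise 2-functors. The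
latter compose like partial functions (`partialMap_comp`), on 2-cells too.

Equalizers are recognized by `IsWordEqualizer`: a substitution with a left inverse, the lifting of
equalized words, and the unique lifting of equalized 2-cells. This criterion survives tensoring on
either side, since foreign letters are fixed by both maps and merely cut words into blocks. The
preservation of equalizers demanded of a horizontal composite follows.

The composites are computed for bicomodules of one shape: words over `L` with two partial functions
`s`, `t` from `L` to the game moves, with disjoint domains (`polarized`). In the composite of two of
them, a letter is either a letter of one side without image in the middle game, or a pair of letters
with the same image there. Indeed the first fork inserts the middle letter beside the letters of the
left component, and the second fork beside those of the right one. If they agree on a word, a left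
letter over `P` must be immediately followed by a right letter over `P`, and a right letter over `O`
by a left letter over `O` (`IsComposite.word`). On 2-cells, two bijections with the same restriction
to the middle game glue uniquely (`IsGluing.exists_glue`, `IsGluing.hom₂_ext`). The composite is
again polarized (`incl_coact`), so the construction iterates and gives both bracketings of the
threefold composite on one alphabet.

The multiplication erases letters, hence is associative. The unit sends a letter to two letters and
cannot be given by a partial function: it is the comultiplication of the game, transported along the
identification of the strategy bicomodule with the tensor square of the game, which is the composite
criterion for an empty middle game (`isComposite_game`). For the neutrality laws, the units lifted
to the twofold composite insert internal copycat moves, which the multiplication erases. -/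

open CategoryTheory MonoidalCategory TwoCat

/-! ### One-object 2-categories with free monoids of 1-cells, and their Gray tensor products -/

namespace TwoCat

/-- A one-object 2-category whose 1-cells are the words over the alphabet `Λ`. -/
class Coded (A : TwoCat) (Λ : outParam Type) where
  base : A
  eq_base : ∀ a : A, a = base
  code : ∀ {a b : A}, (a ⟶ b) → List Λ
  code_id : ∀ a : A, code (𝟙 a) = []
  code_comp : ∀ {a b c : A} (f : a ⟶ b) (g : b ⟶ c), code (f ≫ g) = code f ++ code g
  code_injective : ∀ {a b : A} {f g : a ⟶ b}, code f = code g → f = g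
  code_surjective : ∀ (a b : A) (w : List Λ), ∃ f : a ⟶ b, code f = w

open Coded

section
variable {A B C D X : TwoCat} {ΛA ΛB ΛC ΛD ΛX : Type} [Coded A ΛA] [Coded B ΛB] [Coded C ΛC]
  [Coded D ΛD] [Coded X ΛX]

theorem Coded.obj_eq {A : TwoCat} {ΛA : Type} [Coded A ΛA] (a b : A) : a = b := (eq_base a).trans (eq_base b).symm

/-- There is only one 0-cell, but endpoints are equal only propositionally. Codes, which live in a
fixed type, replace transports along these equalities. -/
theorem Coded.heq_of_code {a b a' b' : A} {f : a ⟶ b} {g : a' ⟶ b'} (h : code f = code g) :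
    HEq f g := by
  obtain rfl := Coded.obj_eq a a'
  obtain rfl := Coded.obj_eq b b'
  exact heq_of_eq (code_injective h)

theorem Coded.code_eq_of_heq {a b a' b' : A} {f : a ⟶ b} {g : a' ⟶ b'} (h : HEq f g) :
    code f = code g := by
  obtain rfl := Coded.obj_eq a a'
  obtain rfl := Coded.obj_eq b b'
  rw [eq_of_heq h]

/-- The 1-cell with a given code. -/
noncomputable def ofCode (A : TwoCat) {Λ : Type} [Coded A Λ] (w : List Λ) : (base : A) ⟶ base :=
  (code_surjective (base : A) base w).choose

@[simp] theorem code_ofCode (w : List ΛA) : code (ofCode A w) = w :=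
  (code_surjective (base : A) base w).choose_spec

theorem ofCode_code (f : (base : A) ⟶ base) : ofCode A (code f) = f :=
  code_injective (code_ofCode _)

theorem ofCode_nil : ofCode A ([] : List ΛA) = 𝟙 _ :=
  code_injective (by rw [code_ofCode, code_id])

theorem ofCode_append (v w : List ΛA) : ofCode A (v ++ w) = ofCode A v ≫ ofCode A w :=
  code_injective (by simp [code_comp])

instance (L : Type) : Coded (free L) L where
  base := FreeObj.mk
  eq_base _ := rfl
  code u := u
  code_id _ := rfl
  code_comp _ _ := rfl
  code_injective h := h
  code_surjective _ _ w := ⟨w, rfl⟩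

instance : Coded TwoCat.pt Empty where
  base := PtObj.mk
  eq_base _ := rfl
  code _ := []
  code_id _ := rfl
  code_comp _ _ := rfl
  code_injective _ := rfl
  code_surjective _ _ w := ⟨PtHom.mk, by cases w with | nil => rfl | cons a => exact a.elim⟩

/-- The letters of a word of the Gray tensor product. -/
def grayCodeData (A B : TwoCat) {ΛA ΛB : Type} [Coded A ΛA] [Coded B ΛB] :
    Funny.LiftData A B (free (ΛA ⊕ ΛB)) where
  obj _ _ := FreeObj.mk
  left f _ := (code f).map Sum.inl
  right _ _ _ g := (code g).map Sum.inr
  left_id a _ := by rw [code_id]; rfl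
  left_comp f f' _ := by rw [code_comp, List.map_append]; rfl
  right_id _ b := by rw [code_id]; rfl
  right_comp _ _ _ _ g g' := by rw [code_comp, List.map_append]; rfl

/-- The letters of a 1-cell of the Gray tensor product. -/
def grayCode {x y : GrayObj A B} (u : x ⟶ y) : List (ΛA ⊕ ΛB) :=
  (Funny.lift (grayCodeData A B)).map (GrayHom.word u)

theorem grayCode_id (x : GrayObj A B) : grayCode (𝟙 x) = [] :=
  (Funny.lift (grayCodeData A B)).map_id _

theorem grayCode_comp {x y z : GrayObj A B} (u : x ⟶ y) (v : y ⟶ z) :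
    grayCode (u ≫ v) = grayCode u ++ grayCode v :=
  (Funny.lift (grayCodeData A B)).map_comp _ _

theorem grayCode_inl {a a' : A} (f : a ⟶ a') (b : B) :
    grayCode (Gray.inl f b) = (code f).map Sum.inl :=
  Funny.lift_inl (grayCodeData A B) f b

theorem grayCode_inr (a : A) {b b' : B} (g : b ⟶ b') :
    grayCode (Gray.inr a g) = (code g).map Sum.inr :=
  Funny.lift_inr (grayCodeData A B) a g

/-- The 1-cell of the Gray tensor product with given letters. -/
noncomputable def grayDecode (A B : TwoCat) {ΛA ΛB : Type} [Coded A ΛA] [Coded B ΛB] :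
    List (ΛA ⊕ ΛB) → ((⟨base, base⟩ : GrayObj A B) ⟶ ⟨base, base⟩)
  | [] => 𝟙 _
  | .inl l :: w => Gray.inl (ofCode A [l]) base ≫ grayDecode A B w
  | .inr l :: w => Gray.inr base (ofCode B [l]) ≫ grayDecode A B w

theorem grayDecode_append (v w : List (ΛA ⊕ ΛB)) :
    grayDecode A B (v ++ w) = grayDecode A B v ≫ grayDecode A B w := by
  induction v with
  | nil => exact (Bicategory.Strict.id_comp _).symm
  | cons l v ih =>
    rcases l with l | l <;>
      exact (congrArg (_ ≫ ·) ih).trans (Bicategory.Strict.assoc _ _ _).symm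

theorem grayDecode_map_inl (w : List ΛA) :
    grayDecode A B (w.map Sum.inl) = Gray.inl (ofCode A w) base := by
  induction w with
  | nil => rw [ofCode_nil, Gray.inl_id]; rfl
  | cons l w ih =>
    rw [← List.singleton_append, ofCode_append, Gray.inl_comp, ← ih]; rfl

theorem grayDecode_map_inr (w : List ΛB) :
    grayDecode A B (w.map Sum.inr) = Gray.inr base (ofCode B w) := by
  induction w with
  | nil => rw [ofCode_nil, Gray.inr_id]; rfl
  | cons l w ih =>
    rw [← List.singleton_append, ofCode_append, Gray.inr_comp, ← ih]; rfl

/-- Checked on generators, both sides being compatible with composition. This is what makes codes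
faithful: a word modulo the relations is recovered from its letters. -/
theorem grayDecode_code {x y : GrayObj A B} (u : x ⟶ y) : HEq (grayDecode A B (grayCode u)) u := by
  have hobj : ∀ x : gray A B, (⟨base, base⟩ : GrayObj A B) = x := by
    rintro ⟨a, b⟩; rw [← eq_base a, ← eq_base b]
  refine Gray.induction (P := fun u => HEq (grayDecode A B (grayCode u)) u) ?_ ?_ ?_ ?_ u
  · intro x
    rw [grayCode_id]
    exact id_heq (X := gray A B) (hobj x)
  · intro x y z u v hu hv
    rw [grayCode_comp, grayDecode_append]
    exact comp_heq (X := gray A B) (hobj x) (hobj y) (hobj z) hu hv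
  · intro a a' f b
    obtain rfl := eq_base a
    obtain rfl := eq_base a'
    obtain rfl := eq_base b
    rw [grayCode_inl, grayDecode_map_inl, ofCode_code]
  · intro a b b' f
    obtain rfl := eq_base a
    obtain rfl := eq_base b
    obtain rfl := eq_base b'
    rw [grayCode_inr, grayDecode_map_inr, ofCode_code]

theorem grayCode_decode (w : List (ΛA ⊕ ΛB)) : grayCode (grayDecode A B w) = w := by
  induction w with
  | nil => exact grayCode_id _
  | cons l w ih =>
    rcases l with l | l
    · refine (grayCode_comp _ _).trans ?_
      rw [ih, grayCode_inl, code_ofCode]; rfl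
    · refine (grayCode_comp _ _).trans ?_
      rw [ih, grayCode_inr, code_ofCode]; rfl

/-- The relations of the Gray tensor product only compose inside one factor, so its 1-cells form the
coproduct of the two free monoids. -/
instance : Coded (gray A B) (ΛA ⊕ ΛB) where
  base := (⟨base, base⟩ : GrayObj A B)
  eq_base := by rintro ⟨a, b⟩; rw [eq_base a, eq_base b]
  code u := grayCode u
  code_id := grayCode_id
  code_comp := grayCode_comp
  code_injective {x y u v} h := by
    have hu := grayDecode_code (A := A) (B := B) u
    rw [h] at hu
    exact eq_of_heq (hu.symm.trans (grayDecode_code (A := A) (B := B) v))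
  code_surjective := by
    rintro ⟨a, b⟩ ⟨a', b'⟩ w
    rw [eq_base a, eq_base b, eq_base a', eq_base b']
    exact ⟨grayDecode A B w, grayCode_decode w⟩

instance : Coded (A ⊗ B) (ΛA ⊕ ΛB) := inferInstanceAs (Coded (gray A B) (ΛA ⊕ ΛB))

theorem code_inl {a a' : A} (f : a ⟶ a') (b : B) :
    code (A := gray A B) (Gray.inl f b) = (code f).map Sum.inl := grayCode_inl f b

theorem code_inr (a : A) {b b' : B} (g : b ⟶ b') :
    code (A := gray A B) (Gray.inr a g) = (code g).map Sum.inr := grayCode_inr a g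

theorem code_gray_comp {x y z : GrayObj A B} (u : x ⟶ y) (v : y ⟶ z) :
    code (A := gray A B) (u ≫ v) = code (A := gray A B) u ++ code (A := gray A B) v :=
  grayCode_comp u v

theorem code_gray_id (x : GrayObj A B) : code (A := gray A B) (𝟙 x) = [] := grayCode_id x

/-- The image of a letter under a 2-functor. -/
noncomputable def letterMap (F : A ⟶ B) (l : ΛA) : List ΛB := code (map F (ofCode A [l]))

theorem letterMap_eq (F : A ⟶ B) {a b : A} (f : a ⟶ b) {l : ΛA} (h : code f = [l]) :
    letterMap F l = code (map F f) := by
  obtain rfl := eq_base a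
  obtain rfl := eq_base b
  rw [letterMap, ← h, ofCode_code]

/-- On 1-cells a 2-functor is a morphism out of a free monoid, hence a substitution. -/
theorem code_map_ofCode (F : A ⟶ B) (w : List ΛA) :
    code (map F (ofCode A w)) = w.flatMap (letterMap F) := by
  induction w with
  | nil => rw [ofCode_nil, TwoCat.map_id, code_id]; rfl
  | cons l w ih =>
    rw [← List.singleton_append, ofCode_append, TwoCat.map_comp, code_comp, ih]
    simp [letterMap]

theorem code_map (F : A ⟶ B) {a b : A} (f : a ⟶ b) :
    code (map F f) = (code f).flatMap (letterMap F) := by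
  obtain rfl := eq_base a
  obtain rfl := eq_base b
  rw [← code_map_ofCode, ofCode_code]

theorem map_heq_of_letterMap {F G : A ⟶ B} (h : ∀ l, letterMap F l = letterMap G l) {a b : A}
    (f : a ⟶ b) : HEq (map F f) (map G f) :=
  Coded.heq_of_code (by rw [code_map, code_map, funext h])

theorem letterMap_comp (F : A ⟶ B) (G : B ⟶ C) (l : ΛA) :
    letterMap (F ≫ G) l = (letterMap F l).flatMap (letterMap G) :=
  code_map G (map F (ofCode A [l]))

theorem letterMap_id (l : ΛA) : letterMap (𝟙 A) l = [l] := code_ofCode (A := A) [l]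

theorem letterMap_of_heq (F : A ⟶ B) {a b : A} (f : a ⟶ b) {a' b' : B} {g : a' ⟶ b'} {l : ΛA}
    (h : code f = [l]) (h' : HEq (map F f) g) : letterMap F l = code g :=
  (letterMap_eq F f h).trans (Coded.code_eq_of_heq h')

theorem code_inl_ofCode (w : List ΛA) (b : B) :
    code (A := gray A B) (Gray.inl (ofCode A w) b) = w.map Sum.inl := by
  rw [code_inl, code_ofCode]

theorem code_inr_ofCode (a : A) (w : List ΛB) :
    code (A := gray A B) (Gray.inr a (ofCode B w)) = w.map Sum.inr := by
  rw [code_inr, code_ofCode]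

theorem letterMap_grayMap_inl (F : A ⟶ C) (G : B ⟶ D) (l : ΛA) :
    letterMap (grayMap F G) (Sum.inl l) = (letterMap F l).map Sum.inl :=
  (letterMap_of_heq (grayMap F G) (Gray.inl (ofCode A [l]) (base : B)) (code_inl_ofCode _ _)
    (heq_of_eq (grayMap_inl F G _ _))).trans (code_inl _ _)

theorem letterMap_grayMap_inr (F : A ⟶ C) (G : B ⟶ D) (l : ΛB) :
    letterMap (grayMap F G) (Sum.inr l) = (letterMap G l).map Sum.inr :=
  (letterMap_of_heq (grayMap F G) (Gray.inr (base : A) (ofCode B [l])) (code_inr_ofCode _ _)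
    (heq_of_eq (grayMap_inr F G _ _))).trans (code_inr _ _)

theorem letterMap_π₁_inl (l : ΛA) : letterMap (π₁ A B) (Sum.inl l) = [l] :=
  (letterMap_of_heq (π₁ A B) (Gray.inl (ofCode A [l]) (base : B)) (code_inl_ofCode _ _)
    HEq.rfl).trans (code_ofCode _)

theorem code_inl' {a a' : A} {f : a ⟶ a'} {w : List ΛA} (h : code f = w) (b : B) :
    code (A := gray A B) (Gray.inl f b) = w.map Sum.inl := by
  rw [code_inl, h]

theorem code_inr' (a : A) {b b' : B} {g : b ⟶ b'} {w : List ΛB} (h : code g = w) :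
    code (A := gray A B) (Gray.inr a g) = w.map Sum.inr := by
  rw [code_inr, h]

theorem letterMap_assocHom_inl_inl (l : ΛA) :
    letterMap (assocHom A B C) (Sum.inl (Sum.inl l)) = [Sum.inl l] :=
  (letterMap_of_heq (assocHom A B C) (Gray.inl (Gray.inl (ofCode A [l]) (base : B)) (base : C))
    (code_inl' (code_inl_ofCode _ _) _) (heq_of_eq (assocHom_inl_inl A B C _ _ _))).trans
    (code_inl_ofCode _ _)

theorem letterMap_assocHom_inl_inr (l : ΛB) :
    letterMap (assocHom A B C) (Sum.inl (Sum.inr l)) = [Sum.inr (Sum.inl l)] :=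
  (letterMap_of_heq (assocHom A B C) (Gray.inl (Gray.inr (base : A) (ofCode B [l])) (base : C))
    (code_inl' (code_inr_ofCode _ _) _) (heq_of_eq (assocHom_inl_inr A B C _ _ _))).trans
    (code_inr' _ (code_inl_ofCode _ _))

theorem letterMap_assocHom_inr (l : ΛC) :
    letterMap (assocHom A B C) (Sum.inr l) = [Sum.inr (Sum.inr l)] :=
  (letterMap_of_heq (assocHom A B C) (Gray.inr (⟨base, base⟩ : GrayObj A B) (ofCode C [l]))
    (code_inr_ofCode _ _) (heq_of_eq (assocHom_inr A B C _ _ _))).trans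
    (code_inr' _ (code_inr_ofCode _ _))

theorem letterMap_assocInv_inl (l : ΛA) :
    letterMap (assocInv A B C) (Sum.inl l) = [Sum.inl (Sum.inl l)] :=
  (letterMap_of_heq (assocInv A B C) (Gray.inl (ofCode A [l]) (⟨base, base⟩ : GrayObj B C))
    (code_inl_ofCode _ _) (heq_of_eq (assocInv_inl A B C _ _ _))).trans
    (code_inl' (code_inl_ofCode _ _) _)

theorem letterMap_assocInv_inr_inl (l : ΛB) :
    letterMap (assocInv A B C) (Sum.inr (Sum.inl l)) = [Sum.inl (Sum.inr l)] :=
  (letterMap_of_heq (assocInv A B C) (Gray.inr (base : A) (Gray.inl (ofCode B [l]) (base : C)))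
    (code_inr' _ (code_inl_ofCode _ _)) (heq_of_eq (assocInv_inr_inl A B C _ _ _))).trans
    (code_inl' (code_inr_ofCode _ _) _)

theorem letterMap_assocInv_inr_inr (l : ΛC) :
    letterMap (assocInv A B C) (Sum.inr (Sum.inr l)) = [Sum.inr l] :=
  (letterMap_of_heq (assocInv A B C) (Gray.inr (base : A) (Gray.inr (base : B) (ofCode C [l])))
    (code_inr' _ (code_inr_ofCode _ _)) (heq_of_eq (assocInv_inr_inr A B C _ _ _))).trans
    (code_inr_ofCode _ _)

theorem letterMap_partialMap {L L' : Type} (h : L → Option L') (l : L) :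
    letterMap (partialMap h) l = (h l).toList := by
  rw [letterMap_eq (partialMap h) (freeWord [l]) rfl]
  change List.filterMap h [l] = _
  cases e : h l <;> simp [e]

theorem letterMap_toGray {L : Type} {F : free L ⟶ A} {G : free L ⟶ B}
    (h : L → ((⟨obj F FreeObj.mk, obj G FreeObj.mk⟩ : GrayObj A B) ⟶
      ⟨obj F FreeObj.mk, obj G FreeObj.mk⟩))
    (h_fst : ∀ l, GrayHom.fst (h l) = map F (freeWord [l]))
    (h_snd : ∀ l, GrayHom.snd (h l) = map G (freeWord [l])) (l : L) :
    letterMap (toGray F G h h_fst h_snd) l = code (A := gray A B) (h l) := by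
  rw [letterMap_eq (toGray F G h h_fst h_snd) (freeWord [l]) rfl]
  -- The value on the one-letter word is `h l ≫ 𝟙 _`, because `wordHom` ends with an identity. Only
  -- the underlying words are compared, since `pair` records the projections in another form.
  refine Eq.trans ?_ ((code_gray_comp (h l) (𝟙 _)).trans ?_)
  · exact Coded.code_eq_of_heq (A := gray A B) (heq_of_eq (Gray.hom_ext rfl))
  · rw [code_gray_id, List.append_nil]

/-- The projections determine the 2-cells, which are pairs. What they miss is how the two
projections of a 1-cell are interleaved, and this can be read off the letters. -/
theorem ext_letterMap {F G : X ⟶ gray A B} (h : ∀ l, letterMap F l = letterMap G l)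
    (h₁ : F ≫ π₁ A B = G ≫ π₁ A B) (h₂ : F ≫ π₂ A B = G ≫ π₂ A B) : F = G :=
  ext_gray h₁ h₂ (map_heq_of_letterMap h)

end

theorem toGray_π₁ {L : Type} {A B : TwoCat} {F : free L ⟶ A} {G : free L ⟶ B}
    (h : L → ((⟨obj F FreeObj.mk, obj G FreeObj.mk⟩ : GrayObj A B) ⟶
      ⟨obj F FreeObj.mk, obj G FreeObj.mk⟩))
    (h_fst : ∀ l, GrayHom.fst (h l) = map F (freeWord [l]))
    (h_snd : ∀ l, GrayHom.snd (h l) = map G (freeWord [l])) :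
    toGray F G h h_fst h_snd ≫ π₁ A B = F :=
  hom_ext (fun _ => rfl) (fun _ => HEq.rfl) (fun _ => HEq.rfl)

theorem toGray_π₂ {L : Type} {A B : TwoCat} {F : free L ⟶ A} {G : free L ⟶ B}
    (h : L → ((⟨obj F FreeObj.mk, obj G FreeObj.mk⟩ : GrayObj A B) ⟶
      ⟨obj F FreeObj.mk, obj G FreeObj.mk⟩))
    (h_fst : ∀ l, GrayHom.fst (h l) = map F (freeWord [l]))
    (h_snd : ∀ l, GrayHom.snd (h l) = map G (freeWord [l])) :
    toGray F G h h_fst h_snd ≫ π₂ A B = G :=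
  hom_ext (fun _ => rfl) (fun _ => HEq.rfl) (fun _ => HEq.rfl)

open Coded Bicategory

/-! ### Factorization of a 2-functor, cell by cell -/

section Lift

/-- This congruence and the next ones handle 2-cells whose boundaries are equal only
propositionally, as happens when a lifted cell is compared with the original one. -/
theorem comp₂_heq {X : TwoCat} {x y x' y' : X} {f g h : x ⟶ y} {f' g' h' : x' ⟶ y'}
    {η : f ⟶ g} {θ : g ⟶ h} {η' : f' ⟶ g'} {θ' : g' ⟶ h'} (hx : x = x') (hy : y = y')
    (hf : HEq f f') (hg : HEq g g') (hh : HEq h h') (hη : HEq η η') (hθ : HEq θ θ') :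
    HEq (η ≫ θ) (η' ≫ θ') := by
  subst hx; subst hy; cases hf; cases hg; cases hh; cases hη; cases hθ; rfl

theorem id₂_heq {X : TwoCat} {x y x' y' : X} {f : x ⟶ y} {f' : x' ⟶ y'}
    (hx : x = x') (hy : y = y') (hf : HEq f f') : HEq (𝟙 f) (𝟙 f') := by
  subst hx; subst hy; cases hf; rfl

theorem whiskerLeft_heq {X : TwoCat} {x y z x' y' z' : X} {f : x ⟶ y} {g h : y ⟶ z}
    {f' : x' ⟶ y'} {g' h' : y' ⟶ z'} {η : g ⟶ h} {η' : g' ⟶ h'} (hx : x = x') (hy : y = y')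
    (hz : z = z') (hf : HEq f f') (hg : HEq g g') (hh : HEq h h') (hη : HEq η η') :
    HEq (f ◁ η) (f' ◁ η') := by
  subst hx; subst hy; subst hz; cases hf; cases hg; cases hh; cases hη; rfl

theorem whiskerRight_heq {X : TwoCat} {x y z x' y' z' : X} {f g : x ⟶ y} {h : y ⟶ z}
    {f' g' : x' ⟶ y'} {h' : y' ⟶ z'} {η : f ⟶ g} {η' : f' ⟶ g'} (hx : x = x') (hy : y = y')
    (hz : z = z') (hf : HEq f f') (hg : HEq g g') (hh : HEq h h') (hη : HEq η η') :
    HEq (η ▷ h) (η' ▷ h') := by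
  subst hx; subst hy; subst hz; cases hf; cases hg; cases hh; cases hη; rfl

/-- Heterogeneous equality absorbs the `eqToHom` corrections of strict preservation. -/
theorem map₂_whiskerLeft_heq {A B : TwoCat} (F : A ⟶ B) {a b c : A} (f : a ⟶ b) {g h : b ⟶ c}
    (η : g ⟶ h) : HEq (map₂ F (f ◁ η)) (map F f ◁ map₂ F η) := by
  rw [map₂_whiskerLeft]
  exact (eqToHom_comp_heq _ _).trans (comp_eqToHom_heq _ _)

theorem map₂_whiskerRight_heq {A B : TwoCat} (F : A ⟶ B) {a b c : A} {f g : a ⟶ b} (η : f ⟶ g)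
    (h : b ⟶ c) : HEq (map₂ F (η ▷ h)) (map₂ F η ▷ map F h) := by
  rw [map₂_whiskerRight]
  exact (eqToHom_comp_heq _ _).trans (comp_eqToHom_heq _ _)

variable {E X Y : TwoCat}

/-- A factorization of the cells of a 2-functor `K` through a 2-functor `ι` which is injective on
parallel 1-cells and on parallel 2-cells. -/
structure CellLift (ι : E ⟶ Y) (K : X ⟶ Y) where
  onObj : X → E
  onMap : ∀ {x y : X}, (x ⟶ y) → (onObj x ⟶ onObj y)
  onMap₂ : ∀ {x y : X} {f g : x ⟶ y}, (f ⟶ g) → (onMap f ⟶ onMap g)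
  obj_eq : ∀ x, obj ι (onObj x) = obj K x
  map_heq : ∀ {x y : X} (f : x ⟶ y), HEq (map ι (onMap f)) (map K f)
  map₂_heq : ∀ {x y : X} {f g : x ⟶ y} (η : f ⟶ g), HEq (map₂ ι (onMap₂ η)) (map₂ K η)
  map_inj : ∀ {x y : E} {f g : x ⟶ y}, map ι f = map ι g → f = g
  map₂_inj : ∀ {x y : E} {f g : x ⟶ y} {η θ : f ⟶ g}, map₂ ι η = map₂ ι θ → η = θ

namespace CellLift

variable {ι : E ⟶ Y} {K : X ⟶ Y} (D : CellLift ι K)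

/-- After `ι` the equation becomes functoriality of `K`, and `ι` is injective on parallel 1-cells.
All laws of the factorization are obtained in this way. -/
theorem onMap_id (x : X) : D.onMap (𝟙 x) = 𝟙 _ :=
  D.map_inj (eq_of_heq ((D.map_heq _).trans ((heq_of_eq (TwoCat.map_id K x)).trans
    ((id_heq (D.obj_eq x).symm).trans (heq_of_eq (TwoCat.map_id ι _).symm)))))

theorem onMap_comp {x y z : X} (f : x ⟶ y) (g : y ⟶ z) :
    D.onMap (f ≫ g) = D.onMap f ≫ D.onMap g :=
  D.map_inj (eq_of_heq ((D.map_heq _).trans ((heq_of_eq (TwoCat.map_comp K f g)).trans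
    ((comp_heq (D.obj_eq x).symm (D.obj_eq y).symm (D.obj_eq z).symm (D.map_heq f).symm
      (D.map_heq g).symm).trans (heq_of_eq (TwoCat.map_comp ι _ _).symm)))))

/-- Needed for whiskering, where the boundaries `onMap (f ≫ g)` and `onMap f ≫ onMap g` are not
definitionally equal. -/
theorem eq_of_map₂_heq (D : CellLift ι K) {x y : E} {f g f' g' : x ⟶ y} (hf : f = f') (hg : g = g')
    {η : f ⟶ g} {θ : f' ⟶ g'} (h : HEq (map₂ ι η) (map₂ ι θ)) : HEq η θ := by
  subst hf; subst hg
  exact heq_of_eq (D.map₂_inj (eq_of_heq h))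

/-- The factorization as a 2-functor. -/
def functor : X ⟶ E := ofCore
  { obj := D.onObj
    map := D.onMap
    map₂ := D.onMap₂
    map₂_id := fun {x y} f => D.map₂_inj (eq_of_heq ((D.map₂_heq _).trans
      ((heq_of_eq (TwoCat.map₂_id K f)).trans
        ((id₂_heq (D.obj_eq x).symm (D.obj_eq y).symm (D.map_heq f).symm).trans
          (heq_of_eq (TwoCat.map₂_id ι _).symm)))))
    map₂_comp := fun {x y f g h} η θ => D.map₂_inj (eq_of_heq ((D.map₂_heq _).trans
      ((heq_of_eq (TwoCat.map₂_comp K η θ)).trans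
        ((comp₂_heq (D.obj_eq x).symm (D.obj_eq y).symm (D.map_heq f).symm (D.map_heq g).symm
          (D.map_heq h).symm (D.map₂_heq η).symm (D.map₂_heq θ).symm).trans
          (heq_of_eq (TwoCat.map₂_comp ι _ _).symm)))))
    map_id := D.onMap_id
    map_comp := D.onMap_comp
    map₂_whisker_left := fun {x y z} f {g h} η => eq_of_heq
      ((D.eq_of_map₂_heq (D.onMap_comp f g) (D.onMap_comp f h)
        ((D.map₂_heq _).trans ((map₂_whiskerLeft_heq K f η).trans
          ((whiskerLeft_heq (D.obj_eq x).symm (D.obj_eq y).symm (D.obj_eq z).symm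
            (D.map_heq f).symm (D.map_heq g).symm (D.map_heq h).symm (D.map₂_heq η).symm).trans
            (map₂_whiskerLeft_heq ι _ _).symm)))).trans
        ((eqToHom_comp_heq _ _).trans (comp_eqToHom_heq _ _)).symm)
    map₂_whisker_right := fun {x y z f g} η h => eq_of_heq
      ((D.eq_of_map₂_heq (D.onMap_comp f h) (D.onMap_comp g h)
        ((D.map₂_heq _).trans ((map₂_whiskerRight_heq K η h).trans
          ((whiskerRight_heq (D.obj_eq x).symm (D.obj_eq y).symm (D.obj_eq z).symm
            (D.map_heq f).symm (D.map_heq g).symm (D.map_heq h).symm (D.map₂_heq η).symm).trans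
            (map₂_whiskerRight_heq ι _ _).symm)))).trans
        ((eqToHom_comp_heq _ _).trans (comp_eqToHom_heq _ _)).symm) }

theorem functor_comp : D.functor ≫ ι = K :=
  hom_ext D.obj_eq D.map_heq D.map₂_heq

end CellLift

end Lift

/-! ### A criterion for equalizers on words and 2-cells, and its stability under tensoring -/

section Equalizer

theorem map_congr {A B : TwoCat} {F G : A ⟶ B} (h : F = G) {a b : A} (f : a ⟶ b) :
    HEq (map F f) (map G f) := by rw [h]

theorem map₂_congr {A B : TwoCat} {F G : A ⟶ B} (h : F = G) {a b : A} {f g : a ⟶ b} (η : f ⟶ g) :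
    HEq (map₂ F η) (map₂ G η) := by rw [h]

variable {E Y Z A : TwoCat} {ΛE ΛY ΛZ ΛA : Type} [Coded E ΛE] [Coded Y ΛY] [Coded Z ΛZ] [Coded A ΛA]

/-- Conditions on letters and on 2-cells under which `ι` is an equalizer of `P` and `Q`. -/
structure IsWordEqualizer (ι : E ⟶ Y) (P Q : Y ⟶ Z) : Prop where
  condition : ι ≫ P = ι ≫ Q
  retraction : ∃ ψ : ΛY → List ΛE, ∀ e, (letterMap ι e).flatMap ψ = [e]
  word : ∀ w : List ΛY, w.flatMap (letterMap P) = w.flatMap (letterMap Q) →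
    ∃ v : List ΛE, v.flatMap (letterMap ι) = w
  map₂_inj : ∀ {x y : E} {f g : x ⟶ y} {η θ : f ⟶ g}, map₂ ι η = map₂ ι θ → η = θ
  map₂_surj : ∀ {x y : E} {f g : x ⟶ y} (θ : map ι f ⟶ map ι g), HEq (map₂ P θ) (map₂ Q θ) →
    ∃ η : f ⟶ g, map₂ ι η = θ

/-- A substitution that undoes `φ` on letters undoes it on all words. No compatibility of `ψ` with
2-cells is involved. -/
theorem flatMap_injective_of_retraction {α β : Type} {φ : α → List β} {ψ : β → List α}
    (h : ∀ e, (φ e).flatMap ψ = [e]) {v w : List α} (e : v.flatMap φ = w.flatMap φ) : v = w := by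
  have key : ∀ v : List α, (v.flatMap φ).flatMap ψ = v := by
    intro v; rw [List.flatMap_assoc]; simp [h]
  rw [← key v, e, key]

theorem exists_map₂_of_heq {X : TwoCat} {ι : E ⟶ Y} {K : X ⟶ Y} {e e' : E} {x y : X}
    (hx : obj ι e = obj K x) (hy : obj ι e' = obj K y)
    {f g : x ⟶ y} {f' g' : e ⟶ e'} (hf : HEq (map ι f') (map K f)) (hg : HEq (map ι g') (map K g))
    (η : f ⟶ g) : ∃ θ : map ι f' ⟶ map ι g', HEq θ (map₂ K η) := by
  -- The boundary of the 2-cell is generalized so that the equalities of 0-cells can be rewritten;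
  -- the heterogeneous equalities then become equalities.
  revert hf hg
  generalize map₂ K η = κ
  revert κ
  generalize map K f = a
  generalize map K g = b
  revert a b
  rw [← hx, ← hy]
  rintro a b κ hf hg
  obtain rfl := eq_of_heq hf
  obtain rfl := eq_of_heq hg
  exact ⟨κ, HEq.rfl⟩

theorem map₂_heq_of_heq {P : Y ⟶ Z} {x y x' y' : Y} (hx : x = x') (hy : y = y')
    {f g : x ⟶ y} {f' g' : x' ⟶ y'} (hf : HEq f f') (hg : HEq g g') {η : f ⟶ g} {θ : f' ⟶ g'}
    (h : HEq η θ) : HEq (map₂ P η) (map₂ P θ) := by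
  subst hx; subst hy; cases hf; cases hg; cases h; rfl

namespace IsWordEqualizer

variable {ι : E ⟶ Y} {P Q : Y ⟶ Z}

theorem map_inj (h : IsWordEqualizer ι P Q) {x y : E} {f g : x ⟶ y} (e : map ι f = map ι g) : f = g := by
  obtain ⟨ψ, hψ⟩ := h.retraction
  apply code_injective
  apply flatMap_injective_of_retraction hψ
  rw [← code_map, ← code_map, e]

/-- The word of each `map K f` is equalized, so it lifts; the 2-cells then lift between the chosen
1-cells. Independent choices still form a 2-functor, because `ι` is injective on parallel cells
(`CellLift`). -/
theorem exists_lift (h : IsWordEqualizer ι P Q) {X : TwoCat} (K : X ⟶ Y) (hK : K ≫ P = K ≫ Q) :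
    ∃ H : X ⟶ E, H ≫ ι = K := by
  have h₁ : ∀ {x y : X} (f : x ⟶ y), ∃ g : (base : E) ⟶ base, HEq (map ι g) (map K f) := by
    intro x y f
    have e : code (map P (map K f)) = code (map Q (map K f)) :=
      code_eq_of_heq (map_congr hK f)
    rw [code_map P, code_map Q] at e
    obtain ⟨v, hv⟩ := h.word _ e
    refine ⟨ofCode E v, heq_of_code ?_⟩
    rw [code_map_ofCode, hv]
  choose onMap hmap using @h₁
  have h₂ : ∀ {x y : X} {f g : x ⟶ y} (η : f ⟶ g), ∃ θ : onMap f ⟶ onMap g,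
      HEq (map₂ ι θ) (map₂ K η) := by
    intro x y f g η
    obtain ⟨θ, hθ⟩ := exists_map₂_of_heq (ι := ι) (K := K) (Coded.obj_eq _ _) (Coded.obj_eq _ _)
      (hmap f) (hmap g) η
    -- The images of `θ` under `P` and `Q` are those of `map₂ K η`, which agree by `hK`.
    obtain ⟨κ, hκ⟩ := h.map₂_surj θ (((map₂_heq_of_heq (Coded.obj_eq _ _) (Coded.obj_eq _ _)
      (hmap f) (hmap g) hθ).trans (map₂_congr hK η)).trans
      (map₂_heq_of_heq (Coded.obj_eq _ _) (Coded.obj_eq _ _) (hmap f) (hmap g) hθ).symm)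
    exact ⟨κ, by rw [hκ]; exact hθ⟩
  choose onMap₂ hmap₂ using @h₂
  let D : CellLift ι K :=
    { onObj := fun _ => base
      onMap := fun f => onMap f
      onMap₂ := fun η => onMap₂ η
      obj_eq := fun _ => Coded.obj_eq _ _
      map_heq := fun f => hmap f
      map₂_heq := fun η => hmap₂ η
      map_inj := h.map_inj
      map₂_inj := h.map₂_inj }
  exact ⟨D.functor, D.functor_comp⟩

/-- Uniqueness of the factorization: the retraction on letters separates 1-cells, and `map₂_inj`
separates 2-cells. -/
theorem hom_ext (h : IsWordEqualizer ι P Q) {X : TwoCat} {H H' : X ⟶ E} (e : H ≫ ι = H' ≫ ι) : H = H' := by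
  obtain ⟨ψ, hψ⟩ := h.retraction
  have h₁ : ∀ {x y : X} (f : x ⟶ y), HEq (map H f) (map H' f) := by
    intro x y f
    apply heq_of_code
    apply flatMap_injective_of_retraction hψ
    rw [← code_map, ← code_map]
    exact code_eq_of_heq (map_congr e f)
  refine TwoCat.hom_ext (fun _ => Coded.obj_eq _ _) h₁ ?_
  intro x y f g η
  have key : ∀ {a b a' b' : E} (_ : a = a') (_ : b = b') {u v : a ⟶ b} {u' v' : a' ⟶ b'}
      (_ : HEq u u') (_ : HEq v v') (θ : u ⟶ v) (θ' : u' ⟶ v'),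
      HEq (map₂ ι θ) (map₂ ι θ') → HEq θ θ' := by
    intro a b a' b' ha hb u v u' v' hu hv θ θ' hθ
    subst ha; subst hb; cases hu; cases hv
    exact heq_of_eq (h.map₂_inj (eq_of_heq hθ))
  exact key (Coded.obj_eq _ _) (Coded.obj_eq _ _) (h₁ f) (h₁ g) _ _ (map₂_congr e η)

/-- The conditions imply that `ι` is an equalizer of `P` and `Q`. -/
noncomputable def isLimit (h : IsWordEqualizer ι P Q) : Limits.IsLimit (Limits.Fork.ofι ι h.condition) :=
  Limits.Fork.IsLimit.ofExistsUnique fun s => by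
    obtain ⟨H, hH⟩ := h.exists_lift s.ι s.condition
    exact ⟨H, hH, fun H' hH' => h.hom_ext (hH'.trans hH.symm)⟩

end IsWordEqualizer

/-- The first letter of the form `inl` marks the end of the initial block of letters `inr`, so both
sides are cut at the same place. -/
theorem append_cons_inl_inj {α β : Type} {v v' : List β} {a a' : α} {w w' : List (α ⊕ β)}
    (h : v.map Sum.inr ++ Sum.inl a :: w = v'.map Sum.inr ++ Sum.inl a' :: w') :
    v = v' ∧ w = w' := by
  induction v generalizing v' with
  | nil => cases v' <;> simp_all
  | cons b v ih =>
    cases v' with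
    | nil => simp at h
    | cons b' v' =>
      simp only [List.map_cons, List.cons_append, List.cons.injEq, Sum.inr.injEq] at h
      obtain ⟨e, e'⟩ := ih h.2
      exact ⟨by rw [h.1, e], e'⟩

/-- The extension of a map on letters by foreign letters on the left. -/
def extL {β γ : Type} (α : Type) (p : β → List γ) : α ⊕ β → List (α ⊕ γ) :=
  Sum.elim (fun a => [.inl a]) (fun b => (p b).map .inr)

/-- The extension of a map on letters by foreign letters on the right. -/
def extR {β γ : Type} (α : Type) (p : β → List γ) : β ⊕ α → List (γ ⊕ α) :=
  Sum.elim (fun b => (p b).map .inl) (fun a => [.inr a])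

theorem flatMap_extL {α β γ : Type} (p : β → List γ) (v : List β) :
    (v.map Sum.inr).flatMap (extL α p) = (v.flatMap p).map Sum.inr := by
  induction v with
  | nil => rfl
  | cons b v ih => simp_all [extL]

/-- Letters of `α` are fixed by both substitutions, so the equation splits into one equation for
each maximal block of letters of `β`, and the blocks lift separately. -/
theorem extL_word {α δ β γ : Type} {φ : δ → List β} {p q : β → List γ}
    (h : ∀ w : List β, w.flatMap p = w.flatMap q → ∃ v : List δ, v.flatMap φ = w)
    (w : List (α ⊕ β)) (e : w.flatMap (extL α p) = w.flatMap (extL α q)) :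
    ∃ v : List _, v.flatMap (extL α φ) = w := by
  -- The accumulator `w₀` is the current block of letters of `β`, already read but not yet closed by
  -- a letter of `α`.
  suffices key : ∀ (w : List (α ⊕ β)) (w₀ : List β),
      (w₀.map Sum.inr ++ w).flatMap (extL α p) = (w₀.map Sum.inr ++ w).flatMap (extL α q) →
      ∃ v : List _, v.flatMap (extL α φ) = w₀.map Sum.inr ++ w from key w [] e
  intro w
  induction w with
  | nil =>
    intro w₀ e
    rw [List.append_nil, flatMap_extL, flatMap_extL] at e
    obtain ⟨v, hv⟩ := h w₀ ((List.map_injective_iff.mpr Sum.inr_injective) e)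
    exact ⟨v.map Sum.inr, by rw [flatMap_extL, hv, List.append_nil]⟩
  | cons l w ih =>
    intro w₀ e
    rcases l with a | b
    · rw [List.flatMap_append, List.flatMap_append, flatMap_extL, flatMap_extL,
        List.flatMap_cons, List.flatMap_cons] at e
      obtain ⟨e₀, e₁⟩ := append_cons_inl_inj e
      obtain ⟨v₀, hv₀⟩ := h w₀ e₀
      obtain ⟨v, hv⟩ := ih [] e₁
      refine ⟨v₀.map Sum.inr ++ Sum.inl a :: v, ?_⟩
      rw [List.flatMap_append, flatMap_extL, hv₀, List.flatMap_cons, hv]; rfl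
    · have := ih (w₀ ++ [b]) (by simpa using e)
      simpa using this

theorem flatMap_map_swap {α β γ : Type} (p : β → List γ) (w : List (β ⊕ α)) :
    (w.map Sum.swap).flatMap (extL α p) = (w.flatMap (extR α p)).map Sum.swap := by
  induction w with
  | nil => rfl
  | cons l w ih =>
    rw [List.map_cons, List.flatMap_cons, List.flatMap_cons, List.map_append, ih]
    congr 1
    rcases l with b | a <;> simp [extL, extR]

/-- Mirror image of `extL_word`, obtained by exchanging the two summands. -/
theorem extR_word {α δ β γ : Type} {φ : δ → List β} {p q : β → List γ}
    (h : ∀ w : List β, w.flatMap p = w.flatMap q → ∃ v : List δ, v.flatMap φ = w)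
    (w : List (β ⊕ α)) (e : w.flatMap (extR α p) = w.flatMap (extR α q)) :
    ∃ v : List _, v.flatMap (extR α φ) = w := by
  have swap_inj : ∀ {α β : Type} {l l' : List (α ⊕ β)}, l.map Sum.swap = l'.map Sum.swap → l = l' :=
    fun e => List.map_injective_iff.mpr (Function.LeftInverse.injective Sum.swap_swap) e
  obtain ⟨v, hv⟩ := extL_word h (w.map Sum.swap) (by rw [flatMap_map_swap, flatMap_map_swap, e])
  refine ⟨v.map Sum.swap, swap_inj ?_⟩
  rw [← flatMap_map_swap, ← hv]; simp

theorem letterMap_grayMap_id_left (A : TwoCat) {ΛA : Type} [Coded A ΛA] (F : Y ⟶ Z) :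
    letterMap (grayMap (𝟙 A) F) = extL ΛA (letterMap F) := by
  funext l
  rcases l with l | l
  · rw [letterMap_grayMap_inl, letterMap_id]; rfl
  · rw [letterMap_grayMap_inr]; rfl

theorem letterMap_grayMap_id_right (A : TwoCat) {ΛA : Type} [Coded A ΛA] (F : Y ⟶ Z) :
    letterMap (grayMap F (𝟙 A)) = extR ΛA (letterMap F) := by
  funext l
  rcases l with l | l
  · rw [letterMap_grayMap_inl]; rfl
  · rw [letterMap_grayMap_inr, letterMap_id]; rfl

theorem grayHom₂_fst_heq {A B : TwoCat} {x y x' y' : GrayObj A B} (hx : x = x') (hy : y = y')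
    {u v : GrayHom x y} {u' v' : GrayHom x' y'} (hu : HEq u u') (hv : HEq v v')
    {η : GrayHom₂ u v} {θ : GrayHom₂ u' v'} (h : HEq η θ) : HEq η.fst θ.fst := by
  subst hx; subst hy; cases hu; cases hv; cases h; rfl

theorem grayHom₂_snd_heq {A B : TwoCat} {x y x' y' : GrayObj A B} (hx : x = x') (hy : y = y')
    {u v : GrayHom x y} {u' v' : GrayHom x' y'} (hu : HEq u u') (hv : HEq v v')
    {η : GrayHom₂ u v} {θ : GrayHom₂ u' v'} (h : HEq η θ) : HEq η.snd θ.snd := by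
  subst hx; subst hy; cases hu; cases hv; cases h; rfl

/-- On 1-cells the letters of `A` are separators (`extL_word`). On 2-cells, which are pairs, the
component in `A` is carried along unchanged. This and `IsWordEqualizer.grayRight` give the tensored
equalizers of `HComposite`. -/
theorem IsWordEqualizer.grayLeft {ι : E ⟶ Y} {P Q : Y ⟶ Z} (h : IsWordEqualizer ι P Q)
    (A : TwoCat) {ΛA : Type} [Coded A ΛA] :
    IsWordEqualizer (grayMap (𝟙 A) ι) (grayMap (𝟙 A) P) (grayMap (𝟙 A) Q) := by
  have hc : grayMap (𝟙 A) ι ≫ grayMap (𝟙 A) P = grayMap (𝟙 A) ι ≫ grayMap (𝟙 A) Q := by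
    rw [grayMap_comp, grayMap_comp, h.condition]
  refine ⟨hc, ?_, ?_, ?_, ?_⟩
  · obtain ⟨ψ, hψ⟩ := h.retraction
    refine ⟨extL ΛA ψ, ?_⟩
    rw [letterMap_grayMap_id_left]
    rintro (a | e)
    · rfl
    · change ((letterMap ι e).map Sum.inr).flatMap _ = _
      rw [flatMap_extL, hψ]; rfl
  · rw [letterMap_grayMap_id_left, letterMap_grayMap_id_left, letterMap_grayMap_id_left]
    exact extL_word h.word
  · intro x y f g η θ e
    exact Gray.hom₂_ext (congrArg GrayHom₂.fst e :) (h.map₂_inj (congrArg GrayHom₂.snd e :))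
  · intro x y f g θ e
    -- Only the second component carries a condition; the first component of `θ` is reused as it
    -- stands.
    have e' := grayHom₂_snd_heq (Coded.obj_eq (A := gray A Z) _ _) (Coded.obj_eq (A := gray A Z) _ _)
      (map_congr hc f) (map_congr hc g) e
    obtain ⟨η, hη⟩ := h.map₂_surj (GrayHom₂.snd θ) e'
    exact ⟨GrayHom₂.mk (GrayHom₂.fst (u := map (grayMap (𝟙 A) ι) f) (v := map (grayMap (𝟙 A) ι) g) θ :) η, Gray.hom₂_ext' rfl hη⟩

theorem IsWordEqualizer.grayRight {ι : E ⟶ Y} {P Q : Y ⟶ Z} (h : IsWordEqualizer ι P Q)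
    (A : TwoCat) {ΛA : Type} [Coded A ΛA] :
    IsWordEqualizer (grayMap ι (𝟙 A)) (grayMap P (𝟙 A)) (grayMap Q (𝟙 A)) := by
  have hc : grayMap ι (𝟙 A) ≫ grayMap P (𝟙 A) = grayMap ι (𝟙 A) ≫ grayMap Q (𝟙 A) := by
    rw [grayMap_comp, grayMap_comp, h.condition]
  refine ⟨hc, ?_, ?_, ?_, ?_⟩
  · obtain ⟨ψ, hψ⟩ := h.retraction
    refine ⟨extR ΛA ψ, ?_⟩
    rw [letterMap_grayMap_id_right]
    rintro (e | a)
    · change ((letterMap ι e).map Sum.inl).flatMap _ = _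
      rw [List.flatMap_map]
      change (letterMap ι e).flatMap (fun a => (ψ a).map Sum.inl) = _
      rw [← List.map_flatMap, hψ]; rfl
    · rfl
  · rw [letterMap_grayMap_id_right, letterMap_grayMap_id_right, letterMap_grayMap_id_right]
    exact extR_word h.word
  · intro x y f g η θ e
    exact Gray.hom₂_ext (h.map₂_inj (congrArg GrayHom₂.fst e :)) (congrArg GrayHom₂.snd e :)
  · intro x y f g θ e
    have e' := grayHom₂_fst_heq (Coded.obj_eq (A := gray Z A) _ _) (Coded.obj_eq (A := gray Z A) _ _)
      (map_congr hc f) (map_congr hc g) e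
    obtain ⟨η, hη⟩ := h.map₂_surj (GrayHom₂.fst θ) e'
    exact ⟨GrayHom₂.mk η (GrayHom₂.snd (u := map (grayMap ι (𝟙 A)) f) (v := map (grayMap ι (𝟙 A)) g) θ :), Gray.hom₂_ext' hη rfl⟩

end Equalizer

end TwoCat

/-! ### Restriction and gluing of label-preserving bijections -/

namespace Words

variable {L L₁ L₂ M : Type}

theorem hom₂_heq {u u' v v' : List L} (hu : u = u') (hv : v = v') {η : FreeHom₂ u v}
    {θ : FreeHom₂ u' v'}
    (h : ∀ (i : Fin u.length) (j : Fin u'.length), i.val = j.val →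
      (η.equiv i).val = (θ.equiv j).val) : HEq η θ := by
  subst hu; subst hv
  exact heq_of_eq (hom₂_ext' fun i => h i i rfl)

theorem val_eq_of_hom₂_heq {u u' v v' : List L} (hu : u = u') (hv : v = v') {η : FreeHom₂ u v}
    {θ : FreeHom₂ u' v'} (h : HEq η θ) (i : Fin u.length) (j : Fin u'.length)
    (hij : i.val = j.val) : (η.equiv i).val = (θ.equiv j).val := by
  subst hu; subst hv; cases h
  rw [Fin.ext hij]

/-- The image of a prefix is a prefix of the image. The rank of a position among those where `h` is
defined is the length of such an image, so this lets ranks be computed in stages. -/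
theorem take_filterMap (h : L → Option L₁) (u : List L) (n : ℕ) :
    (u.filterMap h).take ((u.take n).filterMap h).length = (u.take n).filterMap h := by
  conv_lhs => rw [← List.take_append_drop n u]
  rw [List.take_append_drop]
  conv_lhs => enter [2]; rw [← List.take_append_drop n u, List.filterMap_append]
  simp

theorem get_pos (h : L → Option L₁) (u : List L)
    (i : {i : Fin u.length // (h (u.get i)).isSome}) :
    some ((u.filterMap h).get (pos h u i)) = h (u.get i.1) := get_posFun h u i

/-- A form of `map₂_pos` in which the position is specified by its rank as a natural number, so that
it applies when words are equal only propositionally. -/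
theorem map₂_val (h : L → Option L₁) {u v : List L} (η : FreeHom₂ u v) (i : Fin u.length)
    (hi : (h (u.get i)).isSome) (k : Fin (u.filterMap h).length)
    (hk : k.val = ((u.take i.val).filterMap h).length) :
    ((map₂ h η).equiv k).val = ((v.take (η.equiv i).val).filterMap h).length := by
  obtain rfl : k = pos h u ⟨i, hi⟩ := Fin.ext hk
  rw [map₂_pos, pos_val]; rfl

/-- On both sides the image of a surviving position `i` is the number of surviving letters before
`η.equiv i`: a rank among ranks is the rank for the composite partial function. -/
theorem map₂_map₂_heq (h : L → Option L₁) (k : L₁ → Option L₂) {u v : List L} (η : FreeHom₂ u v) :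
    HEq (map₂ k (map₂ h η)) (map₂ (fun l => (h l).bind k) η) := by
  refine hom₂_heq List.filterMap_filterMap List.filterMap_filterMap ?_
  intro a b hab
  obtain ⟨⟨i, hi⟩, rfl⟩ := (pos (fun l => (h l).bind k) u).surjective b
  have hi₀ : ∃ x, h (u.get i) = some x ∧ (k x).isSome := by
    cases e : h (u.get i) with
    | none => rw [e] at hi; simp at hi
    | some x => rw [e] at hi; exact ⟨x, rfl, hi⟩
  obtain ⟨x, hx, hk⟩ := hi₀
  have hi' : (h (u.get i)).isSome := by rw [hx]; rfl
  have hx' : (u.filterMap h).get (pos h u ⟨i, hi'⟩) = x :=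
    Option.some_injective _ ((get_pos h u ⟨i, hi'⟩).trans hx)
  rw [map₂_val (fun l => (h l).bind k) η i hi _ rfl]
  rw [map₂_val k (map₂ h η) (pos h u ⟨i, hi'⟩) (by rw [hx']; exact hk) a]
  · rw [map₂_val h η i hi' _ rfl, take_filterMap, List.filterMap_filterMap]
  · rw [hab, pos_val, pos_val, take_filterMap, List.filterMap_filterMap]

/-- Two partial functions on letters which are jointly everywhere defined, and which overlap on the
letters on which their composites with `m₁` and `m₂` are defined. -/
structure IsGluing (f : L → Option L₁) (g : L → Option L₂) (m₁ : L₁ → Option M)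
    (m₂ : L₂ → Option M) : Prop where
  cover : ∀ l, (f l).isSome ∨ (g l).isSome
  mid : ∀ l, (f l).bind m₁ = (g l).bind m₂
  both : ∀ {l x}, f l = some x → (g l).isSome → (m₁ x).isSome
  inj₁ : ∀ {l l' x}, f l = some x → f l' = some x → l = l'
  inj₂ : ∀ {l l' x}, g l = some x → g l' = some x → l = l'

namespace IsGluing

variable {f : L → Option L₁} {g : L → Option L₂} {m₁ : L₁ → Option M} {m₂ : L₂ → Option M}

/-- Every position is seen by `f` or by `g`, and a restriction remembers where the positions it sees
are sent. -/
theorem hom₂_ext (h : IsGluing f g m₁ m₂) {u v : List L} {κ κ' : FreeHom₂ u v}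
    (h₁ : map₂ f κ = map₂ f κ') (h₂ : map₂ g κ = map₂ g κ') : κ = κ' := by
  have key : ∀ {N : Type} (k : L → Option N) (_ : map₂ k κ = map₂ k κ') (i : Fin u.length)
      (_ : (k (u.get i)).isSome), κ.equiv i = κ'.equiv i := by
    intro N k e i hi
    have := congrArg (fun η => η.equiv (pos k u ⟨i, hi⟩)) e
    simp only [map₂_pos] at this
    exact congrArg Subtype.val ((pos k v).injective this)
  apply hom₂_ext'
  intro i
  rcases h.cover (u.get i) with hi | hi
  · rw [key f h₁ i hi]
  · rw [key g h₂ i hi]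

/-- Inclusion–exclusion: by `mid` and `both`, the letters seen by both `f` and `g` are exactly those
with an image in the middle. -/
theorem length_add (h : IsGluing f g m₁ m₂) (u : List L) :
    (u.filterMap f).length + (u.filterMap g).length =
      u.length + ((u.filterMap f).filterMap m₁).length := by
  induction u with
  | nil => rfl
  | cons l u ih =>
    have hc := h.cover l
    have hm := h.mid l
    cases hf : f l with
    | none =>
      cases hg : g l with
      | none => simp [hf, hg] at hc
      | some y => simp [hf, hg]; omega
    | some x =>
      cases hg : g l with
      | none =>
        rw [hf, hg] at hm
        have hm' : m₁ x = none := hm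
        simp [hf, hg, hm']; omega
      | some y =>
        obtain ⟨z, hz⟩ := Option.isSome_iff_exists.mp (h.both hf (by rw [hg]; rfl))
        simp [hf, hg, hz]; omega

/-- A position seen by `f` is sent where `η` sends it, and a position seen by `g` where `θ` does.
For a position seen by both, the two prescriptions have the same rank in the middle word by `e`,
hence coincide. The resulting map is injective, and bijective by counting. -/
theorem exists_glue (h : IsGluing f g m₁ m₂) {u v : List L}
    (η : FreeHom₂ (u.filterMap f) (v.filterMap f)) (θ : FreeHom₂ (u.filterMap g) (v.filterMap g))
    (e : HEq (map₂ m₁ η) (map₂ m₂ θ)) : ∃ κ : FreeHom₂ u v, map₂ f κ = η ∧ map₂ g κ = θ := by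
  have hmid : ∀ w : List L, (w.filterMap f).filterMap m₁ = (w.filterMap g).filterMap m₂ := by
    intro w
    rw [List.filterMap_filterMap, List.filterMap_filterMap, funext h.mid]
  -- As `k` is injective where it is defined, preserving the renamed labels amounts to preserving
  -- the original ones.
  have step : ∀ {N : Type} (k : L → Option N) (_ : ∀ {l l' x}, k l = some x → k l' = some x → l = l')
      (ζ : FreeHom₂ (u.filterMap k) (v.filterMap k)) (i : Fin u.length)
      (hi : (k (u.get i)).isSome), ∃ (j : Fin v.length) (_ : v.get j = u.get i)
        (hj : (k (v.get j)).isSome), ζ.equiv (pos k u ⟨i, hi⟩) = pos k v ⟨j, hj⟩ := by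
    intro N k hk ζ i hi
    obtain ⟨⟨j, hj⟩, e⟩ := (pos k v).surjective (ζ.equiv (pos k u ⟨i, hi⟩))
    refine ⟨j, ?_, hj, e.symm⟩
    have e₁ := get_pos k v ⟨j, hj⟩
    rw [e, ζ.label, get_pos] at e₁
    obtain ⟨x, hx⟩ := Option.isSome_iff_exists.mp hi
    exact hk (e₁.symm.trans hx) hx
  -- The rank, in the middle word, of the position assigned by `ζ`. The statement is uniform in the
  -- projection `k`, to be used with both `f` and `g`.
  have mval : ∀ {N : Type} (k : L → Option N) (m : N → Option M)
      (ζ : FreeHom₂ (u.filterMap k) (v.filterMap k)) (i : Fin u.length) (j : Fin v.length)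
      (hi : (k (u.get i)).isSome) (hj : (k (v.get j)).isSome)
      (_ : ζ.equiv (pos k u ⟨i, hi⟩) = pos k v ⟨j, hj⟩) (_ : ((k (u.get i)).bind m).isSome)
      (c : Fin ((u.filterMap k).filterMap m).length)
      (_ : c.val = (((u.take i.val).filterMap k).filterMap m).length),
      ((map₂ m ζ).equiv c).val = ((v.take j.val).filterMap (fun l => (k l).bind m)).length := by
    intro N k m ζ i j hi hj e₁ hm c hc
    rw [map₂_val m ζ (pos k u ⟨i, hi⟩) ?_ c ?_, e₁, pos_val, take_filterMap,
      List.filterMap_filterMap]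
    · rw [← get_pos k u ⟨i, hi⟩] at hm
      exact hm
    · rw [hc, pos_val, take_filterMap]
  have key : ∀ i : Fin u.length, ∃ j : Fin v.length, v.get j = u.get i ∧
      (∀ hi : (f (u.get i)).isSome, ∃ hj : (f (v.get j)).isSome,
        η.equiv (pos f u ⟨i, hi⟩) = pos f v ⟨j, hj⟩) ∧
      (∀ hi : (g (u.get i)).isSome, ∃ hj : (g (v.get j)).isSome,
        θ.equiv (pos g u ⟨i, hi⟩) = pos g v ⟨j, hj⟩) := by
    intro i
    by_cases hf : (f (u.get i)).isSome
    · obtain ⟨a, ha, hfa, ea⟩ := step f h.inj₁ η i hf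
      refine ⟨a, ha, fun _ => ⟨hfa, ea⟩, fun hg => ?_⟩
      obtain ⟨b, hb, hgb, eb⟩ := step g h.inj₂ θ i hg
      obtain ⟨x, hx⟩ := Option.isSome_iff_exists.mp hf
      have hm : ((f (u.get i)).bind m₁).isSome := by rw [hx]; exact h.both hx hg
      have hm' : ((g (u.get i)).bind m₂).isSome := by rwa [← h.mid]
      have hml : ∀ j : Fin v.length, v.get j = u.get i → ((f (v.get j)).bind m₁).isSome := by
        intro j hj; rwa [hj]
      -- The place of the shared letter in the middle word reached through `f`; `c'` is the same
      -- index in the equal word reached through `g`.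
      let c : Fin ((u.filterMap f).filterMap m₁).length :=
        pos m₁ (u.filterMap f) ⟨pos f u ⟨i, hf⟩, by
          rw [← get_pos f u ⟨i, hf⟩] at hm; exact hm⟩
      let c' : Fin ((u.filterMap g).filterMap m₂).length := ⟨c.val, by rw [← hmid]; exact c.2⟩
      have hc : c.val = (((u.take i.val).filterMap f).filterMap m₁).length := by
        change (((u.filterMap f).take ((u.take i.val).filterMap f).length).filterMap m₁).length = _
        rw [take_filterMap]
      have e₁ := mval f m₁ η i a hf hfa ea hm c hc
      have e₂ := mval g m₂ θ i b hg hgb eb hm' c'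
        (hc.trans (congrArg List.length (hmid _)))
      -- At this index `e` says that `a` and `b` have the same rank among the positions with a
      -- middle image, hence are equal.
      have e₃ := val_eq_of_hom₂_heq (hmid u) (hmid v) e c c' rfl
      rw [e₁, e₂, ← funext h.mid] at e₃
      have : (⟨a, hml a ha⟩ : {i : Fin v.length // ((f (v.get i)).bind m₁).isSome}) =
          ⟨b, hml b hb⟩ :=
        (pos (fun l => (f l).bind m₁) v).injective (Fin.ext e₃)
      obtain rfl : a = b := congrArg Subtype.val this
      exact ⟨hgb, eb⟩
    · have hg : (g (u.get i)).isSome := (h.cover _).resolve_left hf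
      obtain ⟨b, hb, hgb, eb⟩ := step g h.inj₂ θ i hg
      exact ⟨b, hb, fun hi => absurd hi hf, fun _ => ⟨hgb, eb⟩⟩
  choose F hlabel hF hG using key
  -- Positions with the same image carry the same label, hence are seen by a common projection,
  -- where `η` or `θ` is injective.
  have hinj : Function.Injective F := by
    intro i i' hii
    have hl : u.get i = u.get i' := by rw [← hlabel i, ← hlabel i', hii]
    rcases h.cover (u.get i) with hi | hi
    · obtain ⟨hj, ej⟩ := hF i hi
      obtain ⟨hj', ej'⟩ := hF i' (by rwa [← hl])
      have : pos f v ⟨F i, hj⟩ = pos f v ⟨F i', hj'⟩ := congrArg _ (Subtype.ext hii)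
      rw [← ej, ← ej'] at this
      exact congrArg Subtype.val ((pos f u).injective (η.equiv.injective this))
    · obtain ⟨hj, ej⟩ := hG i hi
      obtain ⟨hj', ej'⟩ := hG i' (by rwa [← hl])
      have : pos g v ⟨F i, hj⟩ = pos g v ⟨F i', hj'⟩ := congrArg _ (Subtype.ext hii)
      rw [← ej, ← ej'] at this
      exact congrArg Subtype.val ((pos g u).injective (θ.equiv.injective this))
  -- In `length_add` the other three lengths are preserved by `η`, by `θ` and by the restriction of
  -- `η` to the middle.
  have hlen : u.length = v.length := by
    have e₁ := h.length_add u
    have e₂ := h.length_add v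
    have e₃ := length_eq η
    have e₄ := length_eq θ
    have e₅ := length_eq (map₂ m₁ η)
    omega
  have hbij : Function.Bijective F :=
    (Fintype.bijective_iff_injective_and_card F).mpr ⟨hinj, by simpa using hlen⟩
  refine ⟨⟨Equiv.ofBijective F hbij, hlabel⟩, ?_, ?_⟩
  · apply hom₂_ext'
    intro j
    obtain ⟨⟨i, hi⟩, rfl⟩ := (pos f u).surjective j
    obtain ⟨hj, ej⟩ := hF i hi
    rw [map₂_pos, ej]; rfl
  · apply hom₂_ext'
    intro j
    obtain ⟨⟨i, hi⟩, rfl⟩ := (pos g u).surjective j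
    obtain ⟨hj, ej⟩ := hG i hi
    rw [map₂_pos, ej]; rfl

end IsGluing

end Words

/-! ### Composites of letterwise 2-functors and rewriting rules for projections and letters -/

namespace TwoCat

variable {L L₁ L₂ : Type}

/-- Turns equations between composites of letterwise 2-functors, 2-cells included, into equations
between partial functions on letters. -/
theorem partialMap_comp (h : L → Option L₁) (k : L₁ → Option L₂) :
    partialMap h ≫ partialMap k = partialMap (fun l => (h l).bind k) :=
  hom_ext (fun _ => rfl)
    (fun u => heq_of_eq (List.filterMap_filterMap (l := (show List L from u)) (f := h) (g := k)))
    (fun η => Words.map₂_map₂_heq (L := L) h k η)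

section Projections

variable {A B C A' B' X : TwoCat}

theorem grayMap_π₁_assoc (F : A ⟶ A') (G : B ⟶ B') (H : A' ⟶ X) :
    grayMap F G ≫ π₁ A' B' ≫ H = π₁ A B ≫ F ≫ H := by
  rw [← Category.assoc, grayMap_π₁, Category.assoc]

theorem grayMap_π₂_assoc (F : A ⟶ A') (G : B ⟶ B') (H : B' ⟶ X) :
    grayMap F G ≫ π₂ A' B' ≫ H = π₂ A B ≫ G ≫ H := by
  rw [← Category.assoc, grayMap_π₂, Category.assoc]

theorem assocHom_π₂_assoc (H : gray B C ⟶ X) :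
    assocHom A B C ≫ π₂ A (gray B C) ≫ H = grayMap (π₂ A B) (𝟙 C) ≫ H := by
  rw [← Category.assoc, assocHom_π₂]

theorem assocInv_π₂_assoc (H : C ⟶ X) :
    assocInv A B C ≫ π₂ (gray A B) C ≫ H = π₂ A (gray B C) ≫ π₂ B C ≫ H := by
  rw [← Category.assoc, assocInv_π₂, Category.assoc]

theorem letterMap_comp_congr {ΛA ΛB ΛC : Type} [Coded A ΛA] [Coded B ΛB] [Coded C ΛC]
    {F G : A ⟶ B} (h : ∀ l, letterMap F l = letterMap G l) (K : B ⟶ C) (l : ΛA) :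
    letterMap (F ≫ K) l = letterMap (G ≫ K) l := by
  rw [letterMap_comp, letterMap_comp, h]

end Projections

attribute [simp] grayMap_π₁ grayMap_π₂ assocHom_π₁ assocHom_π₂ assocInv_π₁ assocInv_π₂
  grayMap_π₁_assoc grayMap_π₂_assoc assocHom_π₂_assoc assocInv_π₂_assoc partialMap_comp
  letterMap_comp letterMap_id letterMap_grayMap_inl letterMap_grayMap_inr letterMap_π₁_inl
  letterMap_assocHom_inl_inl letterMap_assocHom_inl_inr letterMap_assocHom_inr
  letterMap_assocInv_inl letterMap_assocInv_inr_inl letterMap_assocInv_inr_inr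
  letterMap_partialMap

theorem map_partialMap_letter {L L' : Type} (h : L → Option L') (l : L) :
    map (partialMap h) (freeWord [l]) = freeWord (h l).toList := by
  change List.filterMap h [l] = _
  cases e : h l <;> simp [e]

theorem code_lft {L ΛB : Type} {B : TwoCat} [Coded B ΛB] (l : L) (b : B) :
    Coded.code (A := gray (free L) B) (lft l b) = [Sum.inl l] := code_inl _ _

theorem code_rgt {L ΛA : Type} {A : TwoCat} [Coded A ΛA] (a : A) (l : L) :
    Coded.code (A := gray A (free L)) (rgt a l) = [Sum.inr l] := code_inr _ _

end TwoCat

/-! ### The comonoid of games -/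

section Game

theorem letterMap_gameComul (m : GameMove) :
    letterMap gameComul m = match m with
      | .O => [Sum.inr .O, Sum.inl .O]
      | .P => [Sum.inl .P, Sum.inr .P] := by
  rw [gameComul, letterMap_toGray]
  cases m
  · exact (code_gray_comp _ _).trans (by rw [code_lft, code_rgt]; rfl)
  · exact (code_gray_comp _ _).trans (by rw [code_lft, code_rgt]; rfl)

@[simp] theorem letterMap_gameComul_O :
    letterMap gameComul GameMove.O = [Sum.inr .O, Sum.inl .O] := letterMap_gameComul _

@[simp] theorem letterMap_gameComul_P :
    letterMap gameComul GameMove.P = [Sum.inl .P, Sum.inr .P] := letterMap_gameComul _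

@[simp] theorem gameComul_π₁ : gameComul ≫ π₁ anchorGame anchorGame = 𝟙 _ := toGray_π₁ _ _ _

@[simp] theorem gameComul_π₂ : gameComul ≫ π₂ anchorGame anchorGame = 𝟙 _ := toGray_π₂ _ _ _

@[simp] theorem gameComul_π₁_assoc {X : TwoCat} (H : anchorGame ⟶ X) :
    gameComul ≫ π₁ anchorGame anchorGame ≫ H = H := by
  rw [← Category.assoc, gameComul_π₁, Category.id_comp]

@[simp] theorem gameComul_π₂_assoc {X : TwoCat} (H : anchorGame ⟶ X) :
    gameComul ≫ π₂ anchorGame anchorGame ≫ H = H := by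
  rw [← Category.assoc, gameComul_π₂, Category.id_comp]

/-- Both sides send `O` to `O₃ · O₂ · O₁` and `P` to `P₁ · P₂ · P₃`, and all their projections are
identities. -/
theorem gameComul_assoc :
    gameComul ≫ grayMap (𝟙 anchorGame) gameComul =
      gameComul ≫ grayMap gameComul (𝟙 anchorGame) ≫ assocHom _ _ _ := by
  have hl : ∀ m, letterMap (gameComul ≫ grayMap (𝟙 anchorGame) gameComul) m =
      letterMap (gameComul ≫ grayMap gameComul (𝟙 anchorGame) ≫ assocHom _ _ _) m := by
    rintro (_ | _) <;> simp
  refine ext_letterMap hl ?_ (ext_letterMap (letterMap_comp_congr hl _) ?_ ?_) <;> simp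

/-- After the unitor, which is invertible, this says that the second projection of the
comultiplication is the identity. -/
theorem gameCounit_comul :
    gameComul ≫ grayMap gameCounit (𝟙 anchorGame) = insR anchorGame PtObj.mk := by
  rw [← cancel_mono (TwoCat.leftUnitor anchorGame).hom]
  change (gameComul ≫ grayMap gameCounit (𝟙 anchorGame)) ≫ π₂ TwoCat.pt anchorGame =
    (TwoCat.leftUnitor anchorGame).inv ≫ (TwoCat.leftUnitor anchorGame).hom
  simp

theorem gameComul_counit :
    gameComul ≫ grayMap (𝟙 anchorGame) gameCounit = insL anchorGame PtObj.mk := by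
  rw [← cancel_mono (TwoCat.rightUnitor anchorGame).hom]
  change (gameComul ≫ grayMap (𝟙 anchorGame) gameCounit) ≫ π₁ anchorGame TwoCat.pt =
    (TwoCat.rightUnitor anchorGame).inv ≫ (TwoCat.rightUnitor anchorGame).hom
  simp

/-- The comonoid of polarities of games. -/
@[reducible] def gameComonObj : ComonObj anchorGame where
  counit := gameCounit
  comul := gameComul
  counit_comul := gameCounit_comul
  comul_counit := gameComul_counit
  comul_assoc := gameComul_assoc

end Game

/-! ### Bicomodules given by partial functions to the moves of the source and of the target -/

section Coaction

variable {L : Type}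

/-- The word of a letter and of its image in the target game: an Opponent move of the target is
played before, and a Player move after. -/
def rightWord (t : L → Option GameMove) (l : L) :
    (⟨FreeObj.mk, FreeObj.mk⟩ : GrayObj (free L) anchorGame) ⟶ ⟨FreeObj.mk, FreeObj.mk⟩ :=
  match t l with
  | none => lft (B := anchorGame) l FreeObj.mk
  | some .O => rgt (A := free L) FreeObj.mk GameMove.O ≫ lft (B := anchorGame) l FreeObj.mk
  | some .P => lft (B := anchorGame) l FreeObj.mk ≫ rgt (A := free L) FreeObj.mk GameMove.P

/-- The word of a letter and of its image in the source game: a Player move of the source is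
played before, and an Opponent move after. -/
def leftWord (s : L → Option GameMove) (l : L) :
    (⟨FreeObj.mk, FreeObj.mk⟩ : GrayObj anchorGame (free L)) ⟶ ⟨FreeObj.mk, FreeObj.mk⟩ :=
  match s l with
  | none => rgt (A := anchorGame) FreeObj.mk l
  | some .P => lft (B := free L) GameMove.P FreeObj.mk ≫ rgt (A := anchorGame) FreeObj.mk l
  | some .O => rgt (A := anchorGame) FreeObj.mk l ≫ lft (B := free L) GameMove.O FreeObj.mk

/-- The word of a letter and of its images in the source and in the target game. -/
def coactWord (s t : L → Option GameMove) (l : L) :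
    (⟨FreeObj.mk, ⟨FreeObj.mk, FreeObj.mk⟩⟩ : GrayObj anchorGame (gray (free L) anchorGame)) ⟶
      ⟨FreeObj.mk, ⟨FreeObj.mk, FreeObj.mk⟩⟩ :=
  match s l with
  | none => Gray.inr (A := anchorGame) FreeObj.mk (rightWord t l)
  | some .P => lft (B := gray (free L) anchorGame) GameMove.P ⟨FreeObj.mk, FreeObj.mk⟩ ≫
      Gray.inr (A := anchorGame) FreeObj.mk (rightWord t l)
  | some .O => Gray.inr (A := anchorGame) FreeObj.mk (rightWord t l) ≫
      lft (B := gray (free L) anchorGame) GameMove.O ⟨FreeObj.mk, FreeObj.mk⟩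

variable (s t : L → Option GameMove)

theorem rightWord_fst (l : L) : GrayHom.fst (rightWord t l) = map (𝟙 (free L)) (freeWord [l]) := by
  unfold rightWord
  generalize t l = m
  rcases m with _ | _ | _ <;> rfl

theorem rightWord_snd (l : L) : GrayHom.snd (rightWord t l) = map (partialMap t) (freeWord [l]) := by
  rw [map_partialMap_letter]
  unfold rightWord
  generalize t l = m
  rcases m with _ | _ | _ <;> rfl

theorem leftWord_snd (l : L) : GrayHom.snd (leftWord s l) = map (𝟙 (free L)) (freeWord [l]) := by
  unfold leftWord
  generalize s l = m
  rcases m with _ | _ | _ <;> rfl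

theorem leftWord_fst (l : L) : GrayHom.fst (leftWord s l) = map (partialMap s) (freeWord [l]) := by
  rw [map_partialMap_letter]
  unfold leftWord
  generalize s l = m
  rcases m with _ | _ | _ <;> rfl

/-- The right coaction on the words over `L`, for a partial function to the moves of a game. -/
noncomputable def rightCoact : free L ⟶ gray (free L) anchorGame :=
  toGray (𝟙 (free L)) (partialMap t) (rightWord t) (rightWord_fst t) (rightWord_snd t)

/-- The left coaction on the words over `L`, for a partial function to the moves of a game. -/
noncomputable def leftCoact : free L ⟶ gray anchorGame (free L) :=
  toGray (partialMap s) (𝟙 (free L)) (leftWord s) (leftWord_fst s) (leftWord_snd s)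

@[simp] theorem letterMap_rightCoact (l : L) :
    letterMap (rightCoact t) l = match t l with
      | none => [Sum.inl l]
      | some .O => [Sum.inr .O, Sum.inl l]
      | some .P => [Sum.inl l, Sum.inr .P] := by
  rw [rightCoact, letterMap_toGray]
  unfold rightWord
  generalize t l = m
  rcases m with _ | _ | _
  · exact code_lft _ _
  · exact (code_gray_comp _ _).trans (by rw [code_lft, code_rgt]; rfl)
  · exact (code_gray_comp _ _).trans (by rw [code_lft, code_rgt]; rfl)

@[simp] theorem letterMap_leftCoact (l : L) :
    letterMap (leftCoact s) l = match s l with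
      | none => [Sum.inr l]
      | some .P => [Sum.inl .P, Sum.inr l]
      | some .O => [Sum.inr l, Sum.inl .O] := by
  rw [leftCoact, letterMap_toGray]
  unfold leftWord
  generalize s l = m
  rcases m with _ | _ | _
  · exact code_rgt _ _
  · exact (code_gray_comp _ _).trans (by rw [code_lft, code_rgt]; rfl)
  · exact (code_gray_comp _ _).trans (by rw [code_lft, code_rgt]; rfl)

@[simp] theorem rightCoact_π₁ : rightCoact t ≫ π₁ (free L) anchorGame = 𝟙 _ := toGray_π₁ _ _ _
@[simp] theorem rightCoact_π₂ : rightCoact t ≫ π₂ (free L) anchorGame = partialMap t :=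
  toGray_π₂ _ _ _
@[simp] theorem leftCoact_π₁ : leftCoact s ≫ π₁ anchorGame (free L) = partialMap s :=
  toGray_π₁ _ _ _
@[simp] theorem leftCoact_π₂ : leftCoact s ≫ π₂ anchorGame (free L) = 𝟙 _ := toGray_π₂ _ _ _

section
variable {X : TwoCat}

@[simp] theorem rightCoact_π₁_assoc (H : free L ⟶ X) :
    rightCoact t ≫ π₁ (free L) anchorGame ≫ H = H := by
  rw [← Category.assoc, rightCoact_π₁, Category.id_comp]
@[simp] theorem rightCoact_π₂_assoc (H : anchorGame ⟶ X) :
    rightCoact t ≫ π₂ (free L) anchorGame ≫ H = partialMap t ≫ H := by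
  rw [← Category.assoc, rightCoact_π₂]
@[simp] theorem leftCoact_π₁_assoc (H : anchorGame ⟶ X) :
    leftCoact s ≫ π₁ anchorGame (free L) ≫ H = partialMap s ≫ H := by
  rw [← Category.assoc, leftCoact_π₁]
@[simp] theorem leftCoact_π₂_assoc (H : free L ⟶ X) :
    leftCoact s ≫ π₂ anchorGame (free L) ≫ H = H := by
  rw [← Category.assoc, leftCoact_π₂, Category.id_comp]

end

theorem map_rightCoact_letter (l : L) : map (rightCoact t) (freeWord [l]) = rightWord t l :=
  Coded.code_injective (A := gray (free L) anchorGame)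
    ((letterMap_eq (rightCoact t) (freeWord [l]) rfl).symm.trans (letterMap_toGray _ _ _ l))

theorem coactWord_fst (l : L) :
    GrayHom.fst (coactWord s t l) = map (partialMap s) (freeWord [l]) := by
  rw [map_partialMap_letter]
  unfold coactWord
  generalize s l = m
  rcases m with _ | _ | _ <;> rfl

theorem coactWord_snd (l : L) :
    GrayHom.snd (coactWord s t l) = map (rightCoact t) (freeWord [l]) := by
  rw [map_rightCoact_letter]
  unfold coactWord
  generalize s l = m
  rcases m with _ | _ | _
  · rfl
  · exact Bicategory.Strict.comp_id _
  · exact Bicategory.Strict.id_comp _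

/-- The coaction on the words over `L`, for partial functions to the moves of the source and of the
target game. -/
noncomputable def coact : free L ⟶ gray anchorGame (gray (free L) anchorGame) :=
  toGray (partialMap s) (rightCoact t) (coactWord s t) (coactWord_fst s t) (coactWord_snd s t)

theorem code_rightWord (l : L) :
    Coded.code (A := gray (free L) anchorGame) (rightWord t l) = letterMap (rightCoact t) l :=
  (letterMap_toGray _ _ _ l).symm

@[simp] theorem letterMap_coact (l : L) :
    letterMap (coact s t) l = match s l with
      | none => (letterMap (rightCoact t) l).map Sum.inr
      | some .P => Sum.inl .P :: (letterMap (rightCoact t) l).map Sum.inr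
      | some .O => (letterMap (rightCoact t) l).map Sum.inr ++ [Sum.inl .O] := by
  rw [coact, letterMap_toGray, ← code_rightWord]
  unfold coactWord
  generalize s l = m
  rcases m with _ | _ | _
  · exact code_inr _ _
  · exact (code_gray_comp _ _).trans (by rw [code_lft, code_inr])
  · exact (code_gray_comp _ _).trans (by rw [code_lft, code_inr]; rfl)

@[simp] theorem coact_π₁ :
    coact s t ≫ π₁ anchorGame (gray (free L) anchorGame) = partialMap s := toGray_π₁ _ _ _
@[simp] theorem coact_π₂ :
    coact s t ≫ π₂ anchorGame (gray (free L) anchorGame) = rightCoact t := toGray_π₂ _ _ _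
@[simp] theorem coact_π₁_assoc {X : TwoCat} (H : anchorGame ⟶ X) :
    coact s t ≫ π₁ anchorGame (gray (free L) anchorGame) ≫ H = partialMap s ≫ H := by
  rw [← Category.assoc, coact_π₁]
@[simp] theorem coact_π₂_assoc {X : TwoCat} (H : gray (free L) anchorGame ⟶ X) :
    coact s t ≫ π₂ anchorGame (gray (free L) anchorGame) ≫ H = rightCoact t ≫ H := by
  rw [← Category.assoc, coact_π₂]

/-- Disjointness matters. For a letter over `P` in the source and over `O` in the target, iterating
the coaction would play the outer target copy before the inner source copy, whereas the
comultiplications play both source copies first. -/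
theorem coact_coassoc (h : ∀ l, s l = none ∨ t l = none) :
    coact s t ≫ grayMap (𝟙 anchorGame) (grayMap (coact s t) (𝟙 anchorGame)) ≫
      grayMap (𝟙 anchorGame) (assocHom anchorGame (gray (free L) anchorGame) anchorGame) ≫
      assocInv anchorGame anchorGame (gray (gray (free L) anchorGame) anchorGame) ≫
      grayMap (𝟙 (gray anchorGame anchorGame)) (assocHom (free L) anchorGame anchorGame) =
    coact s t ≫ grayMap gameComul (grayMap (𝟙 (free L)) gameComul) := by
  have hl : ∀ l, letterMap (coact s t ≫ grayMap (𝟙 anchorGame) (grayMap (coact s t) (𝟙 anchorGame)) ≫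
      grayMap (𝟙 anchorGame) (assocHom anchorGame (gray (free L) anchorGame) anchorGame) ≫
      assocInv anchorGame anchorGame (gray (gray (free L) anchorGame) anchorGame) ≫
      grayMap (𝟙 (gray anchorGame anchorGame)) (assocHom (free L) anchorGame anchorGame)) l =
    letterMap (coact s t ≫ grayMap gameComul (grayMap (𝟙 (free L)) gameComul)) l := by
    intro l
    rcases h l with hs | ht
    · rcases ht : t l with _ | _ | _ <;> simp [hs, ht]
    · rcases hs : s l with _ | _ | _ <;> simp [hs, ht]
  -- One use of `ext_letterMap` for each tensor sign of the target, which is the tensor of two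
  -- source games with the words and two target games; the leaves compare projections to single
  -- factors.
  refine ext_letterMap hl
    (ext_letterMap (letterMap_comp_congr hl _) ?_ ?_)
    (ext_letterMap (letterMap_comp_congr hl _) ?_
      (ext_letterMap (letterMap_comp_congr (letterMap_comp_congr hl _) _) ?_ ?_)) <;> simp

theorem coact_counit :
    coact s t ≫ grayMap gameCounit (grayMap (𝟙 (free L)) gameCounit) ≫
      π₂ TwoCat.pt (gray (free L) TwoCat.pt) ≫ π₁ (free L) TwoCat.pt = 𝟙 _ := by
  simp

/-- Identifies the left coaction derived from the counit with an explicit 2-functor; the forks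
defining the horizontal composites then become computable on letters. -/
theorem coact_left :
    coact s t ≫ grayMap (𝟙 anchorGame) (grayMap (𝟙 (free L)) gameCounit) ≫
      grayMap (𝟙 anchorGame) (π₁ (free L) TwoCat.pt) = leftCoact s := by
  refine ext_letterMap ?_ ?_ ?_
  · intro l
    rcases hs : s l with _ | _ | _ <;> rcases ht : t l with _ | _ | _ <;> simp [hs, ht]
  · simp
  · simp

theorem coact_right :
    coact s t ≫ grayMap gameCounit (𝟙 (gray (free L) anchorGame)) ≫
      π₂ TwoCat.pt (gray (free L) anchorGame) = rightCoact t := by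
  simp

attribute [local instance] gameComonObj

/-- The bicomodule given by partial functions to the moves of the source and of the target game. -/
@[reducible] noncomputable def polarized (h : ∀ l, s l = none ∨ t l = none) : BicomoduleStr anchorGame anchorGame (free L) where
  coact := coact s t
  coassoc := coact_coassoc s t h
  counit := coact_counit s t

theorem polarized_left (h : ∀ l, s l = none ∨ t l = none) : (polarized s t h).left = leftCoact s := coact_left s t

theorem polarized_right (h : ∀ l, s l = none ∨ t l = none) : (polarized s t h).right = rightCoact t := coact_right s t

end Coaction

/-! ### Horizontal composites of polarized bicomodules -/

section Composite

variable {LS LT LE : Type}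

/-- The letters of `LE` are the letters of `LS` without image in the middle game, the letters of `LT`
without image in the middle game, and the pairs of letters with the same image in the middle game. -/
structure IsComposite (tS : LS → Option GameMove) (sT : LT → Option GameMove)
    (f : LE → Option LS) (g : LE → Option LT) : Prop extends Words.IsGluing f g tS sT where
  exists_fst : ∀ a, tS a = none → ∃ e, f e = some a
  exists_snd : ∀ b, sT b = none → ∃ e, g e = some b
  exists_both : ∀ a b, (tS a).isSome → tS a = sT b → ∃ e, f e = some a ∧ g e = some b

variable (tS : LS → Option GameMove) (sT : LT → Option GameMove) (f : LE → Option LS)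
  (g : LE → Option LT)

/-- The word of a letter in the two components. Two simultaneous letters are ordered by the polarity
of their common image in the middle game. -/
def inclWord (e : LE) :
    (⟨FreeObj.mk, FreeObj.mk⟩ : GrayObj (free LS) (free LT)) ⟶ ⟨FreeObj.mk, FreeObj.mk⟩ :=
  match f e, g e with
  | some a, none => lft (B := free LT) a FreeObj.mk
  | none, some b => rgt (A := free LS) FreeObj.mk b
  | some a, some b => match tS a with
    | some .O => rgt (A := free LS) FreeObj.mk b ≫ lft (B := free LT) a FreeObj.mk
    | _ => lft (B := free LT) a FreeObj.mk ≫ rgt (A := free LS) FreeObj.mk b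
  | none, none => 𝟙 _

theorem inclWord_fst (e : LE) :
    GrayHom.fst (inclWord tS f g e) = map (partialMap f) (freeWord [e]) := by
  rw [map_partialMap_letter]
  unfold inclWord
  generalize f e = a
  generalize g e = b
  rcases a with _ | a <;> rcases b with _ | b
  · rfl
  · rfl
  · rfl
  · dsimp only
    generalize tS a = m
    rcases m with _ | _ | _ <;> rfl

theorem inclWord_snd (e : LE) :
    GrayHom.snd (inclWord tS f g e) = map (partialMap g) (freeWord [e]) := by
  rw [map_partialMap_letter]
  unfold inclWord
  generalize f e = a
  generalize g e = b
  rcases a with _ | a <;> rcases b with _ | b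
  · rfl
  · rfl
  · rfl
  · dsimp only
    generalize tS a = m
    rcases m with _ | _ | _ <;> rfl

/-- The inclusion of the composite into the tensor product. -/
noncomputable def incl : free LE ⟶ gray (free LS) (free LT) :=
  toGray (partialMap f) (partialMap g) (inclWord tS f g) (inclWord_fst tS f g) (inclWord_snd tS f g)

@[simp] theorem letterMap_incl (e : LE) :
    letterMap (incl tS f g) e = match f e, g e with
      | some a, none => [Sum.inl a]
      | none, some b => [Sum.inr b]
      | some a, some b => match tS a with
        | some .O => [Sum.inr b, Sum.inl a]
        | _ => [Sum.inl a, Sum.inr b]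
      | none, none => [] := by
  rw [incl, letterMap_toGray]
  unfold inclWord
  generalize f e = a
  generalize g e = b
  rcases a with _ | a <;> rcases b with _ | b
  · exact code_gray_id _
  · exact code_rgt _ _
  · exact code_lft _ _
  · dsimp only
    generalize tS a = m
    rcases m with _ | _ | _ <;> exact (code_gray_comp _ _).trans (by rw [code_lft, code_rgt]; rfl)

@[simp] theorem incl_π₁ : incl tS f g ≫ π₁ (free LS) (free LT) = partialMap f := toGray_π₁ _ _ _
@[simp] theorem incl_π₂ : incl tS f g ≫ π₂ (free LS) (free LT) = partialMap g := toGray_π₂ _ _ _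
@[simp] theorem incl_π₁_assoc {X : TwoCat} (H : free LS ⟶ X) :
    incl tS f g ≫ π₁ (free LS) (free LT) ≫ H = partialMap f ≫ H := by
  rw [← Category.assoc, incl_π₁]
@[simp] theorem incl_π₂_assoc {X : TwoCat} (H : free LT ⟶ X) :
    incl tS f g ≫ π₂ (free LS) (free LT) ≫ H = partialMap g ≫ H := by
  rw [← Category.assoc, incl_π₂]

/-- The right coaction of the first component. -/
noncomputable abbrev forkFst : gray (free LS) (free LT) ⟶ gray (free LS) (gray anchorGame (free LT)) :=
  grayMap (rightCoact tS) (𝟙 (free LT)) ≫ assocHom (free LS) anchorGame (free LT)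

/-- The left coaction of the second component. -/
noncomputable abbrev forkSnd : gray (free LS) (free LT) ⟶ gray (free LS) (gray anchorGame (free LT)) :=
  grayMap (𝟙 (free LS)) (leftCoact sT)

/-- The first fork inserts middle letters only beside letters of the first component, and the second
fork only beside those of the second component. `IsComposite.word` rests on this contrast. -/
theorem letterMap_forkFst_inl (a : LS) :
    letterMap (forkFst (LT := LT) tS) (Sum.inl a) = match tS a with
      | none => [Sum.inl a]
      | some .O => [Sum.inr (Sum.inl .O), Sum.inl a]
      | some .P => [Sum.inl a, Sum.inr (Sum.inl .P)] := by
  rcases h : tS a with _ | _ | _ <;> simp [h]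

theorem letterMap_forkFst_inr (b : LT) :
    letterMap (forkFst tS) (Sum.inr b) = [Sum.inr (Sum.inr b)] := by
  simp

theorem letterMap_forkSnd_inl (a : LS) :
    letterMap (forkSnd sT) (Sum.inl a) = [Sum.inl a] := by
  simp

theorem letterMap_forkSnd_inr (b : LT) :
    letterMap (forkSnd (LS := LS) sT) (Sum.inr b) = match sT b with
      | none => [Sum.inr (Sum.inr b)]
      | some .P => [Sum.inr (Sum.inl .P), Sum.inr (Sum.inr b)]
      | some .O => [Sum.inr (Sum.inr b), Sum.inr (Sum.inl .O)] := by
  rcases h : sT b with _ | _ | _ <;> simp [h]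

variable {tS sT f g}

/-- The word is parsed from the left. A letter without middle image is fixed by both forks and is by
itself a letter of the composite. A letter with middle image receives an inserted letter from one
fork only, and the other fork can match it only through an immediately following partner over the
same move. The polarity decides which component comes first, as in `inclWord`. -/
theorem IsComposite.word (h : IsComposite tS sT f g) (n : ℕ) (w : List (LS ⊕ LT)) (hn : w.length ≤ n)
    (e : w.flatMap (letterMap (forkFst tS)) = w.flatMap (letterMap (forkSnd sT))) :
    ∃ v : List LE, v.flatMap (letterMap (incl tS f g)) = w := by
  -- The bound `n` provides a strong induction on the length, since a synchronized pair consumes two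
  -- letters at once.
  induction n generalizing w with
  | zero => exact ⟨[], by rw [List.length_eq_zero_iff.mp (Nat.le_zero.mp hn)]; rfl⟩
  | succ n ih =>
    rcases w with _ | ⟨a | b, w⟩
    · exact ⟨[], rfl⟩
    · rw [List.flatMap_cons, List.flatMap_cons, letterMap_forkFst_inl, letterMap_forkSnd_inl] at e
      rcases ht : tS a with _ | _ | _
      · rw [ht] at e
        obtain ⟨v, hv⟩ := ih w (by simpa using hn) (by simpa using e)
        obtain ⟨l, hl⟩ := h.exists_fst a ht
        have hg : g l = none := by
          by_contra hg
          have := h.both hl (Option.isSome_iff_ne_none.mpr hg)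
          rw [ht] at this
          simp at this
        exact ⟨l :: v, by rw [List.flatMap_cons, hv]; simp [hl, hg]⟩
      -- Middle image `O`: the first fork begins with the middle letter and the second one with `a`,
      -- which is impossible.
      · rw [ht] at e
        simp at e
      -- Middle image `P`: the first fork has `P` right after `a`, so the next letter must begin
      -- with `P` under the second fork. Only a `b` over `P` does.
      · rw [ht] at e
        simp only [List.cons_append, List.nil_append, List.cons.injEq, true_and] at e
        rcases w with _ | ⟨a' | b, w⟩
        · simp at e
        · rw [List.flatMap_cons, List.flatMap_cons, letterMap_forkSnd_inl] at e
          simp at e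
        · rw [List.flatMap_cons, List.flatMap_cons, letterMap_forkSnd_inr, letterMap_forkFst_inr] at e
          rcases hs : sT b with _ | _ | _
          · rw [hs] at e; simp at e
          · rw [hs] at e; simp at e
          · rw [hs] at e
            obtain ⟨v, hv⟩ := ih w (by simp only [List.length_cons] at hn; omega) (by simpa using e)
            obtain ⟨l, hl, hl'⟩ := h.exists_both a b (by rw [ht]; rfl) (by rw [ht, hs])
            exact ⟨l :: v, by rw [List.flatMap_cons, hv]; simp [hl, hl', ht]⟩
    · rw [List.flatMap_cons, List.flatMap_cons, letterMap_forkFst_inr, letterMap_forkSnd_inr] at e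
      rcases hs : sT b with _ | _ | _
      · rw [hs] at e
        obtain ⟨v, hv⟩ := ih w (by simpa using hn) (by simpa using e)
        obtain ⟨l, hl⟩ := h.exists_snd b hs
        have hf : f l = none := by
          by_contra hf
          obtain ⟨x, hx⟩ := Option.ne_none_iff_exists'.mp hf
          have h₁ := h.both hx (by rw [hl]; rfl)
          have h₂ := h.mid l
          rw [hx, hl] at h₂
          change tS x = sT b at h₂
          rw [h₂, hs] at h₁
          simp at h₁
        exact ⟨l :: v, by rw [List.flatMap_cons, hv]; simp [hl, hf]⟩
      -- Middle image `O`: the second fork has `O` right after `b`, so the next letter must be an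
      -- `a` over `O`, the only kind whose image under the first fork begins with `O`.
      · rw [hs] at e
        simp only [List.cons_append, List.nil_append, List.cons.injEq, true_and] at e
        rcases w with _ | ⟨a | b', w⟩
        · simp at e
        · rw [List.flatMap_cons, List.flatMap_cons, letterMap_forkSnd_inl, letterMap_forkFst_inl] at e
          rcases ht : tS a with _ | _ | _
          · rw [ht] at e; simp at e
          · rw [ht] at e
            obtain ⟨v, hv⟩ := ih w (by simp only [List.length_cons] at hn; omega) (by simpa using e)
            obtain ⟨l, hl, hl'⟩ := h.exists_both a b (by rw [ht]; rfl) (by rw [ht, hs])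
            exact ⟨l :: v, by rw [List.flatMap_cons, hv]; simp [hl, hl', ht]⟩
          · rw [ht] at e; simp at e
        · rw [List.flatMap_cons, List.flatMap_cons, letterMap_forkFst_inr] at e
          simp at e
      -- Middle image `P`: now the second fork begins with the middle letter and the first one with
      -- `b`.
      · rw [hs] at e
        simp at e

-- A letter of the composite is recovered from its first component if there is one, and otherwise
-- from its second. A second component that has a partner is sent to the empty word, lest the pair
-- be counted twice.
open Classical in
theorem IsComposite.retraction (h : IsComposite tS sT f g) :
    ∃ ψ : LS ⊕ LT → List LE, ∀ e, (letterMap (incl tS f g) e).flatMap ψ = [e] := by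
  refine ⟨Sum.elim
    (fun a => if ha : ∃ e, f e = some a then [ha.choose] else [])
    (fun b => if hb : ∃ e, g e = some b ∧ f e = none then [hb.choose] else []), ?_⟩
  intro e
  rw [letterMap_incl]
  have hfst : ∀ a, f e = some a →
      (if ha : ∃ e, f e = some a then [ha.choose] else []) = [e] := by
    intro a ha
    rw [dif_pos ⟨e, ha⟩]
    exact congrArg (fun e => [e]) (h.inj₁ (Exists.choose_spec (⟨e, ha⟩ : ∃ e, f e = some a)) ha)
  have hsnd : ∀ b, g e = some b → f e = none →
      (if hb : ∃ e, g e = some b ∧ f e = none then [hb.choose] else []) = [e] := by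
    intro b hb hf
    rw [dif_pos ⟨e, hb, hf⟩]
    exact congrArg (fun e => [e]) (h.inj₂
      (Exists.choose_spec (⟨e, hb, hf⟩ : ∃ e, g e = some b ∧ f e = none)).1 hb)
  have hnone : ∀ a b, f e = some a → g e = some b →
      (if hb : ∃ e, g e = some b ∧ f e = none then [hb.choose] else []) = [] := by
    intro a b ha hb
    rw [dif_neg]
    rintro ⟨e', hb', hf'⟩
    rw [h.inj₂ hb' hb, ha] at hf'
    simp at hf'
  rcases ha : f e with _ | a <;> rcases hb : g e with _ | b
  · have := h.cover e
    simp [ha, hb] at this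
  · simpa using hsnd b hb ha
  · simpa using hfst a ha
  · dsimp only
    have h₁ := hfst a ha
    have h₂ := hnone a b ha hb
    rcases tS a with _ | _ | _ <;>
      simp only [List.flatMap_cons, List.flatMap_nil, Sum.elim_inl, Sum.elim_inr, h₁, h₂] <;> rfl

/-- The 1-cells are handled by `IsComposite.retraction` and `IsComposite.word`, and the 2-cells by
the gluing of bijections. In the equalizing condition, the middle letter inserted by either fork
falls between the two letters of a pair. -/
theorem IsComposite.isWordEqualizer (h : IsComposite tS sT f g) :
    IsWordEqualizer (incl tS f g) (forkFst tS) (forkSnd sT) := by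
  have hm := h.mid
  have hc : incl tS f g ≫ forkFst tS = incl tS f g ≫ forkSnd sT := by
    have hl : ∀ e, letterMap (incl tS f g ≫ forkFst tS) e =
        letterMap (incl tS f g ≫ forkSnd sT) e := by
      intro e
      have hm := h.mid e
      rcases hf : f e with _ | a <;> rcases hg : g e with _ | b
      · simp [hf, hg]
      · rw [hf, hg] at hm
        have hs : sT b = none := hm.symm
        simp [hf, hg, hs]
      · rw [hf, hg] at hm
        have ht : tS a = none := hm
        simp [hf, hg, ht]
      · rw [hf, hg] at hm
        have hs : sT b = tS a := hm.symm
        have := h.both hf (by rw [hg]; rfl)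
        rcases ht : tS a with _ | _ | _
        · rw [ht] at this; simp at this
        · simp [hf, hg, ht, hs]
        · simp [hf, hg, ht, hs]
    refine ext_letterMap hl (by simp) (ext_letterMap (letterMap_comp_congr hl _) ?_ ?_)
    · simp [funext hm]
    · simp
  refine ⟨hc, h.retraction, fun w => h.word w.length w le_rfl, ?_, ?_⟩
  · intro x y u v η θ e
    exact h.hom₂_ext (congrArg GrayHom₂.fst e :) (congrArg GrayHom₂.snd e :)
  · intro x y u v θ e
    -- The middle-game component of `e`. There the two forks give the restrictions of the two
    -- components of `θ`, so this is the compatibility required for gluing.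
    have e' := map₂_heq_of_heq (P := π₂ (free LS) (gray anchorGame (free LT)) ≫ π₁ _ _)
      (Coded.obj_eq _ _) (Coded.obj_eq _ _) (map_congr hc u) (map_congr hc v) e
    have e₁ : forkFst (LT := LT) tS ≫ π₂ (free LS) (gray anchorGame (free LT)) ≫ π₁ _ _ =
          π₁ _ _ ≫ partialMap tS := by simp
    have e₂ : forkSnd (LS := LS) sT ≫ π₂ (free LS) (gray anchorGame (free LT)) ≫ π₁ _ _ =
          π₂ _ _ ≫ partialMap sT := by simp
    have e₃ := ((map₂_congr e₁ θ).symm.trans e').trans (map₂_congr e₂ θ)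
    obtain ⟨κ, h₁, h₂⟩ := h.exists_glue (u := u) (v := v) (GrayHom₂.fst θ) (GrayHom₂.snd θ) e₃
    exact ⟨κ, Gray.hom₂_ext' h₁ h₂⟩

/-- A synchronized letter has a middle image on both sides, so `hS` and `hT` leave it without
external image; any other letter has a single component, whose external image is kept. Hence the
induced coaction is again polarized, and composites can be iterated. -/
theorem incl_coact (h : IsComposite tS sT f g) {sS : LS → Option GameMove}
    {tT : LT → Option GameMove} (hS : ∀ l, sS l = none ∨ tS l = none)
    (hT : ∀ l, sT l = none ∨ tT l = none) :
    coact (fun e => (f e).bind sS) (fun e => (g e).bind tT) ≫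
      grayMap (𝟙 anchorGame) (grayMap (incl tS f g) (𝟙 anchorGame)) =
    incl tS f g ≫ grayMap (leftCoact sS) (rightCoact tT) ≫
      assocHom anchorGame (free LS) (gray (free LT) anchorGame) ≫
      grayMap (𝟙 anchorGame) (assocInv (free LS) (free LT) anchorGame) := by
  have hl : ∀ e, letterMap (coact (fun e => (f e).bind sS) (fun e => (g e).bind tT) ≫
      grayMap (𝟙 anchorGame) (grayMap (incl tS f g) (𝟙 anchorGame))) e =
    letterMap (incl tS f g ≫ grayMap (leftCoact sS) (rightCoact tT) ≫
      assocHom anchorGame (free LS) (gray (free LT) anchorGame) ≫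
      grayMap (𝟙 anchorGame) (assocInv (free LS) (free LT) anchorGame)) e := by
    intro e
    have hm := h.mid e
    rcases hf : f e with _ | a <;> rcases hg : g e with _ | b
    · simp [hf, hg]
    · rcases ht : tT b with _ | _ | _ <;> simp [hf, hg, ht]
    · rcases hs : sS a with _ | _ | _ <;> simp [hf, hg, hs]
    · rw [hf, hg] at hm
      have hs : sT b = tS a := hm.symm
      have := h.both hf (by rw [hg]; rfl)
      have ha := hS a
      have hb := hT b
      rw [hs] at hb
      rcases ht : tS a with _ | _ | _
      · rw [ht] at this; simp at this
      · rw [ht] at ha hb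
        simp only [reduceCtorEq, or_false, false_or] at ha hb
        simp [hf, hg, ht, ha, hb]
      · rw [ht] at ha hb
        simp only [reduceCtorEq, or_false, false_or] at ha hb
        simp [hf, hg, ht, ha, hb]
  refine ext_letterMap hl ?_ (ext_letterMap (letterMap_comp_congr hl _)
    (ext_letterMap (letterMap_comp_congr (letterMap_comp_congr hl _) _) ?_ ?_) ?_) <;> simp

theorem IsComposite.disjoint (h : IsComposite tS sT f g) {sS : LS → Option GameMove}
    {tT : LT → Option GameMove} (hS : ∀ l, sS l = none ∨ tS l = none) (e : LE) :
    (f e).bind sS = none ∨ (g e).bind tT = none := by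
  have hm := h.mid e
  rcases hf : f e with _ | a
  · exact Or.inl rfl
  rcases hg : g e with _ | b
  · exact Or.inr rfl
  rw [hf, hg] at hm
  have := h.both hf (by rw [hg]; rfl)
  rcases hS a with ha | ha
  · exact Or.inl ha
  · rw [ha] at this; simp at this

attribute [local instance] gameComonObj

/-- The horizontal composite of two polarized bicomodules. -/
@[reducible] noncomputable def IsComposite.hComposite (h : IsComposite tS sT f g)
    {sS : LS → Option GameMove} {tT : LT → Option GameMove}
    (hS : ∀ l, sS l = none ∨ tS l = none) (hT : ∀ l, sT l = none ∨ tT l = none) :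
    HComposite (polarized sS tS hS) (polarized sT tT hT) :=
  have h₁ : (polarized sS tS hS).fork₁ (polarized sT tT hT) = forkFst tS := by
    rw [BicomoduleStr.fork₁, polarized_right]; rfl
  have h₂ : (polarized sS tS hS).fork₂ (polarized sT tT hT) = forkSnd sT := by
    rw [BicomoduleStr.fork₂, polarized_left]; rfl
  have H : IsWordEqualizer (incl tS f g) ((polarized sS tS hS).fork₁ (polarized sT tT hT))
      ((polarized sS tS hS).fork₂ (polarized sT tT hT)) := by
    have H := h.isWordEqualizer
    rw [← h₁, ← h₂] at H
    exact H
  { obj := free LE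
    equ := incl tS f g
    condition := H.condition
    isLimit := H.isLimit
    -- The word criterion, unlike the mere property of being an equalizer, passes to the tensored
    -- pair.
    tensor_condition := ((H.grayRight anchorGame).grayLeft anchorGame).condition
    tensor_isLimit := ((H.grayRight anchorGame).grayLeft anchorGame).isLimit
    str := polarized (fun e => (f e).bind sS) (fun e => (g e).bind tT) (h.disjoint hS)
    coact_equ := by
      rw [polarized_left, polarized_right]
      exact incl_coact h hS hT }

end Composite

/-! ### Strategies: twofold and threefold composites, and multiplication -/

section Strategies

/-- The move of the source game. -/
def StratMove.src : StratMove → Option GameMove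
  | .Os => some .P
  | .Ps => some .O
  | .Ot => none
  | .Pt => none

/-- The move of the target game. -/
def StratMove.tgt : StratMove → Option GameMove
  | .Os => none
  | .Ps => none
  | .Ot => some .O
  | .Pt => some .P

namespace StratMove₂

/-- The move of the first strategy. -/
def fst : StratMove₂ → Option StratMove
  | .Os => some .Os
  | .Ps => some .Ps
  | .PO => some .Ot
  | .OP => some .Pt
  | .Ot => none
  | .Pt => none

/-- The move of the second strategy. -/
def snd : StratMove₂ → Option StratMove
  | .Os => none
  | .Ps => none
  | .PO => some .Ps
  | .OP => some .Os
  | .Ot => some .Ot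
  | .Pt => some .Pt

/-- The external move. -/
def visible : StratMove₂ → Option StratMove
  | .Os => some .Os
  | .Ps => some .Ps
  | .PO => none
  | .OP => none
  | .Ot => some .Ot
  | .Pt => some .Pt

end StratMove₂

namespace StratMove₃

/-- The move of the first strategy. -/
def fst : StratMove₃ → Option StratMove
  | .Os => some .Os
  | .Ps => some .Ps
  | .POs => some .Ot
  | .OPs => some .Pt
  | _ => none

/-- The move of the third strategy. -/
def thd : StratMove₃ → Option StratMove
  | .POt => some .Ps
  | .OPt => some .Os
  | .Ot => some .Ot
  | .Pt => some .Pt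
  | _ => none

/-- The move of the first two strategies. -/
def init : StratMove₃ → Option StratMove₂
  | .Os => some .Os
  | .Ps => some .Ps
  | .POs => some .PO
  | .OPs => some .OP
  | .POt => some .Ot
  | .OPt => some .Pt
  | .Ot => none
  | .Pt => none

/-- The move of the last two strategies. -/
def last : StratMove₃ → Option StratMove₂
  | .Os => none
  | .Ps => none
  | .POs => some .Ps
  | .OPs => some .Os
  | .POt => some .PO
  | .OPt => some .OP
  | .Ot => some .Ot
  | .Pt => some .Pt

/-- The move of the composite of the first two strategies and of the third one. -/
def hideInit : StratMove₃ → Option StratMove₂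
  | .Os => some .Os
  | .Ps => some .Ps
  | .POs => none
  | .OPs => none
  | .POt => some .PO
  | .OPt => some .OP
  | .Ot => some .Ot
  | .Pt => some .Pt

/-- The move of the first strategy and of the composite of the last two ones. -/
def hideLast : StratMove₃ → Option StratMove₂
  | .Os => some .Os
  | .Ps => some .Ps
  | .POs => some .PO
  | .OPs => some .OP
  | .POt => none
  | .OPt => none
  | .Ot => some .Ot
  | .Pt => some .Pt

end StratMove₃

open StratMove

theorem strat_disjoint (l : StratMove) : src l = none ∨ tgt l = none := by
  cases l <;> simp [src, tgt]

/-- With an empty middle game nothing is synchronized and the four strategy moves are the moves of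
two separate games. This identifies the strategy bicomodule with the tensor square of the game, the
source carrying reversed names; it serves to build the unit and to compare 2-functors into
strategies. -/
theorem isComposite_game : IsComposite (fun _ => none) (fun _ => none) src tgt where
  cover l := by cases l <;> simp [src, tgt]
  mid l := by cases l <;> rfl
  both {l x} h h' := by cases l <;> simp [src, tgt] at h h'
  inj₁ {l l' x} h h' := by cases l <;> cases h <;> cases l' <;> first | rfl | cases h'
  inj₂ {l l' x} h h' := by cases l <;> cases h <;> cases l' <;> first | rfl | cases h'
  exists_fst a _ := by cases a; exacts [⟨Ps, rfl⟩, ⟨Os, rfl⟩]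
  exists_snd a _ := by cases a; exacts [⟨Ot, rfl⟩, ⟨Pt, rfl⟩]
  exists_both a b h _ := by simp at h

/-- The synchronized pairs are `Ot` with `Ps`, over the middle move `O`, and `Pt` with `Os`, over
`P`. -/
theorem isComposite₂ : IsComposite tgt src StratMove₂.fst StratMove₂.snd where
  cover l := by cases l <;> simp [StratMove₂.fst, StratMove₂.snd]
  mid l := by cases l <;> rfl
  both {l x} h h' := by cases l <;> cases h <;> first | rfl | cases h'
  inj₁ {l l' x} h h' := by cases l <;> cases h <;> cases l' <;> first | rfl | cases h'
  inj₂ {l l' x} h h' := by cases l <;> cases h <;> cases l' <;> first | rfl | cases h'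
  exists_fst a h := by
    cases a
    exacts [⟨.Os, rfl⟩, ⟨.Ps, rfl⟩, ⟨.PO, rfl⟩, ⟨.OP, rfl⟩]
  exists_snd a h := by
    cases a
    exacts [⟨.OP, rfl⟩, ⟨.PO, rfl⟩, ⟨.Ot, rfl⟩, ⟨.Pt, rfl⟩]
  exists_both a b h h' := by
    cases a <;> cases b <;> 
      first | exact ⟨.PO, rfl, rfl⟩ | exact ⟨.OP, rfl, rfl⟩ | simp [src, tgt] at h h'

/-- The moves of two interacting strategies in the target game. -/
abbrev tgt₂ (e : StratMove₂) : Option GameMove := (StratMove₂.snd e).bind tgt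

/-- The moves of two interacting strategies in the source game. -/
abbrev src₂ (e : StratMove₂) : Option GameMove := (StratMove₂.fst e).bind src

theorem isComposite₃ : IsComposite tgt₂ src StratMove₃.init StratMove₃.thd where
  cover l := by cases l <;> simp [StratMove₃.init, StratMove₃.thd]
  mid l := by cases l <;> rfl
  both {l x} h h' := by cases l <;> cases h <;> first | rfl | cases h'
  inj₁ {l l' x} h h' := by cases l <;> cases h <;> cases l' <;> first | rfl | cases h'
  inj₂ {l l' x} h h' := by cases l <;> cases h <;> cases l' <;> first | rfl | cases h'
  exists_fst a h := by
    cases a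
    exacts [⟨.Os, rfl⟩, ⟨.Ps, rfl⟩, ⟨.POs, rfl⟩, ⟨.OPs, rfl⟩, ⟨.POt, rfl⟩, ⟨.OPt, rfl⟩]
  exists_snd a h := by
    cases a
    exacts [⟨.OPt, rfl⟩, ⟨.POt, rfl⟩, ⟨.Ot, rfl⟩, ⟨.Pt, rfl⟩]
  exists_both a b h h' := by
    cases a <;> cases b <;>
      first | exact ⟨.POt, rfl, rfl⟩ | exact ⟨.OPt, rfl, rfl⟩ |
        simp [tgt₂, StratMove₂.snd, src, tgt] at h h'

/-- The alphabet is the same as for the other bracketing, so the associativity isomorphism can be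
the identity. -/
theorem isComposite₃' : IsComposite tgt src₂ StratMove₃.fst StratMove₃.last where
  cover l := by cases l <;> simp [StratMove₃.fst, StratMove₃.last]
  mid l := by cases l <;> rfl
  both {l x} h h' := by cases l <;> cases h <;> first | rfl | cases h'
  inj₁ {l l' x} h h' := by cases l <;> cases h <;> cases l' <;> first | rfl | cases h'
  inj₂ {l l' x} h h' := by cases l <;> cases h <;> cases l' <;> first | rfl | cases h'
  exists_fst a h := by
    cases a
    exacts [⟨.Os, rfl⟩, ⟨.Ps, rfl⟩, ⟨.POs, rfl⟩, ⟨.OPs, rfl⟩]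
  exists_snd a h := by
    cases a
    exacts [⟨.OPs, rfl⟩, ⟨.POs, rfl⟩, ⟨.POt, rfl⟩, ⟨.OPt, rfl⟩, ⟨.Ot, rfl⟩, ⟨.Pt, rfl⟩]
  exists_both a b h h' := by
    cases a <;> cases b <;>
      first | exact ⟨.POs, rfl, rfl⟩ | exact ⟨.OPs, rfl, rfl⟩ |
        simp [src₂, StratMove₂.fst, src, tgt] at h h'

theorem partialMap_congr {L L' : Type} {h k : L → Option L'} (e : ∀ l, h l = k l) :
    partialMap h = partialMap k := by rw [funext e]

/-- This lemma and `coact_strat` match the general construction with the explicit coaction of the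
statement. -/
theorem rightCoact_strat : rightCoact tgt = stratCoactRight := by
  refine ext_letterMap ?_ ((toGray_π₁ _ _ _).trans (toGray_π₁ _ _ _).symm)
    (((toGray_π₂ _ _ _).trans (partialMap_congr (by rintro (_ | _) <;> rfl))).trans
      (toGray_π₂ _ _ _).symm)
  intro l
  refine (letterMap_toGray _ _ _ l).trans (Eq.trans ?_ (letterMap_toGray _ _ _ l).symm)
  cases l <;> rfl

theorem coact_strat : coact src tgt = stratCoact := by
  refine ext_letterMap ?_ (((toGray_π₁ _ _ _).trans
      (partialMap_congr (by rintro (_ | _) <;> rfl))).trans (toGray_π₁ _ _ _).symm)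
    (((toGray_π₂ _ _ _).trans rightCoact_strat).trans (toGray_π₂ _ _ _).symm)
  intro l
  refine (letterMap_toGray _ _ _ l).trans (Eq.trans ?_ (letterMap_toGray _ _ _ l).symm)
  cases l <;> rfl

/-- The 2-functor which sends a move in the source or in the target game to this move in the
corresponding component. -/
noncomputable abbrev inclGame : free StratMove ⟶ gray anchorGame anchorGame :=
  incl (fun _ => none) src tgt

/-- The inclusion of two interacting strategies. -/
noncomputable abbrev inclStrat₂ : free StratMove₂ ⟶ gray (free StratMove) (free StratMove) :=
  incl tgt StratMove₂.fst StratMove₂.snd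

/-- The inclusion of three interacting strategies, the first two ones being composed. -/
noncomputable abbrev inclStrat₃ : free StratMove₃ ⟶ gray (free StratMove₂) (free StratMove) :=
  incl tgt₂ StratMove₃.init StratMove₃.thd

/-- The inclusion of three interacting strategies, the last two ones being composed. -/
noncomputable abbrev inclStrat₃' : free StratMove₃ ⟶ gray (free StratMove) (free StratMove₂) :=
  incl tgt StratMove₃.fst StratMove₃.last

theorem inclStrat₂_eq : inclStrat₂ = incl₂ := by
  refine ext_letterMap ?_
    (((toGray_π₁ _ _ _).trans (partialMap_congr (by rintro (_ | _) <;> rfl))).trans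
      (toGray_π₁ _ _ _).symm)
    (((toGray_π₂ _ _ _).trans (partialMap_congr (by rintro (_ | _) <;> rfl))).trans
      (toGray_π₂ _ _ _).symm)
  intro l
  refine (letterMap_toGray _ _ _ l).trans (Eq.trans ?_ (letterMap_toGray _ _ _ l).symm)
  cases l <;> rfl

/-- The first two strategies see a letter as a letter of their own composite, or not at all: `Ot`
and `Pt` give the empty word. -/
theorem code_inclLeftWord₃ (l : StratMove₃) :
    Coded.code (A := gray anchorStrat anchorStrat) (inclLeftWord₃ l) =
      (StratMove₃.init l).toList.flatMap (letterMap inclStrat₂) := by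
  have h : ∀ e, letterMap inclStrat₂ e = Coded.code (A := gray anchorStrat anchorStrat)
      (inclWord tgt StratMove₂.fst StratMove₂.snd e) := letterMap_toGray _ _ _
  cases l
  case Ot => exact code_gray_id _
  case Pt => exact code_gray_id _
  all_goals
    simp only [StratMove₃.init, Option.toList_some, List.flatMap_cons, List.flatMap_nil,
      List.append_nil, h]
    rfl

theorem inclLeft₃_eq : partialMap StratMove₃.init ≫ inclStrat₂ = inclLeft₃ := by
  refine ext_letterMap ?_ ?_ ?_
  · intro l
    rw [letterMap_comp, letterMap_partialMap, ← code_inclLeftWord₃]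
    exact (letterMap_toGray _ _ _ l).symm
  · rw [Category.assoc, incl_π₁, partialMap_comp]
    exact (partialMap_congr (by rintro (_ | _) <;> rfl)).trans (toGray_π₁ _ _ _).symm
  · rw [Category.assoc, incl_π₂, partialMap_comp]
    exact (partialMap_congr (by rintro (_ | _) <;> rfl)).trans (toGray_π₂ _ _ _).symm

theorem code_inclWord₃ (l : StratMove₃) :
    Coded.code (A := gray (gray anchorStrat anchorStrat) anchorStrat) (inclWord₃ l) =
      (letterMap inclStrat₃ l).flatMap (letterMap (grayMap inclStrat₂ (𝟙 (free StratMove)))) := by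
  have h : ∀ l, Coded.code (A := gray (gray anchorStrat anchorStrat) anchorStrat)
      (Gray.inl (B := anchorStrat) (inclLeftWord₃ l) FreeObj.mk) =
        ((StratMove₃.init l).toList.flatMap (letterMap inclStrat₂)).map Sum.inl := fun l =>
    code_inl' (code_inclLeftWord₃ l) _
  cases l
  case POt =>
    exact (code_gray_comp _ _).trans ((congrArg₂ (· ++ ·) (code_rgt _ _) (h _)).trans
      (by simp [StratMove₃.init, StratMove₃.thd, tgt₂, tgt, StratMove₂.fst, StratMove₂.snd]))
  case OPt =>
    exact (code_gray_comp _ _).trans ((congrArg₂ (· ++ ·) (h _) (code_rgt _ _)).trans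
      (by simp [StratMove₃.init, StratMove₃.thd, tgt₂, tgt, StratMove₂.fst, StratMove₂.snd]))
  case Ot => exact (code_rgt _ _).trans (by simp [StratMove₃.init, StratMove₃.thd])
  case Pt => exact (code_rgt _ _).trans (by simp [StratMove₃.init, StratMove₃.thd])
  case Os => exact (h .Os).trans (by simp [StratMove₃.init, StratMove₃.thd])
  case Ps => exact (h .Ps).trans (by simp [StratMove₃.init, StratMove₃.thd])
  case POs => exact (h .POs).trans (by simp [StratMove₃.init, StratMove₃.thd])
  case OPs => exact (h .OPs).trans (by simp [StratMove₃.init, StratMove₃.thd])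

theorem inclStrat₃_eq : inclStrat₃ ≫ grayMap inclStrat₂ (𝟙 (free StratMove)) = incl₃ := by
  refine ext_letterMap ?_ ?_ ?_
  · intro l
    rw [letterMap_comp, ← code_inclWord₃]
    exact (letterMap_toGray _ _ _ l).symm
  · rw [Category.assoc, grayMap_π₁, incl_π₁_assoc, inclLeft₃_eq]
    exact (toGray_π₁ _ _ _).symm
  · rw [Category.assoc, grayMap_π₂, incl_π₂_assoc, Category.comp_id]
    exact (partialMap_congr (by rintro (_ | _) <;> rfl)).trans (toGray_π₂ _ _ _).symm

/-- Every letter has the same expansion through either bracketing; for instance `POt` gives `Ps ·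
Ot` in components 3 and 2, whether this pair is synchronized in the inner or in the outer composite.
-/
theorem inclStrat₃_assoc :
    inclStrat₃' ≫ grayMap (𝟙 (free StratMove)) inclStrat₂ =
      inclStrat₃ ≫ grayMap inclStrat₂ (𝟙 (free StratMove)) ≫ assocHom _ _ _ := by
  have hl : ∀ l, letterMap (inclStrat₃' ≫ grayMap (𝟙 (free StratMove)) inclStrat₂) l =
      letterMap (inclStrat₃ ≫ grayMap inclStrat₂ (𝟙 (free StratMove)) ≫ assocHom _ _ _) l := by
    intro l
    cases l <;> simp [StratMove₃.init, StratMove₃.thd, StratMove₃.fst, StratMove₃.last, StratMove₂.fst,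
      StratMove₂.snd, tgt₂, tgt]
  -- Three leaves remain, one for each strategy, and each is an identity of partial functions on
  -- letters.
  refine ext_letterMap hl ?_ (ext_letterMap (letterMap_comp_congr hl _) ?_ ?_)
  all_goals
    simp only [Category.assoc, grayMap_π₁, grayMap_π₂, assocHom_π₁, assocHom_π₂, grayMap_π₁_assoc,
      incl_π₁, incl_π₂, incl_π₁_assoc, incl_π₂_assoc, partialMap_comp, Category.comp_id]
    exact partialMap_congr (by rintro (_ | _) <;> rfl)

/-- Composition: the internal moves are erased. -/
noncomputable abbrev stratMult : free StratMove₂ ⟶ free StratMove := partialMap StratMove₂.visible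

/-- Internal moves have no image in the outer games, so erasing them commutes with recording the
external ones. -/
theorem stratMult_coact :
    stratMult ≫ coact src tgt =
      coact src₂ tgt₂ ≫ grayMap (𝟙 anchorGame) (grayMap stratMult (𝟙 anchorGame)) := by
  have hl : ∀ l, letterMap (stratMult ≫ coact src tgt) l =
      letterMap (coact src₂ tgt₂ ≫ grayMap (𝟙 anchorGame) (grayMap stratMult (𝟙 anchorGame))) l := by
    intro l
    cases l <;> simp [StratMove₂.fst, StratMove₂.snd, StratMove₂.visible, src₂, tgt₂, src, tgt]
  refine ext_letterMap hl ?_ (ext_letterMap (letterMap_comp_congr hl _) ?_ ?_)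
  · simp only [Category.assoc, grayMap_π₁, coact_π₁, partialMap_comp, Category.comp_id]
    exact partialMap_congr (by rintro (_ | _) <;> rfl)
  · simp
  · simp only [Category.assoc, grayMap_π₂, coact_π₂, coact_π₂_assoc, rightCoact_π₂,
      partialMap_comp, Category.comp_id]
    exact partialMap_congr (by rintro (_ | _) <;> rfl)

/-- Shows that `hideInit` is the horizontal composite of the multiplication with an identity; the
moves between the last two strategies stay synchronized because `Ot` and `Pt` are kept by the
multiplication. -/
theorem hideInit_incl :
    partialMap StratMove₃.hideInit ≫ inclStrat₂ = inclStrat₃ ≫ grayMap stratMult (𝟙 (free StratMove)) := by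
  refine ext_letterMap ?_ ?_ ?_
  · intro l
    cases l <;> simp [StratMove₃.init, StratMove₃.thd, StratMove₃.hideInit, StratMove₂.fst,
      StratMove₂.snd, StratMove₂.visible, tgt₂, tgt]
  all_goals
    simp only [Category.assoc, grayMap_π₁, grayMap_π₂, incl_π₁, incl_π₂, incl_π₁_assoc,
      partialMap_comp, Category.comp_id]
    exact partialMap_congr (by rintro (_ | _) <;> rfl)

theorem hideLast_incl :
    partialMap StratMove₃.hideLast ≫ inclStrat₂ =
      inclStrat₃' ≫ grayMap (𝟙 (free StratMove)) stratMult := by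
  refine ext_letterMap ?_ ?_ ?_
  · intro l
    cases l <;> simp [StratMove₃.fst, StratMove₃.last, StratMove₃.hideLast, StratMove₂.fst,
      StratMove₂.snd, StratMove₂.visible, tgt]
  all_goals
    simp only [Category.assoc, grayMap_π₁, grayMap_π₂, incl_π₁, incl_π₂, incl_π₂_assoc,
      partialMap_comp, Category.comp_id]
    exact partialMap_congr (by rintro (_ | _) <;> rfl)

end Strategies

/-! ### The unit and the neutrality laws -/

section Unit

open StratMove

/-- One letter must become two, so no partial function on letters will do. The comultiplication is
factored instead through the identification of strategies with pairs of games; the condition to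
check is harmless, as no middle letter is ever inserted. -/
theorem exists_stratUnit : ∃ U : anchorGame ⟶ free StratMove, U ≫ inclGame = gameComul := by
  refine isComposite_game.isWordEqualizer.exists_lift gameComul ?_
  have hl : ∀ m, letterMap (gameComul ≫ forkFst (LT := GameMove) (fun _ : GameMove => none)) m =
      letterMap (gameComul ≫ forkSnd (LS := GameMove) (fun _ : GameMove => none)) m := by
    rintro (_ | _) <;> simp
  refine ext_letterMap hl (by simp) (ext_letterMap (letterMap_comp_congr hl _) ?_ ?_)
  · simp
  · simp

/-- The unit: every move is copied from the target to the source or from the source to the target. -/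
noncomputable def stratUnit : anchorGame ⟶ free StratMove := exists_stratUnit.choose

theorem stratUnit_inclGame : stratUnit ≫ inclGame = gameComul := exists_stratUnit.choose_spec

@[simp] theorem stratUnit_src : stratUnit ≫ partialMap src = 𝟙 _ := by
  rw [← incl_π₁ (fun _ => none) src tgt, ← Category.assoc, stratUnit_inclGame, gameComul_π₁]

@[simp] theorem stratUnit_tgt : stratUnit ≫ partialMap tgt = 𝟙 _ := by
  rw [← incl_π₂ (fun _ => none) src tgt, ← Category.assoc, stratUnit_inclGame, gameComul_π₂]

/-- A composite with an inclusion determines the image of a letter. -/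
theorem letterMap_of_comp_incl {X : TwoCat} {Λ LS LT LE : Type} [Coded X Λ]
    {tS : LS → Option GameMove} {sT : LT → Option GameMove} {f : LE → Option LS} {g : LE → Option LT}
    (h : IsComposite tS sT f g) {F : X ⟶ free LE} {l : Λ} {w : List LE}
    (e : letterMap (F ≫ incl tS f g) l = w.flatMap (letterMap (incl tS f g))) :
    letterMap F l = w := by
  obtain ⟨ψ, hψ⟩ := h.retraction
  exact flatMap_injective_of_retraction hψ ((letterMap_comp _ _ _).symm.trans e)

@[simp] theorem letterMap_stratUnit_O : letterMap stratUnit GameMove.O = [Ot, Ps] :=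
  letterMap_of_comp_incl isComposite_game (by rw [stratUnit_inclGame]; simp [src, tgt])

@[simp] theorem letterMap_stratUnit_P : letterMap stratUnit GameMove.P = [Os, Pt] :=
  letterMap_of_comp_incl isComposite_game (by rw [stratUnit_inclGame]; simp [src, tgt])

/-- Both sides send `O` to `O₃ · Ot · Ps · O₁` and `P` to `P₁ · Os · Pt · P₃`. -/
theorem stratUnit_coact :
    stratUnit ≫ coact src tgt = (gameComul ≫ grayMap (𝟙 anchorGame) gameComul) ≫
      grayMap (𝟙 anchorGame) (grayMap stratUnit (𝟙 anchorGame)) := by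
  have hl : ∀ m, letterMap (stratUnit ≫ coact src tgt) m =
      letterMap ((gameComul ≫ grayMap (𝟙 anchorGame) gameComul) ≫
        grayMap (𝟙 anchorGame) (grayMap stratUnit (𝟙 anchorGame))) m := by
    rintro (_ | _) <;> simp [src, tgt]
  refine ext_letterMap hl ?_ (ext_letterMap (letterMap_comp_congr hl _) ?_ ?_) <;> simp

/-- The copycat inserted on the left synchronizes with the strategy: `Os` becomes `Os · Pt` in the
first component followed by `Os` in the second, and both forks put the middle `P` between the last
two. -/
theorem leftCoact_src_fork :
    (leftCoact src ≫ grayMap stratUnit (𝟙 (free StratMove))) ≫ forkFst tgt =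
      (leftCoact src ≫ grayMap stratUnit (𝟙 (free StratMove))) ≫ forkSnd src := by
  have hl : ∀ l, letterMap ((leftCoact src ≫ grayMap stratUnit (𝟙 (free StratMove))) ≫ forkFst tgt) l =
      letterMap ((leftCoact src ≫ grayMap stratUnit (𝟙 (free StratMove))) ≫ forkSnd src) l := by
    intro l
    cases l <;> simp [src, tgt]
  refine ext_letterMap hl ?_ (ext_letterMap (letterMap_comp_congr hl _) ?_ ?_) <;> simp

theorem rightCoact_tgt_fork :
    (rightCoact tgt ≫ grayMap (𝟙 (free StratMove)) stratUnit) ≫ forkFst tgt =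
      (rightCoact tgt ≫ grayMap (𝟙 (free StratMove)) stratUnit) ≫ forkSnd src := by
  have hl : ∀ l, letterMap ((rightCoact tgt ≫ grayMap (𝟙 (free StratMove)) stratUnit) ≫ forkFst tgt) l =
      letterMap ((rightCoact tgt ≫ grayMap (𝟙 (free StratMove)) stratUnit) ≫ forkSnd src) l := by
    intro l
    cases l <;> simp [src, tgt]
  refine ext_letterMap hl ?_ (ext_letterMap (letterMap_comp_congr hl _) ?_ ?_) <;> simp

theorem exists_unitLeft : ∃ U : free StratMove ⟶ free StratMove₂,
    U ≫ inclStrat₂ = leftCoact src ≫ grayMap stratUnit (𝟙 (free StratMove)) :=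
  isComposite₂.isWordEqualizer.exists_lift _ leftCoact_src_fork

theorem exists_unitRight : ∃ U : free StratMove ⟶ free StratMove₂,
    U ≫ inclStrat₂ = rightCoact tgt ≫ grayMap (𝟙 (free StratMove)) stratUnit :=
  isComposite₂.isWordEqualizer.exists_lift _ rightCoact_tgt_fork

/-- `inclGame` is a monomorphism with projections `src` and `tgt`. This tests equality for
2-functors into strategies that are not given by partial functions. -/
theorem hom_ext_strat {X : TwoCat} {Λ : Type} [Coded X Λ] {F G : X ⟶ free StratMove}
    (h : ∀ l, letterMap F l = letterMap G l) (h₁ : F ≫ partialMap src = G ≫ partialMap src)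
    (h₂ : F ≫ partialMap tgt = G ≫ partialMap tgt) : F = G :=
  isComposite_game.isWordEqualizer.hom_ext (ext_letterMap (letterMap_comp_congr h _)
    (by simpa using h₁) (by simpa using h₂))

/-- Internal moves have no source. Expressing the source through `inclStrat₂` is what allows it to
be computed for the lifted units, which are known only after this inclusion. -/
theorem stratMult_src : stratMult ≫ partialMap src = inclStrat₂ ≫ π₁ _ _ ≫ partialMap src := by
  rw [incl_π₁_assoc, partialMap_comp, partialMap_comp]
  exact partialMap_congr (by rintro (_ | _) <;> rfl)

theorem stratMult_tgt : stratMult ≫ partialMap tgt = inclStrat₂ ≫ π₂ _ _ ≫ partialMap tgt := by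
  rw [incl_π₂_assoc, partialMap_comp, partialMap_comp]
  exact partialMap_congr (by rintro (_ | _) <;> rfl)

/-- Injectivity of the inclusion on words recovers the letters of `U`: it inserts internal copycat
moves `OP` and `PO`, which the multiplication erases. The 2-cells are controlled by the source and
the target. -/
theorem unitLeft_mult {U : free StratMove ⟶ free StratMove₂}
    (h : U ≫ inclStrat₂ = leftCoact src ≫ grayMap stratUnit (𝟙 (free StratMove))) :
    U ≫ stratMult = 𝟙 _ := by
  have hU : ∀ (l : StratMove) (w : List StratMove₂),
      letterMap (leftCoact src ≫ grayMap stratUnit (𝟙 (free StratMove))) l =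
        w.flatMap (letterMap inclStrat₂) → letterMap U l = w := fun l w e =>
    letterMap_of_comp_incl isComposite₂ (by rw [h]; exact e)
  -- The coaction gives `P₁ · Os`, and the unit replaces `P₁` by `Os · Pt`; this `Pt` pairs with the
  -- original `Os` into `OP`. Dually, the `Ps` of the next line pairs with the `Ot` of the copy of
  -- `O₁`.
  have hs := hU Os [.Os, .OP] (by simp [src, tgt, StratMove₂.fst, StratMove₂.snd])
  have hs' := hU Ps [.PO, .Ps] (by simp [src, tgt, StratMove₂.fst, StratMove₂.snd])
  have ht := hU Ot [.Ot] (by simp [src, StratMove₂.fst, StratMove₂.snd])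
  have ht' := hU Pt [.Pt] (by simp [src, StratMove₂.fst, StratMove₂.snd])
  refine hom_ext_strat ?_ ?_ ?_
  · intro l
    cases l <;> simp [hs, hs', ht, ht', StratMove₂.visible]
  · rw [Category.assoc, stratMult_src, ← Category.assoc, h]; simp
  · rw [Category.assoc, stratMult_tgt, ← Category.assoc, h]; simp

theorem unitRight_mult {U : free StratMove ⟶ free StratMove₂}
    (h : U ≫ inclStrat₂ = rightCoact tgt ≫ grayMap (𝟙 (free StratMove)) stratUnit) :
    U ≫ stratMult = 𝟙 _ := by
  have hU : ∀ (l : StratMove) (w : List StratMove₂),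
      letterMap (rightCoact tgt ≫ grayMap (𝟙 (free StratMove)) stratUnit) l =
        w.flatMap (letterMap inclStrat₂) → letterMap U l = w := fun l w e =>
    letterMap_of_comp_incl isComposite₂ (by rw [h]; exact e)
  have hs := hU Os [.Os] (by simp [tgt, StratMove₂.fst, StratMove₂.snd])
  have hs' := hU Ps [.Ps] (by simp [tgt, StratMove₂.fst, StratMove₂.snd])
  -- On this side the copycat comes second: `O₃ · Ot` becomes `Ot · Ps` in the second component
  -- followed by the original `Ot` in the first, and the last two form `PO`.
  have ht := hU Ot [.Ot, .PO] (by simp [tgt, StratMove₂.fst, StratMove₂.snd])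
  have ht' := hU Pt [.OP, .Pt] (by simp [tgt, StratMove₂.fst, StratMove₂.snd])
  refine hom_ext_strat ?_ ?_ ?_
  · intro l
    cases l <;> simp [hs, hs', ht, ht', StratMove₂.visible]
  · rw [Category.assoc, stratMult_src, ← Category.assoc, h]; simp
  · rw [Category.assoc, stratMult_tgt, ← Category.assoc, h]; simp

/-- In either order, all four kinds of internal moves end up erased. -/
theorem hideInit_mult : partialMap StratMove₃.hideInit ≫ stratMult =
    partialMap StratMove₃.hideLast ≫ stratMult := by
  rw [partialMap_comp, partialMap_comp]
  exact partialMap_congr (by rintro (_ | _) <;> rfl)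

end Unit

/-! ### The internal category and the theorem -/

section InternalCategory

open StratMove

attribute [local instance] gameComonObj

/-- The internal category of polarities of strategies. -/
noncomputable def stratCategory : InternalCategory anchorGame anchorStrat where
  bicomodule := polarized src tgt strat_disjoint
  comp₂ := isComposite₂.hComposite strat_disjoint strat_disjoint
  comp₃ := isComposite₃.hComposite (isComposite₂.disjoint strat_disjoint) strat_disjoint
  comp₃' := isComposite₃'.hComposite strat_disjoint (isComposite₂.disjoint strat_disjoint)
  -- Both bracketings are realized on the same 2-category of words, so only their inclusions need to
  -- be compared.
  assoc := Iso.refl (free StratMove₃)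
  assoc_equ := (Category.id_comp _).trans inclStrat₃_assoc
  mult := stratMult
  mult_hom := stratMult_coact
  unit := stratUnit
  unit_hom := stratUnit_coact
  multLeft := partialMap StratMove₃.hideInit
  multLeft_equ := hideInit_incl
  multRight := partialMap StratMove₃.hideLast
  multRight_equ := hideLast_incl
  unitLeft := exists_unitLeft.choose
  unitLeft_equ := by
    rw [polarized_left]
    exact exists_unitLeft.choose_spec
  unitRight := exists_unitRight.choose
  unitRight_equ := by
    rw [polarized_right]
    exact exists_unitRight.choose_spec
  mult_assoc := hideInit_mult.trans (Category.id_comp _).symm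
  unit_mult := unitLeft_mult exists_unitLeft.choose_spec
  mult_unit := unitRight_mult exists_unitRight.choose_spec

end InternalCategory

theorem mainTheorem3 :
    ∃ (comonoid : ComonObj anchorGame) (M : InternalCategory anchorGame anchorStrat),
      comonoid.comul = gameComul ∧ comonoid.counit = gameCounit ∧
      M.bicomodule.coact = stratCoact ∧
      (∃ e₂ : free StratMove₂ ≅ M.comp₂.obj,
        e₂.hom ≫ M.comp₂.equ = incl₂ ∧ e₂.hom ≫ M.mult = hide) ∧
      (∃ e₃ : free StratMove₃ ≅ M.comp₃.obj,
        e₃.hom ≫ M.comp₃.equ ≫ M.comp₂.equ ▷ anchorStrat = incl₃) := by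
  -- The composites were constructed on the required 2-categories of words, so the isomorphisms are
  -- identities and only the explicit forms of the inclusions and of the multiplication remain.
  refine ⟨gameComonObj, stratCategory, rfl, rfl, coact_strat, ⟨Iso.refl _, ?_, ?_⟩, ⟨Iso.refl _, ?_⟩⟩
  · exact (Category.id_comp _).trans inclStrat₂_eq
  · exact (Category.id_comp _).trans (partialMap_congr (by rintro (_ | _) <;> rfl))
  · exact (Category.id_comp _).trans inclStrat₃_eq
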